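/- Let $d\ge 1$. A *univariate wavelet system* is a pair $\eta_0,\eta_1$ of bandlimited (compactly supported Fourier transform) complex Schwartz functions on $\mathbb{R}$ that are the scaling function and the mother wavelet of an orthonormal multiresolution analysis of $L_2(\mathbb{R})$: if $V_j$ and $W_j$ ($j\in\mathbb{Z}$) are the closed spans in $L_2(\mathbb{R})$ of the functions $\eta_0((\cdot-2^jk)/2^j)$, respectively $\eta_1((\cdot-2^jk)/2^j)$, $k\in\mathbb{Z}$, then the integer translates of $\eta_0$ are orthonormal, those of $\eta_1$ are orthonormal, $V_{j+1}\subset V_j$, $\bigcup_j V_j$ is dense, $\bigcap_j V_j=\{0\}$, and $W_j$ is the orthogonal complement of $V_j$ in $V_{j-1}$. Fix such a system. Let $\mathcal{D}_j$ be the set of pairs $(I,e)$ of a dyadic cube $I=2^j(k+[0,1]^d)$, $k\in\mathbb{Z}^d$, and a gender $e\in\{0,1\}^d\setminus\{0\}$; let $\mathcal{D}=\bigcup_{j\in\mathbb{Z}}\mathcal{D}_j$. Put $\psi_{I,e}(x)=\prod_{m=1}^d\eta_{e_m}\big((x_m-2^jk_m)/2^j\big)$ and $f_{I,e}=|I|^{-1}\int_{\mathbb{R}^d}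 f\,\overline{\psi_{I,e}}$, the coefficients of the wavelet expansion $f=\sum f_{I,e}\psi_{I,e}$; the gender is suppressed below. For $s>0$ let $1/\tau=s/d$ and $1/q=1+s/d$. The Besov space $B^s_{\tau,q}$ consists of the measurable $f:\mathbb{R}^d\to\mathbb{C}$ in $L_\tau$ that are tempered, i.e. $\int |f(x)|(1+|x|)^{-M}\,dx<\infty$ for some $M\in\mathbb{N}$ (automatic if $\tau\ge1$), and for which $$|f|_{B^s_{\tau,q}}:=\Big(\sum_{j\in\mathbb{Z}}A_j^q\Big)^{1/q}<\infty,\qquad A_j:=\Big(\sum_{I\in\mathcal{D}_j}|f_I|^\tau\Big)^{1/\tau}.$$ **Theorem.** There is an integer $N_0\ge 0$, depending only on $d$ and the wavelet system, such that for every $s>0$ there is a constant $C>0$, depending only on $s$, $d$ and the wavelet system, with the following property. For every integer $N\ge1$ and every $f\in B^s_{\tau,q}$, where $1/\tau=s/d$ and $1/q=1+s/d$, there is a linear combination of $N$ Gaussians $$s_f(x)=\sum_{j=1}^N a_j\exp\big[-(|x-\xi_j|/\sigma_j)^2\big],\qquad a_j\in\mathbb{C},\ \xi_j\in\mathbb{R}^d,\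 \sigma_j>0$$ (zero coefficients are allowed), such that $$\|f-s_f\|_\infty\le C\,N^{-s/d}\,|f|_{B^s_{\tau,q}}.$$ Moreover, $s_f$ can be taken of the form $s_f=\sum_{I\in\mathcal{D}}f_I\,S_I$, where each $S_I$ is a linear combination of $N_I$ Gaussians, and the budgets $N_I$ come from the Besov cost distribution $$\mathrm{c}_I=N\,|f|_{B^s_{\tau,q}}^{-q}\,A_j^{q-\tau}\,|f_I|^\tau\quad(I\in\mathcal{D}_j),\qquad N_I=\begin{cases}\lfloor \mathrm{c}_I\rfloor,&\lfloor \mathrm{c}_I\rfloor\ge N_0,\\0,&\text{otherwise}\end{cases}$$ ($\mathrm{c}_I:=0$ if $f_I=0$); only finitely many $N_I$ are nonzero, and $\sum_I N_I\le N$. -/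

import Mathlib

open MeasureTheory
open scoped ENNReal SchwartzMap FourierTransform ComplexConjugate

noncomputable section

/-- Closed linear span in `L²(ℝ; ℂ)` of the functions `x ↦ η ((x - 2^j k) / 2^j)`, `k ∈ ℤ`,
i.e. of the versions of `η` attached to the dyadic intervals of length `2^j`. -/
def levelSpace (η : 𝓢(ℝ, ℂ)) (j : ℤ) : Submodule ℂ (Lp ℂ 2 (volume : Measure ℝ)) :=
  (Submodule.span ℂ {g : Lp ℂ 2 (volume : Measure ℝ) |
    ∃ k : ℤ, g =ᵐ[volume] fun x : ℝ => η ((x - 2 ^ j * k) / 2 ^ j)}).topologicalClosure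

/-- A univariate wavelet system: an orthonormal multiresolution analysis of `L²(ℝ; ℂ)` generated
by a bandlimited Schwartz scaling function `η 0`, with a bandlimited Schwartz mother
wavelet `η 1`. Larger `j` means coarser scale. -/
structure IsWaveletSystem (η : Fin 2 → 𝓢(ℝ, ℂ)) : Prop where
  /-- Both generators are bandlimited. -/
  bandlimited : ∀ i, HasCompactSupport (𝓕 (η i : ℝ → ℂ))
  /-- The integer translates of each generator are orthonormal. -/
  orthonormal : ∀ (i : Fin 2) (k l : ℤ),
    ∫ x : ℝ, η i (x - k) * conj (η i (x - l)) = if k = l then 1 else 0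
  /-- The approximation spaces `V_j` are nested. -/
  nested : ∀ j : ℤ, levelSpace (η 0) (j + 1) ≤ levelSpace (η 0) j
  /-- The union of the `V_j` is dense. -/
  dense : (⨆ j : ℤ, levelSpace (η 0) j).topologicalClosure = ⊤
  /-- The intersection of the `V_j` is trivial. -/
  inter : ⨅ j : ℤ, levelSpace (η 0) j = ⊥
  /-- The wavelet space `W_j` is the orthogonal complement of `V_j` in `V_{j-1}`. -/
  wavelet : ∀ j : ℤ,
    levelSpace (η 1) j = levelSpace (η 0) (j - 1) ⊓ (levelSpace (η 0) j)ᗮ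

/-- Position and gender of a wavelet at a fixed dyadic level: `(k, e)` with `k ∈ ℤ^d` and
`e ∈ {0,1}^d \ {0}`. -/
abbrev LevelIndex (d : ℕ) : Type := (Fin d → ℤ) × {e : Fin d → Fin 2 // e ≠ 0}

/-- `(j, (k, e))` stands for the dyadic cube `I = 2^j (k + [0,1]^d)` together with the
gender `e`. -/
abbrev WaveletIndex (d : ℕ) : Type := ℤ × LevelIndex d

/-- The tensor product wavelet `ψ_{I,e}(x) = ψ_e ((x - c(I)) / ℓ(I))`, where
`ψ_e(y) = ∏ m, η_{e_m}(y_m)`, `c(I) = 2^j k` and `ℓ(I) = 2^j`. -/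
def waveletFun {d : ℕ} (η : Fin 2 → 𝓢(ℝ, ℂ)) (i : WaveletIndex d)
    (x : EuclideanSpace ℝ (Fin d)) : ℂ :=
  ∏ m : Fin d, η (i.2.2.1 m) ((x m - 2 ^ i.1 * i.2.1 m) / 2 ^ i.1)

/-- The coefficient `f_{I,e}` of `ψ_{I,e}` in the wavelet expansion `f = ∑ f_{I,e} ψ_{I,e}`.
As `‖ψ_{I,e}‖₂² = |I|`, it is `|I|⁻¹ ∫ f conj(ψ_{I,e})`, with `|I| = (2^j)^d`. -/
def waveletCoeff {d : ℕ} (η : Fin 2 → 𝓢(ℝ, ℂ)) (f : EuclideanSpace ℝ (Fin d) → ℂ)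
    (i : WaveletIndex d) : ℂ :=
  ((((2 : ℝ) ^ i.1) ^ d : ℝ) : ℂ)⁻¹ * ∫ x, f x * conj (waveletFun η i x)

/-- The energy `A_j = (∑_{I ∈ D_j} |f_I|^τ)^{1/τ}` of `f` at the dyadic level `j`. -/
def levelEnergy {d : ℕ} (η : Fin 2 → 𝓢(ℝ, ℂ)) (τ : ℝ) (f : EuclideanSpace ℝ (Fin d) → ℂ)
    (j : ℤ) : ℝ≥0∞ :=
  (∑' κ : LevelIndex d, ‖waveletCoeff η f (j, κ)‖ₑ ^ τ) ^ (1 / τ)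

/-- The Besov quasi-seminorm `(∑_{j ∈ ℤ} A_j^q)^{1/q}`, for smoothness `s = d / τ`. -/
def besovSeminorm {d : ℕ} (η : Fin 2 → 𝓢(ℝ, ℂ)) (τ q : ℝ)
    (f : EuclideanSpace ℝ (Fin d) → ℂ) : ℝ≥0∞ :=
  (∑' j : ℤ, levelEnergy η τ f j ^ q) ^ (1 / q)

/-- Membership in the Besov space `B^s_{τ,q}`, `s = d / τ`. -/
structure MemBesov {d : ℕ} (η : Fin 2 → 𝓢(ℝ, ℂ)) (τ q : ℝ)
    (f : EuclideanSpace ℝ (Fin d) → ℂ) : Prop where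
  /-- `f` is an `L_τ` function. -/
  memLp : MemLp f (ENNReal.ofReal τ) volume
  /-- `f` is a tempered distribution, so that its wavelet coefficients are defined. This is
  automatic for `τ ≥ 1`. -/
  tempered : ∃ M : ℕ, Integrable (fun x => (((1 + ‖x‖) ^ M)⁻¹ : ℝ) • f x) volume
  /-- The quasi-seminorm is finite. -/
  finite : besovSeminorm η τ q f < ∞

/-- `g` is a linear combination of `n` Gaussians with arbitrary centers `ξ` and tensions `σ`.
Zero coefficients are allowed, so this means "at most `n` Gaussians". -/
def IsGaussianSum {d : ℕ} (n : ℕ) (g : EuclideanSpace ℝ (Fin d) → ℂ) : Prop :=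
  ∃ (A : Fin n → ℂ) (ξ : Fin n → EuclideanSpace ℝ (Fin d)) (σ : Fin n → ℝ),
    (∀ j, 0 < σ j) ∧
    ∀ x, g x = ∑ j, A j * (Real.exp (-(‖x - ξ j‖ / σ j) ^ 2) : ℂ)

/-- The Besov cost `c_I = N |f|^{-q} A_j^{q-τ} |f_I|^τ` of a wavelet. -/
def besovCost {d : ℕ} (η : Fin 2 → 𝓢(ℝ, ℂ)) (τ q : ℝ) (N : ℕ)
    (f : EuclideanSpace ℝ (Fin d) → ℂ) (i : WaveletIndex d) : ℝ :=
  N * (besovSeminorm η τ q f).toReal ^ (-q) * (levelEnergy η τ f i.1).toReal ^ (q - τ)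
    * ‖waveletCoeff η f i‖ ^ τ

/-- The budget `N_I` of a wavelet: `⌊c_I⌋` if this is at least `N₀`, and `0` otherwise. -/
def besovBudget {d : ℕ} (η : Fin 2 → 𝓢(ℝ, ℂ)) (τ q : ℝ) (N₀ N : ℕ)
    (f : EuclideanSpace ℝ (Fin d) → ℂ) (i : WaveletIndex d) : ℕ :=
  if N₀ ≤ ⌊besovCost η τ q N f i⌋₊ then ⌊besovCost η τ q N f i⌋₊ else 0

end

/-! The error is estimated wavelet by wavelet. A bandlimited wavelet is approximated by `n`
Gaussians with error `C (1 + n)^(-1/τ)` times an envelope that decays like the wavelet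
(`exists_isGaussianSum_norm_waveletFun_sub_le`). The cost is designed so that `|f_I| c_I^(-1/τ)` is
the same for all wavelets of a level, namely `N^(-1/τ) |f|^(1-q) A_j^q`, and rounding is harmless
because `c_I ≤ 1 + N_I` (`norm_waveletCoeff_mul_rpow_le`). The envelopes of one level sum to a
bounded function (`summable_levelIndex_decay`), and `∑ A_j^q = |f|^q`, so the errors add up to a
multiple of `N^(-s/d) |f|`. The same identity shows that the costs sum to at most `N`
(`summable_besovCost`).

The Gaussian approximation is a quadrature. Since `φ` is bandlimited and the Fourier transform of a
Gaussian `γ` has no zeros, `φ = κ * γ` with `κ` Schwartz. The trapezoidal rule for this convolution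
has an error of every algebraic order by Poisson summation, and truncating it leaves finitely many
translates of `γ` (`exists_gaussian_quadrature`). Tensor products of such sums are again sums of
radial Gaussians.

What remains is that `f` equals its wavelet series almost everywhere (`IsWaveletSystem.ae_eq_tsum`).
As `f` is merely tempered and in `L_τ`, with `τ` possibly below `1`, the Hilbert space theory does
not apply to `f` directly. The relation between `V_(j-1)`, `V_j` and `W_j` is therefore turned into
a pointwise identity of rapidly decaying kernels (`IsWaveletSystem.levelKernel_pred`), so that the
projections `P_j f` make sense and telescope into the wavelet levels; these are summable uniformly
because `q ≤ 1`. At fine scales `P_j f` tends to `f`, because the kernels have integral one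
(`IsWaveletSystem.integral_shiftKernel`, from the density of the `V_j`). At coarse scales the limit
`p` is annihilated by a high finite difference in one coordinate (`tendsto_fwdDiff_iter_levelProj`),
hence is polynomial along discrete rays. But `f` and its wavelet series tend to zero along almost
every such ray, so `p` does too, and then `p` vanishes. -/

/-- The polynomially decaying weight `(1 + ‖x‖)^{-L}`. -/
noncomputable def decay {E : Type*} [SeminormedAddCommGroup E] (L : ℕ) (x : E) : ℝ :=
  ((1 + ‖x‖) ^ L)⁻¹

/-! ### Polynomial weights and their lattice sums -/

section Decay

variable {E : Type*} [SeminormedAddCommGroup E]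

lemma decay_pos (L : ℕ) (x : E) : 0 < decay L x := by
  have := norm_nonneg x
  unfold decay; positivity

lemma decay_nonneg (L : ℕ) (x : E) : 0 ≤ decay L x := (decay_pos L x).le

lemma decay_le_one (L : ℕ) (x : E) : decay L x ≤ 1 := by
  have := norm_nonneg x
  exact inv_le_one_of_one_le₀ (one_le_pow₀ (by linarith))

lemma decay_add (K L : ℕ) (x : E) : decay (K + L) x = decay K x * decay L x := by
  simp only [decay, pow_add, mul_inv]

lemma decay_anti {K L : ℕ} (h : K ≤ L) (x : E) : decay L x ≤ decay K x := by
  have := norm_nonneg x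
  unfold decay
  gcongr
  linarith

@[simp] lemma decay_neg (L : ℕ) (x : E) : decay L (-x) = decay L x := by
  simp [decay]

lemma decay_sub_comm (L : ℕ) (x y : E) : decay L (x - y) = decay L (y - x) := by
  rw [← decay_neg, neg_sub]

/-- This is `1 + ‖x - y‖ ≤ (1 + ‖x‖)(1 + ‖y‖)`. It converts the decay of two functions about a
common centre into off-diagonal decay of the kernel built from them. -/
lemma decay_mul_le (L : ℕ) (x y : E) : decay L x * decay L y ≤ decay L (x - y) := by
  have hx := norm_nonneg x
  have hy := norm_nonneg y
  unfold decay
  rw [← mul_inv, ← mul_pow]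
  gcongr
  nlinarith [norm_sub_le x y, mul_nonneg hx hy]

lemma decay_add_le (L : ℕ) (x y : E) : decay L (x + y) ≤ (1 + ‖y‖) ^ L * decay L x := by
  have hx := norm_nonneg x
  have hy := norm_nonneg y
  have h := norm_nonneg (x + y)
  unfold decay
  rw [inv_le_iff_one_le_mul₀ (by positivity), mul_right_comm, ← div_eq_mul_inv,
    one_le_div (by positivity), ← mul_pow]
  gcongr
  have := norm_sub_le (x + y) y
  rw [add_sub_cancel_right] at this
  nlinarith

lemma decay_continuous (L : ℕ) : Continuous (decay L : E → ℝ) := by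
  unfold decay
  refine Continuous.inv₀ (by fun_prop) fun x => ?_
  have := norm_nonneg x
  positivity

/-- From `1 + ‖y‖ ≤ (1 + a)(1 + ‖x‖)(1 + ‖x - y‖ / a)`. The explicit growth of order `a^L` matters
at coarse scales, where it must be beaten by finite differences. -/
lemma decay_smul_sub_le [NormedSpace ℝ E] (L : ℕ) {a : ℝ} (ha : 0 < a) (x y : E) :
    decay L (a⁻¹ • (x - y)) ≤ ((1 + a) * (1 + ‖x‖)) ^ L * decay L y := by
  have hx := norm_nonneg x
  have hy := norm_nonneg y
  have h := norm_nonneg (x - y)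
  unfold decay
  rw [norm_smul, norm_inv, Real.norm_of_nonneg ha.le, inv_le_iff_one_le_mul₀ (by positivity),
    mul_right_comm, ← div_eq_mul_inv, one_le_div (by positivity), ← mul_pow]
  gcongr
  have h1 : ‖y‖ ≤ ‖x‖ + ‖x - y‖ := by
    have := norm_sub_le x (x - y)
    rwa [sub_sub_cancel] at this
  have h2 : ‖x - y‖ = a * (a⁻¹ * ‖x - y‖) := (mul_inv_cancel_left₀ ha.ne' _).symm
  have h3 : 0 ≤ a⁻¹ * ‖x - y‖ := by positivity
  generalize a⁻¹ * ‖x - y‖ = t at h2 h3 ⊢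
  have h4 : 0 ≤ ‖x‖ * t := by positivity
  have h5 : 0 ≤ a * ‖x‖ := by positivity
  have h6 : 0 ≤ a * ‖x‖ * t := by positivity
  nlinarith

end Decay

lemma integrable_decay {E : Type*} [NormedAddCommGroup E] [NormedSpace ℝ E]
    [FiniteDimensional ℝ E] [MeasurableSpace E] [BorelSpace E] (μ : Measure E)
    [μ.IsAddHaarMeasure] {L : ℕ} (hL : Module.finrank ℝ E < L) :
    Integrable (decay L : E → ℝ) μ := by
  have h := integrable_one_add_norm (E := E) (μ := μ) (r := L) (by exact_mod_cast hL)
  refine h.congr (Filter.Eventually.of_forall fun x => ?_)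
  have := norm_nonneg x
  simp only [decay]
  rw [Real.rpow_neg (by positivity), Real.rpow_natCast]

lemma integrable_decay_real {L : ℕ} (hL : 2 ≤ L) : Integrable (decay L : ℝ → ℝ) :=
  integrable_decay volume (by rw [Module.finrank_self]; omega)

/-- A bound for the sum of `h * decay 2` over translates of the lattice `h ℤ`, `0 < h ≤ 1`. -/
noncomputable def decaySum : ℝ := 4 * ∫ t : ℝ, decay 2 t

lemma decaySum_nonneg : 0 ≤ decaySum :=
  mul_nonneg (by norm_num) (integral_nonneg fun _ => decay_nonneg _ _)

/-- Each term is compared with the integral of `h * decay 2 (h t)` over a unit interval starting at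
`u / h + k`. There the argument moves by at most `h ≤ 1`, which costs a factor `(1 + 1)^2 = 4`, and
the total integral does not depend on `h`. -/
lemma summable_decay_lattice {h : ℝ} (h0 : 0 < h) (h1 : h ≤ 1) (u : ℝ) :
    Summable (fun k : ℤ => h * decay 2 (h * k + u)) ∧
      ∑' k : ℤ, h * decay 2 (h * k + u) ≤ decaySum := by
  have hint : Integrable (fun t : ℝ => h * decay 2 (h * t)) :=
    ((integrable_decay_real le_rfl).comp_mul_left' h0.ne').const_mul h
  have hs := (hint.hasSum_intervalIntegral (u / h)).mul_left 4
  have htot : ∫ t : ℝ, h * decay 2 (h * t) = ∫ t : ℝ, decay 2 t := by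
    rw [integral_const_mul, Measure.integral_comp_mul_left (fun t : ℝ => decay 2 t) h,
      abs_of_pos (by positivity), smul_eq_mul, mul_inv_cancel_left₀ h0.ne']
  rw [htot] at hs
  have hle : ∀ k : ℤ, h * decay 2 (h * k + u) ≤
      4 * ∫ t in (u / h + k)..(u / h + k + 1), h * decay 2 (h * t) := by
    intro k
    have : ∫ t in (u / h + k)..(u / h + k + 1), h * decay 2 (h * k + u) ≤
        ∫ t in (u / h + k)..(u / h + k + 1), 4 * (h * decay 2 (h * t)) := by
      refine intervalIntegral.integral_mono_on (by linarith) (by simp)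
        ((hint.const_mul 4).intervalIntegrable) fun t ht => ?_
      have hb := decay_add_le 2 (h * t) (h * k + u - h * t)
      rw [add_sub_cancel] at hb
      have hn : ‖h * k + u - h * t‖ ≤ 1 := by
        have hu : h * (u / h) = u := mul_div_cancel₀ u h0.ne'
        have e : h * k + u - h * t = h * (u / h + k - t) := by rw [mul_sub, mul_add, hu]; ring
        rw [e, Real.norm_eq_abs, abs_mul, abs_of_pos h0]
        have : |u / h + k - t| ≤ 1 := abs_le.2 ⟨by linarith [ht.2], by linarith [ht.1]⟩
        nlinarith [abs_nonneg (u / h + k - t)]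
      have hq : (1 + ‖h * k + u - h * t‖) ^ 2 ≤ 4 := by
        nlinarith [norm_nonneg (h * k + u - h * t)]
      calc h * decay 2 (h * k + u) ≤ h * (4 * decay 2 (h * t)) := by
            refine mul_le_mul_of_nonneg_left (hb.trans ?_) h0.le
            exact mul_le_mul_of_nonneg_right hq (decay_nonneg _ _)
        _ = _ := by ring
    simpa using this
  have hsum := Summable.of_nonneg_of_le (fun k => mul_nonneg h0.le (decay_nonneg _ _)) hle
    hs.summable
  exact ⟨hsum, (hsum.tsum_le_tsum hle hs.summable).trans hs.tsum_eq.le⟩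

lemma summable_decay_int {L : ℕ} (hL : 2 ≤ L) (x : ℝ) :
    Summable fun k : ℤ => decay L (x - k) := by
  refine Summable.of_nonneg_of_le (fun k => decay_nonneg _ _) (fun k => decay_anti hL _) ?_
  refine (summable_decay_lattice one_pos le_rfl (-x)).1.congr fun k => ?_
  rw [decay_sub_comm]; simp [sub_eq_add_neg]

lemma tsum_decay_int_le {L : ℕ} (hL : 2 ≤ L) (x : ℝ) :
    ∑' k : ℤ, decay L (x - k) ≤ decaySum := by
  refine ((summable_decay_int hL x).tsum_le_tsum (fun k => decay_anti hL _)
    (summable_decay_int le_rfl x)).trans (le_trans (le_of_eq (tsum_congr fun k => ?_))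
    (summable_decay_lattice one_pos le_rfl (-x)).2)
  rw [decay_sub_comm]; simp [sub_eq_add_neg]

lemma exists_schwartz_le_decay (φ : 𝓢(ℝ, ℂ)) (L : ℕ) :
    ∃ C : ℝ, 0 < C ∧ ∀ x, ‖φ x‖ ≤ C * decay L x := by
  refine ⟨2 ^ L * ((Finset.Iic (L, 0)).sup
    (fun m => SchwartzMap.seminorm ℝ m.1 m.2)) φ + 1, by positivity, fun x => ?_⟩
  have h := SchwartzMap.one_add_le_sup_seminorm_apply (𝕜 := ℝ) (m := (L, 0)) le_rfl le_rfl φ x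
  rw [norm_iteratedFDeriv_zero] at h
  have hp : 0 < (1 + ‖x‖) ^ L := by have := norm_nonneg x; positivity
  unfold decay
  rw [← div_eq_mul_inv, le_div_iff₀ hp, mul_comm]
  linarith

/-! ### Sums over integer translates -/

/-- The majorants move with `x`, so uniform convergence is only local: where `π x` is within `1` of
`π x₀`, they are dominated by `4` times those at `x₀`. -/
lemma continuous_tsum_of_le_decay {X F : Type*} [TopologicalSpace X] [NormedAddCommGroup F]
    [CompleteSpace F] {π : X → ℝ} (hπ : Continuous π) {f : ℤ → X → F} (hf : ∀ k, Continuous (f k))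
    {C : ℝ} (hb : ∀ k x, ‖f k x‖ ≤ C * decay 2 (π x - k)) :
    Continuous fun x => ∑' k, f k x := by
  rw [continuous_iff_continuousAt]
  intro x₀
  have hC : 0 ≤ C := by
    have := (norm_nonneg _).trans (hb 0 x₀)
    exact nonneg_of_mul_nonneg_left this (decay_pos _ _)
  set U : Set X := {x | |π x - π x₀| < 1} with hU
  have hUo : IsOpen U := isOpen_lt (by fun_prop) continuous_const
  have hx₀ : x₀ ∈ U := by simp [hU]
  have hc : ContinuousOn (fun x => ∑' k, f k x) U := by
    refine continuousOn_tsum (u := fun k : ℤ => C * (4 * decay 2 (π x₀ - k)))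
      (fun k => (hf k).continuousOn) (((summable_decay_int le_rfl _).mul_left 4).mul_left C) ?_
    intro k x hx
    refine (hb k x).trans (mul_le_mul_of_nonneg_left ?_ hC)
    have h := decay_add_le 2 (π x₀ - k) (π x - π x₀)
    have e : π x₀ - k + (π x - π x₀) = π x - k := by ring
    rw [e] at h
    refine h.trans (mul_le_mul_of_nonneg_right ?_ (decay_nonneg _ _))
    have h1 : ‖π x - π x₀‖ < 1 := hx
    nlinarith [norm_nonneg (π x - π x₀)]
  exact hc.continuousAt (hUo.mem_nhds hx₀)

/-- The kernel `∑ k, α(x - k) conj β(y - k)`. -/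
noncomputable def shiftKernel (α β : ℝ → ℂ) (x y : ℝ) : ℂ :=
  ∑' k : ℤ, α (x - k) * conj (β (y - k))

section ShiftKernel

variable {α β : ℝ → ℂ} {A B : ℝ} {L : ℕ}

/-- Of the `L + 2` orders of decay, `L` from each factor combine into decay off the diagonal, and
the remaining `2` of the first factor make the sum over `k` converge. -/
lemma norm_shiftKernel_term_le (hα : ∀ x, ‖α x‖ ≤ A * decay (L + 2) x)
    (hβ : ∀ x, ‖β x‖ ≤ B * decay (L + 2) x) (x y : ℝ) (k : ℤ) :
    ‖α (x - k) * conj (β (y - k))‖ ≤ A * B * decay L (x - y) * decay 2 (x - k) := by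
  have hA : 0 ≤ A := nonneg_of_mul_nonneg_left ((norm_nonneg _).trans (hα 0)) (decay_pos _ _)
  have hB : 0 ≤ B := nonneg_of_mul_nonneg_left ((norm_nonneg _).trans (hβ 0)) (decay_pos _ _)
  rw [norm_mul, RCLike.norm_conj]
  calc ‖α (x - k)‖ * ‖β (y - k)‖
      ≤ (A * decay (L + 2) (x - k)) * (B * decay (L + 2) (y - k)) :=
        mul_le_mul (hα _) (hβ _) (norm_nonneg _) (mul_nonneg hA (decay_nonneg _ _))
    _ ≤ (A * decay (L + 2) (x - k)) * (B * decay L (y - k)) :=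
        mul_le_mul_of_nonneg_left (mul_le_mul_of_nonneg_left (decay_anti (by omega) _) hB)
          (mul_nonneg hA (decay_nonneg _ _))
    _ = A * B * (decay L (x - k) * decay L (y - k)) * decay 2 (x - k) := by
        rw [decay_add]; ring
    _ ≤ A * B * decay L (x - y) * decay 2 (x - k) := by
        refine mul_le_mul_of_nonneg_right (mul_le_mul_of_nonneg_left ?_ (mul_nonneg hA hB))
          (decay_nonneg _ _)
        refine (decay_mul_le L _ _).trans_eq ?_
        congr 1; ring

lemma summable_shiftKernel (hα : ∀ x, ‖α x‖ ≤ A * decay (L + 2) x)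
    (hβ : ∀ x, ‖β x‖ ≤ B * decay (L + 2) x) (x y : ℝ) :
    Summable fun k : ℤ => ‖α (x - k) * conj (β (y - k))‖ :=
  Summable.of_nonneg_of_le (fun _ => norm_nonneg _) (norm_shiftKernel_term_le hα hβ x y)
    ((summable_decay_int le_rfl x).mul_left _)

lemma norm_shiftKernel_le (hα : ∀ x, ‖α x‖ ≤ A * decay (L + 2) x)
    (hβ : ∀ x, ‖β x‖ ≤ B * decay (L + 2) x) (x y : ℝ) :
    ‖shiftKernel α β x y‖ ≤ A * B * decaySum * decay L (x - y) := by
  have hA : 0 ≤ A := nonneg_of_mul_nonneg_left ((norm_nonneg _).trans (hα 0)) (decay_pos _ _)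
  have hB : 0 ≤ B := nonneg_of_mul_nonneg_left ((norm_nonneg _).trans (hβ 0)) (decay_pos _ _)
  have h := tsum_of_norm_bounded ((summable_decay_int le_rfl x).mul_left
    (A * B * decay L (x - y))).hasSum (norm_shiftKernel_term_le hα hβ x y)
  refine h.trans ?_
  rw [tsum_mul_left]
  calc A * B * decay L (x - y) * ∑' k : ℤ, decay 2 (x - k)
      ≤ A * B * decay L (x - y) * decaySum :=
        mul_le_mul_of_nonneg_left (tsum_decay_int_le le_rfl x)
          (mul_nonneg (mul_nonneg hA hB) (decay_nonneg _ _))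
    _ = _ := by ring

lemma continuous_shiftKernel (hα : ∀ x, ‖α x‖ ≤ A * decay (L + 2) x)
    (hβ : ∀ x, ‖β x‖ ≤ B * decay (L + 2) x) (hαc : Continuous α) (hβc : Continuous β) :
    Continuous fun p : ℝ × ℝ => shiftKernel α β p.1 p.2 := by
  refine continuous_tsum_of_le_decay (π := Prod.fst) continuous_fst
    (C := A * B) (fun k => ?_) fun k p => ?_
  · exact (hαc.comp (by fun_prop)).mul (Complex.continuous_conj.comp (hβc.comp (by fun_prop)))
  · have hA : 0 ≤ A := nonneg_of_mul_nonneg_left ((norm_nonneg _).trans (hα 0)) (decay_pos _ _)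
    have hB : 0 ≤ B := nonneg_of_mul_nonneg_left ((norm_nonneg _).trans (hβ 0)) (decay_pos _ _)
    refine (norm_shiftKernel_term_le hα hβ p.1 p.2 k).trans
      (mul_le_mul_of_nonneg_right ?_ (decay_nonneg _ _))
    exact mul_le_of_le_one_right (mul_nonneg hA hB) (decay_le_one _ _)

end ShiftKernel

/-! ### Orthogonal projections -/

section Hilbert

variable {H : Type*} [NormedAddCommGroup H] [InnerProductSpace ℂ H]

/-- Rescaled by `c^(-1/2)`, the family is a Hilbert basis of its closed span, and the projection is
the basis expansion. The scaling is kept explicit because the dyadic atoms have squared norm `2^j`.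
-/
lemma hasSum_inner_starProjection_span [CompleteSpace H] {ι : Type*} {e : ι → H} {c : ℝ} (hc : 0 < c)
    [DecidableEq ι] (he : ∀ k l, inner ℂ (e k) (e l) = if k = l then (c : ℂ) else 0) (u v : H) :
    HasSum (fun k => (c : ℂ)⁻¹ * (inner ℂ u (e k) * inner ℂ (e k) v))
      (inner ℂ u ((Submodule.span ℂ (Set.range e)).topologicalClosure.starProjection v)) := by
  set V := (Submodule.span ℂ (Set.range e)).topologicalClosure with hV
  have hcc : (c : ℂ) ≠ 0 := by exact_mod_cast hc.ne'
  set r : ℂ := (((Real.sqrt c)⁻¹ : ℝ) : ℂ) with hr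
  have hrr : r * r = (c : ℂ)⁻¹ := by
    rw [hr, ← Complex.ofReal_mul, ← mul_inv, Real.mul_self_sqrt hc.le]; simp
  have hrc : conj r = r := Complex.conj_ofReal _
  have hmem : ∀ k, r • e k ∈ V := fun k =>
    V.smul_mem _ (Submodule.le_topologicalClosure _ (Submodule.subset_span ⟨k, rfl⟩))
  let b : ι → V := fun k => ⟨r • e k, hmem k⟩
  have hb : Orthonormal ℂ b := by
    rw [orthonormal_iff_ite]
    intro k l
    change inner ℂ (r • e k) (r • e l) = _
    rw [inner_smul_left, inner_smul_right, he, hrc]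
    split_ifs
    · rw [← mul_assoc, hrr, inv_mul_cancel₀ hcc]
    · simp
  have hbot : (Submodule.span ℂ (Set.range b))ᗮ = ⊥ := by
    rw [Submodule.eq_bot_iff]
    intro x hx
    have hx' : (x : H) ∈ Vᗮ := by
      refine (Submodule.orthogonal_closure _).ge ?_
      rw [Submodule.mem_orthogonal]
      intro y hy
      induction hy using Submodule.span_induction with
      | mem y hy =>
        obtain ⟨k, rfl⟩ := hy
        have h1 : inner ℂ (b k) x = 0 :=
          (Submodule.mem_orthogonal _ _).1 hx _ (Submodule.subset_span ⟨k, rfl⟩)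
        change inner ℂ (r • e k) (x : H) = 0 at h1
        rw [inner_smul_left, mul_eq_zero] at h1
        refine h1.resolve_left ?_
        rw [hrc]
        intro h0
        rw [h0, mul_zero] at hrr
        exact inv_ne_zero hcc hrr.symm
      | zero => simp
      | add y z _ _ hy hz => rw [inner_add_left, hy, hz, add_zero]
      | smul a y _ hy => rw [inner_smul_left, hy, mul_zero]
    have h0 : inner ℂ (x : H) (x : H) = 0 := (Submodule.mem_orthogonal _ _).1 hx' _ x.2
    exact Subtype.ext (inner_self_eq_zero.1 h0)
  have hs := (HilbertBasis.mkOfOrthogonalEqBot hb hbot).hasSum_orthogonalProjectionOnto v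
  rw [HilbertBasis.coe_mkOfOrthogonalEqBot] at hs
  have hs2 := (hs.mapL V.subtypeL).mapL (innerSL ℂ u)
  refine hs2.congr_fun fun k => ?_
  change _ = inner ℂ u (inner ℂ (r • e k) v • (r • e k))
  rw [inner_smul_right, inner_smul_right, inner_smul_left, hrc, ← hrr]
  ring

/-- `V'` is the orthogonal sum of `V` and `W`: any `z ∈ V'` splits into its projection to `V` and a
remainder in `W`, and each piece is orthogonal to the residual of `x`. -/
lemma starProjection_add_of_eq_inf_orthogonal {V V' W : Submodule ℂ H}
    [V.HasOrthogonalProjection] [V'.HasOrthogonalProjection] [W.HasOrthogonalProjection]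
    (hVV' : V ≤ V') (hW : W = V' ⊓ Vᗮ) (x : H) :
    V'.starProjection x = V.starProjection x + W.starProjection x := by
  have hWV' : W ≤ V' := hW ▸ inf_le_left
  refine (Submodule.eq_starProjection_of_mem_orthogonal
    (V'.add_mem (hVV' (V.starProjection_apply_mem x))
      (hWV' (W.starProjection_apply_mem x))) ?_).symm ▸ rfl
  rw [Submodule.mem_orthogonal]
  intro z hz
  have hz1 : V.starProjection z ∈ V := V.starProjection_apply_mem z
  have hz2 : z - V.starProjection z ∈ W := by
    rw [hW]
    exact ⟨V'.sub_mem hz (hVV' hz1), V.sub_starProjection_mem_orthogonal z⟩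
  have hVW : ∀ a ∈ V, ∀ b ∈ W, inner ℂ a b = 0 := fun a ha b hb =>
    (Submodule.mem_orthogonal _ _).1 ((hW ▸ hb : b ∈ V' ⊓ Vᗮ).2) a ha
  have e : z = V.starProjection z + (z - V.starProjection z) := by abel
  have h1 : inner ℂ (V.starProjection z) (x - V.starProjection x) = 0 :=
    (Submodule.mem_orthogonal _ _).1 (V.sub_starProjection_mem_orthogonal x) _ hz1
  have h2 : inner ℂ (z - V.starProjection z) (x - W.starProjection x) = 0 :=
    (Submodule.mem_orthogonal _ _).1 (W.sub_starProjection_mem_orthogonal x) _ hz2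
  have h3 := hVW _ hz1 _ (W.starProjection_apply_mem x)
  have h4 : inner ℂ (z - V.starProjection z) (V.starProjection x) = 0 := by
    rw [← inner_conj_symm, hVW _ (V.starProjection_apply_mem x) _ hz2, map_zero]
  rw [e, inner_add_left]
  rw [show x - (V.starProjection x + W.starProjection x) =
    (x - V.starProjection x) - W.starProjection x by abel, inner_sub_right, h1, h3,
    show x - V.starProjection x - W.starProjection x =
    (x - W.starProjection x) - V.starProjection x by abel, inner_sub_right, h2, h4]
  simp

end Hilbert

/-! ### The kernels of the projections onto the spaces of a multiresolution analysis -/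

/-- The version of `φ` attached to the dyadic interval `2^j (k + [0,1])`. -/
noncomputable def atom (φ : ℝ → ℂ) (j k : ℤ) (x : ℝ) : ℂ := φ ((x - 2 ^ j * k) / 2 ^ j)

/-- The kernel of the projection onto the span of the `atom φ j k`, `k ∈ ℤ`. -/
noncomputable def levelKernel (φ : ℝ → ℂ) (j : ℤ) (x y : ℝ) : ℂ :=
  (((2 : ℝ) ^ j : ℝ) : ℂ)⁻¹ * shiftKernel φ φ (x / 2 ^ j) (y / 2 ^ j)

lemma atom_eq (φ : ℝ → ℂ) (j k : ℤ) (x : ℝ) : atom φ j k x = φ (x / 2 ^ j - k) := by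
  have : (2 : ℝ) ^ j ≠ 0 := by positivity
  unfold atom
  congr 1
  field_simp

section Level

variable {φ : ℝ → ℂ} {C : ℝ} {L : ℕ}

lemma norm_atom_le (hφ : ∀ x, ‖φ x‖ ≤ C * decay L x) (j k : ℤ) (x : ℝ) :
    ‖atom φ j k x‖ ≤ C * decay L (x / 2 ^ j - k) := by
  rw [atom_eq]; exact hφ _

lemma continuous_atom (hφ : Continuous φ) (j k : ℤ) : Continuous (atom φ j k) :=
  hφ.comp (by fun_prop)

lemma hasSum_levelKernel (hφ : ∀ x, ‖φ x‖ ≤ C * decay 2 x) (j : ℤ) (x y : ℝ) :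
    HasSum (fun k => (((2 : ℝ) ^ j : ℝ) : ℂ)⁻¹ * (atom φ j k x * conj (atom φ j k y)))
      (levelKernel φ j x y) := by
  simp only [atom_eq]
  exact ((summable_shiftKernel (L := 0) hφ hφ _ _).of_norm.hasSum).mul_left _

lemma summable_levelKernel (hφ : ∀ x, ‖φ x‖ ≤ C * decay 2 x) (j : ℤ) (x y : ℝ) :
    Summable (fun k => ‖(((2 : ℝ) ^ j : ℝ) : ℂ)⁻¹ * (atom φ j k x * conj (atom φ j k y))‖) := by
  simp only [atom_eq, norm_mul _⁻¹]
  exact (summable_shiftKernel (L := 0) hφ hφ _ _).mul_left _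

lemma norm_levelKernel_le (hφ : ∀ x, ‖φ x‖ ≤ C * decay (L + 2) x) (j : ℤ) (x y : ℝ) :
    ‖levelKernel φ j x y‖ ≤
      ((2 : ℝ) ^ j)⁻¹ * (C * C * decaySum * decay L ((x - y) / 2 ^ j)) := by
  unfold levelKernel
  rw [norm_mul, norm_inv, Complex.norm_real, Real.norm_of_nonneg (by positivity), sub_div]
  exact mul_le_mul_of_nonneg_left (norm_shiftKernel_le hφ hφ _ _) (by positivity)

lemma continuous_levelKernel (hφ : ∀ x, ‖φ x‖ ≤ C * decay 2 x) (hc : Continuous φ) (j : ℤ) :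
    Continuous fun p : ℝ × ℝ => levelKernel φ j p.1 p.2 :=
  continuous_const.mul ((continuous_shiftKernel (L := 0) hφ hφ hc hc).comp
    (g := fun p : ℝ × ℝ => shiftKernel φ φ p.1 p.2)
    (f := fun p : ℝ × ℝ => (p.1 / 2 ^ j, p.2 / 2 ^ j)) (by fun_prop))

lemma conj_shiftKernel (α β : ℝ → ℂ) (x y : ℝ) :
    conj (shiftKernel α β x y) = shiftKernel β α y x := by
  unfold shiftKernel
  rw [Complex.conj_tsum]
  refine tsum_congr fun k => ?_
  rw [map_mul, Complex.conj_conj, mul_comm]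

end Level

lemma memLp_atom (η : 𝓢(ℝ, ℂ)) (j k : ℤ) : MemLp (atom η j k) 2 := by
  have hc : Continuous (atom η j k) := continuous_atom η.continuous j k
  rw [memLp_two_iff_integrable_sq_norm hc.aestronglyMeasurable]
  have h := (memLp_two_iff_integrable_sq_norm η.continuous.aestronglyMeasurable).1
    (η.memLp 2 volume)
  have h2 := (h.comp_sub_right (k : ℝ)).comp_div (R := (2 : ℝ) ^ j) (by positivity)
  refine h2.congr (Filter.Eventually.of_forall fun x => ?_)
  simp only [atom_eq]

lemma integral_atom_mul_conj (η : 𝓢(ℝ, ℂ))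
    (ho : ∀ k l : ℤ, ∫ x : ℝ, η (x - k) * conj (η (x - l)) = if k = l then 1 else 0) (j k l : ℤ) :
    ∫ x, atom η j k x * conj (atom η j l x) = if k = l then (((2 : ℝ) ^ j : ℝ) : ℂ) else 0 := by
  simp only [atom_eq]
  rw [Measure.integral_comp_div (fun x : ℝ => η (x - k) * conj (η (x - l))), ho,
    abs_of_pos (by positivity)]
  split_ifs <;> simp

/-- The class of `atom η j k` in `L²`. -/
noncomputable def lpAtom (η : 𝓢(ℝ, ℂ)) (j k : ℤ) : Lp ℂ 2 (volume : Measure ℝ) :=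
  (memLp_atom η j k).toLp _

lemma levelSpace_eq (η : 𝓢(ℝ, ℂ)) (j : ℤ) :
    levelSpace η j = (Submodule.span ℂ (Set.range (lpAtom η j))).topologicalClosure := by
  unfold levelSpace
  congr 2
  ext g
  simp only [Set.mem_ofPred_eq, Set.mem_range]
  refine exists_congr fun k => ?_
  have h := (memLp_atom η j k).coeFn_toLp
  constructor
  · intro hg
    exact Lp.ext (h.trans hg.symm)
  · rintro rfl
    exact h

instance completeSpace_levelSpace (η : 𝓢(ℝ, ℂ)) (j : ℤ) : CompleteSpace (levelSpace η j) := by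
  unfold levelSpace
  infer_instance

lemma starProjection_congr {H : Type*} [NormedAddCommGroup H] [InnerProductSpace ℂ H]
    {V W : Submodule ℂ H} [V.HasOrthogonalProjection] [W.HasOrthogonalProjection] (h : V = W) :
    V.starProjection = W.starProjection := by
  subst h; rfl

lemma inner_toLp_toLp {u v : ℝ → ℂ} (hu : MemLp u 2) (hv : MemLp v 2) :
    inner ℂ (hu.toLp u) (hv.toLp v) = ∫ x, conj (u x) * v x := by
  rw [L2.inner_def]
  refine integral_congr_ae ?_
  filter_upwards [hu.coeFn_toLp, hv.coeFn_toLp] with x h1 h2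
  rw [h1, h2, RCLike.inner_apply, mul_comm]

lemma hasSum_integral_levelKernel_mul {φ : ℝ → ℂ} {C : ℝ} (hφ : ∀ x, ‖φ x‖ ≤ C * decay 2 x)
    (hc : Continuous φ) (j : ℤ) {v : ℝ → ℂ} (hv : Integrable v) (x : ℝ) :
    HasSum (fun k => (((2 : ℝ) ^ j : ℝ) : ℂ)⁻¹ *
      (atom φ j k x * ∫ y, conj (atom φ j k y) * v y)) (∫ y, levelKernel φ j x y * v y) := by
  have hC : 0 ≤ C := nonneg_of_mul_nonneg_left ((norm_nonneg _).trans (hφ 0)) (decay_pos _ _)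
  have hb : ∀ k y, ‖atom φ j k y‖ ≤ C := fun k y =>
    (norm_atom_le hφ j k y).trans (mul_le_of_le_one_right hC (decay_le_one _ _))
  have hint : ∀ k, Integrable fun y => conj (atom φ j k y) * v y := fun k =>
    hv.bdd_mul (c := C) (Complex.continuous_conj.comp
      (continuous_atom hc j k)).aestronglyMeasurable
      (Filter.Eventually.of_forall fun y => by rw [RCLike.norm_conj]; exact hb k y)
  have h := hasSum_integral_of_summable_integral_norm (μ := volume)
    (F := fun (k : ℤ) (y : ℝ) => (((2 : ℝ) ^ j : ℝ) : ℂ)⁻¹ *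
      (atom φ j k x * (conj (atom φ j k y) * v y)))
    (fun k => ((hint k).const_mul _).const_mul _) ?_
  · have e : ∫ y, levelKernel φ j x y * v y = ∫ y, ∑' k : ℤ, (((2 : ℝ) ^ j : ℝ) : ℂ)⁻¹ *
        (atom φ j k x * (conj (atom φ j k y) * v y)) := by
      refine integral_congr_ae (Filter.Eventually.of_forall fun y => ?_)
      have := ((hasSum_levelKernel hφ j x y).mul_right (v y)).tsum_eq
      simp only [← this]
      exact tsum_congr fun k => by ring
    rw [e]
    exact h.congr_fun fun k => by rw [integral_const_mul, integral_const_mul]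
  · refine Summable.of_nonneg_of_le (fun k => integral_nonneg fun y => norm_nonneg _)
      (f := fun k : ℤ => ((2 : ℝ) ^ j)⁻¹ * (C * (C * ∫ y, ‖v y‖)) * decay 2 (x / 2 ^ j - k))
      (fun k => ?_) ((summable_decay_int le_rfl _).mul_left _)
    rw [← integral_const_mul, ← integral_const_mul, ← integral_const_mul, ← integral_mul_const]
    refine integral_mono (((hint k).const_mul _).const_mul _).norm
      ((((hv.norm.const_mul _).const_mul _).const_mul _).mul_const _) fun y => ?_
    simp only [norm_mul, norm_inv, RCLike.norm_conj, Complex.norm_real]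
    rw [Real.norm_of_nonneg (by positivity : (0 : ℝ) ≤ 2 ^ j)]
    calc ((2 : ℝ) ^ j)⁻¹ * (‖atom φ j k x‖ * (‖atom φ j k y‖ * ‖v y‖))
        ≤ ((2 : ℝ) ^ j)⁻¹ * ((C * decay 2 (x / 2 ^ j - k)) * (C * ‖v y‖)) := by
          gcongr
          · exact mul_nonneg hC (decay_nonneg _ _)
          · exact norm_atom_le hφ j k x
          · exact hb k y
      _ = _ := by ring

/-- Identifies the abstract projection with an integral operator, weakly. The basis expansion is
exchanged with both integrals; integrability of `u` and `v` on top of square integrability provides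
the majorants. -/
lemma inner_starProjection_levelSpace (η : 𝓢(ℝ, ℂ))
    (ho : ∀ k l : ℤ, ∫ x : ℝ, η (x - k) * conj (η (x - l)) = if k = l then 1 else 0) (j : ℤ)
    {u v : ℝ → ℂ} (hu₁ : Integrable u) (hu : MemLp u 2) (hv₁ : Integrable v) (hv : MemLp v 2) :
    inner ℂ (hu.toLp u) ((levelSpace η j).starProjection (hv.toLp v)) =
      ∫ x, conj (u x) * ∫ y, levelKernel η j x y * v y := by
  obtain ⟨C, hC, hφ⟩ := exists_schwartz_le_decay η 2
  have hb : ∀ k y, ‖atom η j k y‖ ≤ C := fun k y =>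
    (norm_atom_le hφ j k y).trans (mul_le_of_le_one_right hC.le (decay_le_one _ _))
  have hs := hasSum_inner_starProjection_span (e := lpAtom η j) (c := (2 : ℝ) ^ j) (by positivity)
    (fun k l => by
      rw [lpAtom, lpAtom, inner_toLp_toLp]
      simp only [mul_comm (conj _)]
      rw [integral_atom_mul_conj η ho j l k]
      simp only [eq_comm]) (hu.toLp u) (hv.toLp v)
  have e1 : ∀ k, inner ℂ (hu.toLp u) (lpAtom η j k) = ∫ x, conj (u x) * atom η j k x :=
    fun k => inner_toLp_toLp hu _
  have e2 : ∀ k, inner ℂ (lpAtom η j k) (hv.toLp v) = ∫ x, conj (atom η j k x) * v x :=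
    fun k => inner_toLp_toLp _ hv
  simp only [e1, e2] at hs
  set t : ℤ → ℂ := fun k => ∫ x, conj (atom η j k x) * v x with ht
  have htb : ∀ k, ‖t k‖ ≤ C * ∫ y, ‖v y‖ := by
    intro k
    rw [← integral_const_mul]
    refine norm_integral_le_of_norm_le (hv₁.norm.const_mul _)
      (Filter.Eventually.of_forall fun y => ?_)
    rw [norm_mul, RCLike.norm_conj]
    exact mul_le_mul_of_nonneg_right (hb k y) (norm_nonneg _)
  set D : ℝ := C * ∫ y, ‖v y‖ with hD
  have hD0 : 0 ≤ D := mul_nonneg hC.le (integral_nonneg fun _ => norm_nonneg _)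
  have hsum : ∀ x : ℝ, Summable fun k : ℤ => ‖u x‖ * (((2 : ℝ) ^ j)⁻¹ *
      (C * decay 2 (x / 2 ^ j - k) * D)) := fun x =>
    ((((summable_decay_int le_rfl _).mul_left C).mul_right D).mul_left _).mul_left _
  have hG := hasSum_integral_of_dominated_convergence (μ := volume)
    (F := fun (k : ℤ) (x : ℝ) => conj (u x) *
      ((((2 : ℝ) ^ j : ℝ) : ℂ)⁻¹ * (atom η j k x * t k)))
    (f := fun x => conj (u x) * ∫ y, levelKernel η j x y * v y)
    (fun k x => ‖u x‖ * (((2 : ℝ) ^ j)⁻¹ * (C * decay 2 (x / 2 ^ j - k) * D)))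
    (fun k => (Complex.continuous_conj.comp_aestronglyMeasurable hu₁.1).mul
      (by have := continuous_atom η.continuous j k; fun_prop))
    (fun k => Filter.Eventually.of_forall fun x => ?_)
    (Filter.Eventually.of_forall hsum) ?_
    (Filter.Eventually.of_forall fun x =>
      (hasSum_integral_levelKernel_mul hφ η.continuous j hv₁ x).mul_left _)
  · rw [starProjection_congr (levelSpace_eq η j)]
    refine hs.unique (hG.congr_fun fun k => ?_)
    rw [show (((2 : ℝ) ^ j : ℝ) : ℂ)⁻¹ * ((∫ x, conj (u x) * atom η j k x) * t k) =
      (((2 : ℝ) ^ j : ℝ) : ℂ)⁻¹ * t k * (∫ x, conj (u x) * atom η j k x) by ring,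
      ← integral_const_mul]
    refine integral_congr_ae (Filter.Eventually.of_forall fun x => ?_)
    simp only
    ring
  · simp only [norm_mul, norm_inv, RCLike.norm_conj, Complex.norm_real]
    rw [Real.norm_of_nonneg (by positivity : (0 : ℝ) ≤ 2 ^ j)]
    gcongr
    · exact mul_nonneg hC.le (decay_nonneg _ _)
    · exact norm_atom_le hφ j k x
    · exact htb k
  · have hcont : Continuous fun x : ℝ => ∑' k : ℤ, (decay 2 (x / 2 ^ j - k) : ℝ) :=
      continuous_tsum_of_le_decay (π := fun x : ℝ => x / 2 ^ j) (C := 1) (by fun_prop)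
        (fun k => (decay_continuous 2).comp (by fun_prop))
        (fun k x => by rw [Real.norm_of_nonneg (decay_nonneg _ _), one_mul])
    refine (Integrable.bdd_mul (c := decaySum) (hu₁.norm.mul_const (((2 : ℝ) ^ j)⁻¹ * (C * D)))
      hcont.aestronglyMeasurable (Filter.Eventually.of_forall fun x => ?_)).congr
      (Filter.Eventually.of_forall fun x => ?_)
    · rw [Real.norm_of_nonneg (tsum_nonneg fun _ => decay_nonneg _ _)]
      exact tsum_decay_int_le le_rfl _
    · simp only
      rw [← tsum_mul_right]
      exact tsum_congr fun k => by ring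

/-- The fundamental lemma of the calculus of variations, applied in one variable and then in the
other; continuity upgrades almost everywhere to everywhere. -/
lemma eq_zero_of_forall_integral_integral {D : ℝ → ℝ → ℂ} {B : ℝ}
    (hD : Continuous fun p : ℝ × ℝ => D p.1 p.2) (hB : ∀ x y, ‖D x y‖ ≤ B)
    (h : ∀ u v : ℝ → ℝ, ContDiff ℝ (⊤ : ℕ∞) u → HasCompactSupport u → ContDiff ℝ (⊤ : ℕ∞) v →
      HasCompactSupport v → ∫ x, u x • ∫ y, v y • D x y = 0) (x y : ℝ) : D x y = 0 := by
  have h1 : ∀ v : ℝ → ℝ, ContDiff ℝ (⊤ : ℕ∞) v → HasCompactSupport v →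
      ∀ x, ∫ y, v y • D x y = 0 := by
    intro v hv hvc
    have hvi : Integrable v := hv.continuous.integrable_of_hasCompactSupport hvc
    have hc : Continuous fun x => ∫ y, v y • D x y := by
      refine continuous_of_dominated (bound := fun y => ‖v y‖ * B) (fun x => ?_)
        (fun x => Filter.Eventually.of_forall fun y => ?_) (hvi.norm.mul_const B)
        (Filter.Eventually.of_forall fun y => ?_)
      · exact (hv.continuous.smul (hD.comp (by fun_prop : Continuous fun y : ℝ => (x, y)))
          ).aestronglyMeasurable
      · rw [norm_smul]; exact mul_le_mul_of_nonneg_left (hB x y) (norm_nonneg _)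
      · exact (hD.comp (by fun_prop : Continuous fun x : ℝ => (x, y))).const_smul (v y)
    have h2 := ae_eq_zero_of_integral_contDiff_smul_eq_zero hc.locallyIntegrable
      (μ := volume) fun u hu huc => h u v hu huc hv hvc
    have h3 := (hc.ae_eq_iff_eq volume continuous_const).1
      (show (fun x => ∫ y, v y • D x y) =ᵐ[volume] fun _ => (0 : ℂ) from h2)
    exact fun x => congrFun h3 x
  have hc : Continuous fun y => D x y := hD.comp (by fun_prop : Continuous fun y : ℝ => (x, y))
  have h2 := ae_eq_zero_of_integral_contDiff_smul_eq_zero hc.locallyIntegrable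
      (μ := volume) fun v hv hvc => h1 v hv hvc x
  have h3 := (hc.ae_eq_iff_eq volume continuous_const).1
      (show (fun y => D x y) =ᵐ[volume] fun _ => (0 : ℂ) from h2)
  exact congrFun h3 y

/-- The projections satisfy the corresponding identity, their kernels represent them on test
functions, and continuous kernels are determined by such pairings. In this pointwise form the
identity can be integrated against functions outside `L²`. -/
lemma IsWaveletSystem.levelKernel_pred {η : Fin 2 → 𝓢(ℝ, ℂ)} (hη : IsWaveletSystem η) (j : ℤ)
    (x y : ℝ) : levelKernel (η 0) (j - 1) x y =
      levelKernel (η 0) j x y + levelKernel (η 1) j x y := by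
  obtain ⟨C₀, -, h₀⟩ := exists_schwartz_le_decay (η 0) 2
  obtain ⟨C₁, -, h₁⟩ := exists_schwartz_le_decay (η 1) 2
  have c₀ := continuous_levelKernel h₀ (η 0).continuous (j - 1)
  have c₁ := continuous_levelKernel h₀ (η 0).continuous j
  have c₂ := continuous_levelKernel h₁ (η 1).continuous j
  have key : ∀ (i : Fin 2) (j : ℤ), ∃ B, ∀ x y, ‖levelKernel (η i) j x y‖ ≤ B := by
    intro i j
    obtain ⟨C, hC, h⟩ := exists_schwartz_le_decay (η i) 2
    refine ⟨((2 : ℝ) ^ j)⁻¹ * (C * C * decaySum * 1), fun x y => ?_⟩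
    refine (norm_levelKernel_le (L := 0) h j x y).trans ?_
    have := decaySum_nonneg
    gcongr
    exact decay_le_one _ _
  obtain ⟨B₀, hB₀⟩ := key 0 (j - 1)
  obtain ⟨B₁, hB₁⟩ := key 0 j
  obtain ⟨B₂, hB₂⟩ := key 1 j
  rw [← sub_eq_zero]
  refine eq_zero_of_forall_integral_integral (B := B₀ + (B₁ + B₂))
    (D := fun x y => levelKernel (η 0) (j - 1) x y -
      (levelKernel (η 0) j x y + levelKernel (η 1) j x y)) (c₀.sub (c₁.add c₂))
    (fun x y => (norm_sub_le _ _).trans (add_le_add (hB₀ _ _)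
      ((norm_add_le _ _).trans (add_le_add (hB₁ _ _) (hB₂ _ _))))) ?_ x y
  intro u v hu huc hv hvc
  set u' : ℝ → ℂ := fun x => u x with hu'
  set v' : ℝ → ℂ := fun x => v x with hv'
  have hcu : Continuous u' := Complex.continuous_ofReal.comp hu.continuous
  have hcv : Continuous v' := Complex.continuous_ofReal.comp hv.continuous
  have hsu : HasCompactSupport u' := huc.comp_left (g := fun t : ℝ => (t : ℂ)) rfl
  have hsv : HasCompactSupport v' := hvc.comp_left (g := fun t : ℝ => (t : ℂ)) rfl
  have iu : Integrable u' := hcu.integrable_of_hasCompactSupport hsu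
  have iv : Integrable v' := hcv.integrable_of_hasCompactSupport hsv
  have mu : MemLp u' 2 := hcu.memLp_of_hasCompactSupport hsu
  have mv : MemLp v' 2 := hcv.memLp_of_hasCompactSupport hsv
  have hproj := starProjection_add_of_eq_inf_orthogonal (V := levelSpace (η 0) j)
    (V' := levelSpace (η 0) (j - 1)) (W := levelSpace (η 1) j)
    (by simpa using hη.nested (j - 1)) (hη.wavelet j) (mv.toLp v')
  have hin := congrArg (inner ℂ (mu.toLp u')) hproj
  rw [inner_add_right, inner_starProjection_levelSpace _ (hη.orthonormal 0) _ iu mu iv mv,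
    inner_starProjection_levelSpace _ (hη.orthonormal 0) _ iu mu iv mv,
    inner_starProjection_levelSpace _ (hη.orthonormal 1) _ iu mu iv mv] at hin
  have hk : ∀ {K : ℝ → ℝ → ℂ} {B : ℝ}, (Continuous fun p : ℝ × ℝ => K p.1 p.2) →
      (∀ x y, ‖K x y‖ ≤ B) → (∀ x, Integrable fun y => K x y * v' y) ∧
        Integrable fun x => conj (u' x) * ∫ y, K x y * v' y := by
    intro K B hK hB
    have h1 : ∀ x, Integrable fun y => K x y * v' y := fun x =>
      iv.bdd_mul (c := B) (hK.comp (by fun_prop : Continuous fun y : ℝ => (x, y))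
        ).aestronglyMeasurable (Filter.Eventually.of_forall (hB x))
    refine ⟨h1, Continuous.integrable_of_hasCompactSupport ?_ ?_⟩
    · refine (Complex.continuous_conj.comp hcu).mul ?_
      refine continuous_of_dominated (bound := fun y => B * ‖v' y‖) (fun x => (h1 x).1)
        (fun x => Filter.Eventually.of_forall fun y => ?_) (iv.norm.const_mul B)
        (Filter.Eventually.of_forall fun y => ?_)
      · rw [norm_mul]; exact mul_le_mul_of_nonneg_right (hB x y) (norm_nonneg _)
      · exact (hK.comp (by fun_prop : Continuous fun x : ℝ => (x, y))).mul_const _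
    · exact (hsu.comp_left (g := fun z : ℂ => conj z) (map_zero _)).mul_right
  obtain ⟨i₀, I₀⟩ := hk c₀ hB₀
  obtain ⟨i₁, I₁⟩ := hk c₁ hB₁
  obtain ⟨i₂, I₂⟩ := hk c₂ hB₂
  rw [← integral_add I₁ I₂, ← sub_eq_zero] at hin
  rw [← (integral_sub I₀ (I₁.add I₂)).trans hin]
  refine integral_congr_ae (Filter.Eventually.of_forall fun x => ?_)
  simp only [Pi.add_apply]
  rw [← mul_add, ← mul_sub, ← integral_add (i₁ x) (i₂ x)]
  refine Eq.trans ?_ (congrArg (conj (u' x) * ·) (integral_sub (i₀ x) ((i₁ x).add (i₂ x))))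
  simp only [hu', Complex.conj_ofReal, Complex.real_smul]
  congr 1
  refine integral_congr_ae (Filter.Eventually.of_forall fun y => ?_)
  simp only [hv']
  ring

/-! ### Density of the approximation spaces and reproduction of constants -/

lemma IsWaveletSystem.antitone_levelSpace {η : Fin 2 → 𝓢(ℝ, ℂ)} (hη : IsWaveletSystem η) :
    Antitone (levelSpace (η 0)) :=
  antitone_int_of_succ_le hη.nested

lemma IsWaveletSystem.tendsto_starProjection {η : Fin 2 → 𝓢(ℝ, ℂ)} (hη : IsWaveletSystem η)
    (v : Lp ℂ 2 (volume : Measure ℝ)) :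
    Filter.Tendsto (fun n : ℕ => (levelSpace (η 0) (-(n : ℤ))).starProjection v) Filter.atTop
      (nhds v) := by
  refine Submodule.starProjection_tendsto_self (fun n : ℕ => levelSpace (η 0) (-(n : ℤ)))
    (fun m n h => hη.antitone_levelSpace (by simpa using h)) v ?_
  rw [← hη.dense]
  refine Submodule.topologicalClosure_mono (iSup_le fun j => ?_)
  refine le_trans (hη.antitone_levelSpace (?_ : -((j.natAbs : ℕ) : ℤ) ≤ j))
    (le_iSup (fun n : ℕ => levelSpace (η 0) (-(n : ℤ))) j.natAbs)
  omega

lemma integral_add_smul {E F : Type*} [NormedAddCommGroup E] [NormedSpace ℝ E]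
    [MeasurableSpace E] [BorelSpace E] [FiniteDimensional ℝ E] (μ : Measure E)
    [μ.IsAddHaarMeasure] [NormedAddCommGroup F] [NormedSpace ℝ F] (g : E → F) (x : E) {a : ℝ}
    (ha : 0 < a) :
    ∫ s, g (x + a • s) ∂μ = (a ^ Module.finrank ℝ E)⁻¹ • ∫ y, g y ∂μ := by
  rw [Measure.integral_comp_smul μ (fun s => g (x + s)) a, integral_add_left_eq_self,
    abs_of_nonneg (by positivity)]

lemma shiftKernel_add_one (α β : ℝ → ℂ) (x y : ℝ) :
    shiftKernel α β (x + 1) (y + 1) = shiftKernel α β x y := by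
  unfold shiftKernel
  rw [← (Equiv.addRight (1 : ℤ)).tsum_eq]
  refine tsum_congr fun k => ?_
  simp only [Equiv.coe_addRight, Int.cast_add, Int.cast_one, add_sub_add_right_eq_sub]

/-- The translates of the scaling function reproduce constants. -/
lemma IsWaveletSystem.integral_shiftKernel {η : Fin 2 → 𝓢(ℝ, ℂ)} (hη : IsWaveletSystem η)
    (x : ℝ) : ∫ t, shiftKernel (η 0) (η 0) x t = 1 := by
  obtain ⟨C, hC, hφ⟩ := exists_schwartz_le_decay (η 0) (3 + 2)
  have hφ2 : ∀ x, ‖η 0 x‖ ≤ C * decay 2 x := fun x =>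
    (hφ x).trans (mul_le_mul_of_nonneg_left (decay_anti (by norm_num) _) hC.le)
  have hφc := (η 0).continuous
  set K := shiftKernel (η 0) (η 0) with hK
  have hKc : Continuous fun p : ℝ × ℝ => K p.1 p.2 := continuous_shiftKernel hφ hφ hφc hφc
  set B : ℝ := C * C * decaySum with hB
  have hB0 : 0 ≤ B := mul_nonneg (mul_nonneg hC.le hC.le) decaySum_nonneg
  have hKb : ∀ x s, ‖K x (x + s)‖ ≤ B * decay 3 s := by
    intro x s
    have := norm_shiftKernel_le hφ hφ x (x + s)
    rwa [sub_add_cancel_left, decay_neg] at this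
  have hKi : ∀ x, Integrable fun s => K x (x + s) := fun x =>
    Integrable.mono' ((integrable_decay_real (by norm_num)).const_mul B)
      (hKc.comp (by fun_prop : Continuous fun s : ℝ => (x, x + s))).aestronglyMeasurable
      (Filter.Eventually.of_forall (hKb x))
  set G : ℝ → ℂ := fun x => ∫ s, K x (x + s) with hG
  have hGc : Continuous G := by
    refine continuous_of_dominated (bound := fun s => B * decay 3 s) (fun x => (hKi x).1)
      (fun x => Filter.Eventually.of_forall (hKb x))
      ((integrable_decay_real (by norm_num)).const_mul B) (Filter.Eventually.of_forall fun s => ?_)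
    exact hKc.comp (by fun_prop : Continuous fun x : ℝ => (x, x + s))
  have hGp : Function.Periodic G 1 := by
    intro x
    simp only [hG]
    refine integral_congr_ae (Filter.Eventually.of_forall fun s => ?_)
    simp only
    rw [show x + 1 + s = x + s + 1 by ring, hK, shiftKernel_add_one]
  have hfin : ∫ t, K x t = G x := by
    simp only [hG]
    exact (integral_add_left_eq_self (fun t => K x t) x).symm
  rw [hfin]
  set I : ℝ := ∫ t : ℝ, decay 3 t with hI
  have hI0 : 0 ≤ I := integral_nonneg fun _ => decay_nonneg _ _
  set M : ℝ := B * I + 1 with hM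
  have hGb : ∀ x, ‖G x - 1‖ ≤ M := by
    intro x
    refine (norm_sub_le _ _).trans ?_
    rw [norm_one]
    refine add_le_add_left ?_ _
    rw [hI, ← integral_const_mul]
    exact norm_integral_le_of_norm_le ((integrable_decay_real (by norm_num)).const_mul B)
      (Filter.Eventually.of_forall (hKb x))
  -- the `L²` distance of `G` and `1` over a period, at every scale
  set c : ℝ := ∫ x in (0 : ℝ)..1, ‖G x - 1‖ ^ 2 with hc
  -- The substitution stretches `[0, 1]` over exactly `2^n` periods of `G`, so no limit of averages
  -- is needed.
  have hper : ∀ n : ℕ, ∫ x in (0 : ℝ)..1, ‖G (2 ^ n * x) - 1‖ ^ 2 = c := by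
    intro n
    have hp : Function.Periodic (fun x => ‖G x - 1‖ ^ 2) 1 := fun x => by simp only [hGp x]
    rw [intervalIntegral.integral_comp_mul_left (fun x => ‖G x - 1‖ ^ 2)
      (by positivity : (2 : ℝ) ^ n ≠ 0)]
    have h := hp.intervalIntegral_add_zsmul_eq (2 ^ n) 0
    simp only [zero_add, zsmul_eq_mul, Int.cast_pow, Int.cast_ofNat, mul_one] at h
    rw [mul_zero, mul_one, h (fun _ _ => (by fun_prop :
      Continuous fun x => ‖G x - 1‖ ^ 2).intervalIntegrable _ _)]
    rw [smul_eq_mul, ← mul_assoc, inv_mul_cancel₀ (by positivity), one_mul]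
  -- A stand-in for the constant `1`, which is not in `L²`: the margin of width `1` around `[0, 1]`
  -- makes the cut-off invisible there up to `O(2^(-n))`.
  set v : ℝ → ℂ := (Set.Icc (-1 : ℝ) 2).indicator (fun _ => (1 : ℂ)) with hv
  have hvm : Measurable v := measurable_const.indicator measurableSet_Icc
  have hvb : ∀ x, ‖v x‖ ≤ 1 := fun x => by
    simp only [hv, Set.indicator_apply]; split_ifs <;> simp
  have iv : Integrable v := memLp_one_iff_integrable.1
    (memLp_indicator_const 1 measurableSet_Icc (1 : ℂ) (Or.inr (by simp)))
  have mv : MemLp v 2 := by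
    refine memLp_indicator_const 2 measurableSet_Icc (1 : ℂ) (Or.inr ?_)
    simp
  -- Pairing `u = (G(2^n ·) - 1)` on `[0, 1]` with `P_(-n) v - v` gives `c` up to the cut-off error;
  -- Cauchy–Schwarz with `‖u‖ = √c` then yields the bound. Both terms on the right tend to zero, the
  -- first by density of the `V_j`.
  have key : ∀ n : ℕ, c ≤ Real.sqrt c *
      ‖(levelSpace (η 0) (-(n : ℤ))).starProjection (mv.toLp v) - mv.toLp v‖ +
        M * (B * ((1 / 2) ^ n * ∫ t : ℝ, decay 2 t)) := by
    intro n
    set a : ℝ := (2 : ℝ) ^ (-(n : ℤ)) with ha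
    have ha0 : 0 < a := by positivity
    have ha1 : a = (1 / 2) ^ n := by rw [ha, zpow_neg, zpow_natCast, one_div, inv_pow]
    have hax : ∀ x, x / a = 2 ^ n * x := fun x => by
      rw [ha, zpow_neg, zpow_natCast, div_inv_eq_mul, mul_comm]
    set u : ℝ → ℂ := (Set.Icc (0 : ℝ) 1).indicator (fun x => G (2 ^ n * x) - 1) with hu
    have hum : Measurable u :=
      Measurable.indicator (by fun_prop : Continuous fun x => G (2 ^ n * x) - 1).measurable
        measurableSet_Icc
    have mu' : ∀ p, MemLp u p := fun p => by
      rw [hu, memLp_indicator_iff_restrict measurableSet_Icc]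
      exact MemLp.of_bound (by fun_prop : Continuous fun x => G (2 ^ n * x) - 1
        ).aestronglyMeasurable M (Filter.Eventually.of_forall fun x => hGb _)
    have mu := mu' 2
    have iu : Integrable u := memLp_one_iff_integrable.1 (mu' 1)
    set T : ℝ → ℂ := fun x => ∫ y, levelKernel (η 0) (-(n : ℤ)) x y * v y with hT
    have hT1 : ∀ x, T x = ∫ s, K (2 ^ n * x) (2 ^ n * x + s) * v (x + a * s) := by
      intro x
      have h := integral_add_smul volume
        (fun y => levelKernel (η 0) (-(n : ℤ)) x y * v y) x ha0
      rw [Module.finrank_self, pow_one] at h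
      have h' : T x = a • ∫ s, levelKernel (η 0) (-(n : ℤ)) x (x + a • s) * v (x + a • s) := by
        rw [h, smul_smul, mul_inv_cancel₀ ha0.ne', one_smul]
      rw [h', ← integral_smul]
      refine integral_congr_ae (Filter.Eventually.of_forall fun s => ?_)
      simp only [levelKernel, smul_eq_mul, Complex.real_smul]
      rw [← ha, add_div, mul_div_cancel_left₀ s ha0.ne', hax, ← mul_assoc, ← mul_assoc,
        mul_inv_cancel₀ (by exact_mod_cast ha0.ne'), one_mul]
    -- Where `v` differs from `1` one has `a |s| > 1`, and one of the three orders of decay is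
    -- traded for the factor `a`.
    have hvs : ∀ x ∈ Set.Icc (0 : ℝ) 1, ∀ s, decay 3 s * ‖v (x + a * s) - 1‖ ≤
        a * decay 2 s := by
      intro x hx s
      rw [show (3 : ℕ) = 2 + 1 from rfl, decay_add, mul_assoc,
        mul_comm a (decay 2 s)]
      refine mul_le_mul_of_nonneg_left ?_ (decay_nonneg 2 s)
      by_cases hs : |a * s| ≤ 1
      · have : x + a * s ∈ Set.Icc (-1 : ℝ) 2 :=
          ⟨by linarith [(abs_le.1 hs).1, hx.1], by linarith [(abs_le.1 hs).2, hx.2]⟩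
        rw [hv, Set.indicator_of_mem this, sub_self, norm_zero, mul_zero]
        exact ha0.le
      · have h1 : ‖v (x + a * s) - 1‖ ≤ 1 := by
          simp only [hv, Set.indicator_apply]; split_ifs <;> simp
        have h2 : 1 ≤ a * |s| := by
          rw [abs_mul, abs_of_pos ha0] at hs; linarith
        refine (mul_le_of_le_one_right (decay_nonneg _ _) h1).trans ?_
        unfold decay
        rw [pow_one, inv_le_comm₀ (by positivity) ha0, Real.norm_eq_abs]
        rw [inv_le_iff_one_le_mul₀ ha0]
        nlinarith
    have hTG : ∀ x ∈ Set.Icc (0 : ℝ) 1, ‖T x - G (2 ^ n * x)‖ ≤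
        B * ((1 / 2) ^ n * ∫ t : ℝ, decay 2 t) := by
      intro x hx
      have i1 : Integrable fun s => K (2 ^ n * x) (2 ^ n * x + s) * v (x + a * s) :=
        (hKi _).mul_bdd (c := 1) (hvm.comp (by fun_prop)).aestronglyMeasurable
          (Filter.Eventually.of_forall fun s => hvb _)
      rw [hT1, ← integral_sub i1 (hKi _), ← integral_const_mul, ← integral_const_mul]
      refine norm_integral_le_of_norm_le
        (((integrable_decay_real le_rfl).const_mul _).const_mul _)
        (Filter.Eventually.of_forall fun s => ?_)
      rw [← mul_sub_one, norm_mul]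
      calc _ ≤ B * decay 3 s * ‖v (x + a * s) - 1‖ :=
            mul_le_mul_of_nonneg_right (hKb _ _) (norm_nonneg _)
        _ = B * (decay 3 s * ‖v (x + a * s) - 1‖) := mul_assoc _ _ _
        _ ≤ _ := by rw [← ha1]; exact mul_le_mul_of_nonneg_left (hvs x hx s) hB0
    have hTc : Continuous T := by
      have hk := continuous_levelKernel hφ2 hφc (-(n : ℤ))
      have hb : ∀ x y, ‖levelKernel (η 0) (-(n : ℤ)) x y‖ ≤ a⁻¹ * (B * 1) := fun x y => by
        refine (norm_levelKernel_le hφ (-(n : ℤ)) x y).trans ?_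
        rw [← ha]
        gcongr
        exact decay_le_one _ _
      refine continuous_of_dominated (bound := fun y => a⁻¹ * (B * 1) * ‖v y‖) (fun x => ?_)
        (fun x => Filter.Eventually.of_forall fun y => ?_) (iv.norm.const_mul _)
        (Filter.Eventually.of_forall fun y => ?_)
      · exact ((hk.comp (by fun_prop : Continuous fun y : ℝ => (x, y))).measurable.mul
          hvm).aestronglyMeasurable
      · rw [norm_mul]; exact mul_le_mul_of_nonneg_right (hb x y) (norm_nonneg _)
      · exact (hk.comp (by fun_prop : Continuous fun x : ℝ => (x, y))).mul_const _
    have huu : ∫ x, conj (u x) * u x = (c : ℂ) := by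
      rw [← hper n, intervalIntegral.integral_of_le zero_le_one, ← integral_Icc_eq_integral_Ioc,
        ← integral_indicator measurableSet_Icc, ← integral_complex_ofReal]
      refine integral_congr_ae (Filter.Eventually.of_forall fun x => ?_)
      simp only [hu, Set.indicator_apply]
      split_ifs
      · rw [Complex.conj_mul']; norm_cast
      · simp
    have hun : ‖mu.toLp u‖ = Real.sqrt c := by
      have h1 := inner_toLp_toLp mu mu
      rw [huu, inner_self_eq_norm_sq_to_K] at h1
      have h2 : ‖mu.toLp u‖ ^ 2 = c := Complex.ofReal_injective (by simpa using h1)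
      rw [← h2, Real.sqrt_sq (norm_nonneg _)]
    have hin : inner ℂ (mu.toLp u)
        ((levelSpace (η 0) (-(n : ℤ))).starProjection (mv.toLp v) - mv.toLp v) =
        (c : ℂ) + ∫ x, conj (u x) * (T x - G (2 ^ n * x)) := by
      have huc : Integrable fun x => conj (u x) := by
        simpa using (Complex.conjCLE.toContinuousLinearMap.integrable_comp iu)
      have hB' : ∀ {F : ℝ → ℂ}, Continuous F → Integrable fun x => conj (u x) * F x := by
        intro F hF
        obtain ⟨b, hb⟩ := (isCompact_Icc (a := (0 : ℝ)) (b := 1)).exists_bound_of_continuousOn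
          hF.continuousOn
        refine (huc.norm.mul_const b).mono' (huc.1.mul hF.aestronglyMeasurable)
          (Filter.Eventually.of_forall fun x => ?_)
        rw [norm_mul]
        by_cases hx : x ∈ Set.Icc (0 : ℝ) 1
        · exact mul_le_mul_of_nonneg_left (hb x hx) (norm_nonneg _)
        · rw [hu, Set.indicator_of_notMem hx]; simp
      have hGn : Continuous fun x => G (2 ^ n * x) := by fun_prop
      rw [inner_sub_right, inner_starProjection_levelSpace _ (hη.orthonormal 0) _ iu mu iv mv,
        inner_toLp_toLp, ← huu, ← integral_add, ← integral_sub]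
      · refine integral_congr_ae (Filter.Eventually.of_forall fun x => ?_)
        simp only
        by_cases hx : x ∈ Set.Icc (0 : ℝ) 1
        · have hx' : x ∈ Set.Icc (-1 : ℝ) 2 := ⟨by linarith [hx.1], by linarith [hx.2]⟩
          rw [hu, hv, Set.indicator_of_mem hx, Set.indicator_of_mem hx']
          ring
        · rw [hu, Set.indicator_of_notMem hx]; simp
      · exact hB' hTc
      · exact huc.mul_bdd (c := 1) hvm.aestronglyMeasurable (Filter.Eventually.of_forall hvb)
      · exact iu.bdd_mul (c := M) huc.1 (Filter.Eventually.of_forall fun x => by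
          rw [RCLike.norm_conj, hu, Set.indicator_apply]
          split_ifs
          · exact hGb _
          · rw [norm_zero]; positivity)
      · exact hB' (hTc.sub hGn)
    have herr : ‖∫ x, conj (u x) * (T x - G (2 ^ n * x))‖ ≤
        M * (B * ((1 / 2) ^ n * ∫ t : ℝ, decay 2 t)) := by
      have h := norm_integral_le_of_norm_le (μ := volume)
        (f := fun x => conj (u x) * (T x - G (2 ^ n * x)))
        (g := (Set.Icc (0 : ℝ) 1).indicator
          (fun _ => M * (B * ((1 / 2) ^ n * ∫ t : ℝ, decay 2 t))))
        (memLp_one_iff_integrable.1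
          (memLp_indicator_const 1 measurableSet_Icc _ (Or.inr (by simp))))
        (Filter.Eventually.of_forall fun x => ?_)
      · refine h.trans_eq ?_
        rw [integral_indicator measurableSet_Icc]; simp
      · simp only [Set.indicator_apply, hu]
        split_ifs with hx
        · rw [norm_mul, RCLike.norm_conj]
          exact mul_le_mul (hGb _) (hTG x hx) (norm_nonneg _) (by positivity)
        · simp
    have hcc : c = ‖(c : ℂ)‖ := by
      rw [Complex.norm_real, Real.norm_of_nonneg]
      exact intervalIntegral.integral_nonneg zero_le_one fun _ _ => by positivity
    calc c = ‖(c : ℂ)‖ := hcc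
      _ ≤ _ := by
        rw [← sub_eq_iff_eq_add.2 hin, ← hun]
        exact (norm_sub_le _ _).trans (add_le_add (norm_inner_le_norm _ _) herr)
  have hlim : Filter.Tendsto (fun n : ℕ => Real.sqrt c *
      ‖(levelSpace (η 0) (-(n : ℤ))).starProjection (mv.toLp v) - mv.toLp v‖ +
        M * (B * ((1 / 2) ^ n * ∫ t : ℝ, decay 2 t))) Filter.atTop (nhds 0) := by
    have h1 := (tendsto_iff_norm_sub_tendsto_zero.1
      (hη.tendsto_starProjection (mv.toLp v))).const_mul (Real.sqrt c)
    have h2 : Filter.Tendsto (fun n : ℕ => (1 / 2 : ℝ) ^ n) Filter.atTop (nhds 0) :=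
      tendsto_pow_atTop_nhds_zero_of_lt_one (by norm_num) (by norm_num)
    have h3 := ((h2.mul_const (∫ t : ℝ, decay 2 t)).const_mul B).const_mul M
    have h4 := h1.add h3
    simp only [mul_zero, zero_mul, add_zero] at h4
    exact h4
  have hc0 : c ≤ 0 := ge_of_tendsto' hlim key
  have hcont : Continuous fun x => ‖G x - 1‖ ^ 2 := by fun_prop
  have hzero : ∀ x ∈ Set.Icc (0 : ℝ) 1, ‖G x - 1‖ ^ 2 = 0 := by
    by_contra! hne
    obtain ⟨y, hy, hy0⟩ := hne
    have := intervalIntegral.integral_pos one_pos hcont.continuousOn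
      (fun _ _ => by positivity) ⟨y, hy, lt_of_le_of_ne (by positivity) hy0.symm⟩
    exact absurd hc0 (not_le.2 this)
  have hx := hzero (Int.fract x) ⟨Int.fract_nonneg x, (Int.fract_lt_one x).le⟩
  have hfr : G (Int.fract x) = G x := by
    have := hGp.sub_zsmul_eq (x := x) ⌊x⌋
    rwa [zsmul_eq_mul, mul_one] at this
  rw [hfr] at hx
  exact sub_eq_zero.1 (norm_eq_zero.1 (pow_eq_zero_iff two_ne_zero |>.1 hx))

/-! ### Sums over products of index sets -/

lemma summable_and_tsum_prod_pi {𝕜 ι : Type*} [RCLike 𝕜] {d : ℕ} {f : Fin d → ι → 𝕜}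
    (hf : ∀ m, Summable fun k => ‖f m k‖) :
    (Summable fun k : Fin d → ι => ‖∏ m, f m (k m)‖) ∧
      ∑' k : Fin d → ι, ∏ m, f m (k m) = ∏ m, ∑' k, f m k := by
  induction d with
  | zero => exact ⟨Summable.of_finite, by simp⟩
  | succ d ih =>
    obtain ⟨h1, h2⟩ := ih (f := fun m => f m.succ) fun m => hf m.succ
    let E : ι × (Fin d → ι) ≃ (Fin (d + 1) → ι) := Fin.consEquiv fun _ => ι
    have he : ∀ p : ι × (Fin d → ι), ∏ m, f m (E p m) =
        f 0 p.1 * ∏ m : Fin d, f m.succ (p.2 m) := fun p => by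
      rw [Fin.prod_univ_succ]; rfl
    have h3 : Summable fun p : ι × (Fin d → ι) => ‖f 0 p.1 * ∏ m : Fin d, f m.succ (p.2 m)‖ :=
      Summable.mul_norm (f := f 0) (g := fun k : Fin d → ι => ∏ m : Fin d, f m.succ (k m)) (hf 0) h1
    have h4 : Summable fun p : ι × (Fin d → ι) => ‖∏ m, f m (E p m)‖ :=
      h3.congr fun p => congrArg norm (he p).symm
    have h5 : Summable ((fun k : Fin (d + 1) → ι => ‖∏ m, f m (k m)‖) ∘ E) := h4
    refine ⟨E.summable_iff.1 h5, ?_⟩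
    calc ∑' k : Fin (d + 1) → ι, ∏ m, f m (k m) = ∑' p, ∏ m, f m (E p m) :=
          (E.tsum_eq fun k : Fin (d + 1) → ι => ∏ m, f m (k m)).symm
      _ = ∑' p : ι × (Fin d → ι), f 0 p.1 * ∏ m : Fin d, f m.succ (p.2 m) := tsum_congr he
      _ = (∑' k, f 0 k) * ∑' k : Fin d → ι, ∏ m, f m.succ (k m) :=
          (tsum_mul_tsum_of_summable_norm (hf 0) h1).symm
      _ = ∏ m, ∑' k, f m k := by rw [h2, Fin.prod_univ_succ]

lemma hasSum_prod_fintype {κ ι F : Type*} [Fintype ι] [AddCommMonoid F] [TopologicalSpace F]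
    [ContinuousAdd F] {f : κ × ι → F} {a : ι → F} (h : ∀ e, HasSum (fun k => f (k, e)) (a e)) :
    HasSum f (∑ e, a e) := by
  classical
  have h1 : ∀ e, HasSum (fun p : κ × ι => if p.2 = e then f p else 0) (a e) := by
    intro e
    have hi : Function.Injective fun k : κ => (k, e) := fun k l hkl => (Prod.ext_iff.1 hkl).1
    rw [← hi.hasSum_iff]
    · exact (h e).congr_fun fun k => by simp
    · rintro ⟨k, e'⟩ hk
      simp only [Set.mem_range, Prod.mk.injEq, not_exists] at hk
      rw [if_neg]
      rintro rfl
      exact hk k ⟨rfl, rfl⟩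
  refine (hasSum_sum fun e _ => h1 e).congr_fun fun p => ?_
  simp

section Euclidean

variable {d : ℕ}

/-- The Euclidean norm is at most the sum of the absolute coordinates, and that sum already occurs
among the terms of the expanded product. -/
lemma one_add_norm_le_prod (x : EuclideanSpace ℝ (Fin d)) : 1 + ‖x‖ ≤ ∏ m, (1 + ‖x m‖) := by
  have h1 : ‖x‖ ≤ ∑ m, ‖x m‖ := by
    rw [EuclideanSpace.norm_eq]
    refine Real.sqrt_le_iff.2 ⟨Finset.sum_nonneg fun _ _ => norm_nonneg _, ?_⟩
    exact Finset.sum_sq_le_sq_sum_of_nonneg fun _ _ => norm_nonneg _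
  have h2 : ∀ s : Finset (Fin d), 1 + ∑ m ∈ s, ‖x m‖ ≤ ∏ m ∈ s, (1 + ‖x m‖) := by
    classical
    intro s
    induction s using Finset.induction_on with
    | empty => simp
    | insert a s ha ih =>
      rw [Finset.sum_insert ha, Finset.prod_insert ha]
      have := norm_nonneg (x a)
      have : 0 ≤ ∑ m ∈ s, ‖x m‖ := Finset.sum_nonneg fun _ _ => norm_nonneg _
      nlinarith
  linarith [h2 Finset.univ]

lemma prod_decay_le (L : ℕ) (x : EuclideanSpace ℝ (Fin d)) :
    ∏ m, decay L (x m) ≤ decay L x := by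
  have := norm_nonneg x
  unfold decay
  rw [Finset.prod_inv_distrib, Finset.prod_pow]
  gcongr
  exact one_add_norm_le_prod x

lemma summable_prod_decay (x : Fin d → ℝ) :
    (Summable fun k : Fin d → ℤ => ∏ m, decay 2 (x m - k m)) ∧
      ∑' k : Fin d → ℤ, ∏ m, decay 2 (x m - k m) ≤ decaySum ^ d := by
  have h := summable_and_tsum_prod_pi (𝕜 := ℝ) (f := fun (m : Fin d) (k : ℤ) => decay 2 (x m - k))
    fun m => (summable_decay_int le_rfl (x m)).norm
  refine ⟨h.1.of_norm, ?_⟩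
  rw [h.2]
  refine (Finset.prod_le_prod (fun m _ => tsum_nonneg fun k => decay_nonneg _ _)
    fun m _ => tsum_decay_int_le le_rfl (x m)).trans_eq (by simp)

/-- A bound for the sum over a dyadic level of the envelopes of the wavelets. -/
noncomputable def levelSum (d : ℕ) : ℝ :=
  Fintype.card {e : Fin d → Fin 2 // e ≠ 0} * decaySum ^ d

lemma levelSum_nonneg (d : ℕ) : 0 ≤ levelSum d := by
  have := decaySum_nonneg
  unfold levelSum; positivity

lemma summable_levelIndex_decay (x : Fin d → ℝ) :
    (Summable fun κ : LevelIndex d => ∏ m, decay 2 (x m - κ.1 m)) ∧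
      ∑' κ : LevelIndex d, ∏ m, decay 2 (x m - κ.1 m) ≤ levelSum d := by
  have h := hasSum_prod_fintype (ι := {e : Fin d → Fin 2 // e ≠ 0})
    (f := fun κ : LevelIndex d => ∏ m, decay 2 (x m - κ.1 m)) fun e =>
    (summable_prod_decay x).1.hasSum
  refine ⟨h.summable, h.tsum_eq.le.trans ?_⟩
  rw [Finset.sum_const, nsmul_eq_mul, Finset.card_univ]
  exact mul_le_mul_of_nonneg_left (summable_prod_decay x).2 (by positivity)

lemma exists_le_decay_of_fin_two (η : Fin 2 → 𝓢(ℝ, ℂ)) (L : ℕ) :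
    ∃ C : ℝ, 0 < C ∧ ∀ i x, ‖η i x‖ ≤ C * decay L x := by
  obtain ⟨C₀, h₀, H₀⟩ := exists_schwartz_le_decay (η 0) L
  obtain ⟨C₁, h₁, H₁⟩ := exists_schwartz_le_decay (η 1) L
  refine ⟨C₀ + C₁, by positivity, fun i x => ?_⟩
  have := decay_nonneg L x
  fin_cases i
  · exact (H₀ x).trans (mul_le_mul_of_nonneg_right (by linarith) this)
  · exact (H₁ x).trans (mul_le_mul_of_nonneg_right (by linarith) this)

lemma waveletFun_eq (η : Fin 2 → 𝓢(ℝ, ℂ)) (i : WaveletIndex d) (x : EuclideanSpace ℝ (Fin d)) :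
    waveletFun η i x = ∏ m, η (i.2.2.1 m) (x m / 2 ^ i.1 - i.2.1 m) :=
  Finset.prod_congr rfl fun m _ => atom_eq (η (i.2.2.1 m)) i.1 (i.2.1 m) (x m)

lemma norm_waveletFun_le {η : Fin 2 → 𝓢(ℝ, ℂ)} {C : ℝ} {L : ℕ}
    (h : ∀ i x, ‖η i x‖ ≤ C * decay L x) (i : WaveletIndex d) (x : EuclideanSpace ℝ (Fin d)) :
    ‖waveletFun η i x‖ ≤ C ^ d * ∏ m, decay L (x m / 2 ^ i.1 - i.2.1 m) := by
  rw [waveletFun_eq, norm_prod]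
  refine (Finset.prod_le_prod (fun _ _ => norm_nonneg _) fun m _ => h _ _).trans_eq ?_
  rw [Finset.prod_mul_distrib]; simp

lemma continuous_waveletFun (η : Fin 2 → 𝓢(ℝ, ℂ)) (i : WaveletIndex d) :
    Continuous (waveletFun η i) := by
  unfold waveletFun
  refine continuous_finsetProd _ fun m _ => (η _).continuous.comp (by fun_prop)

/-! ### Tensor product kernels -/

/-- Tensor product of the kernels `shiftKernel φ φ`. -/
noncomputable def tensorKernel (φ : ℝ → ℂ) (x y : EuclideanSpace ℝ (Fin d)) : ℂ :=
  ∏ m, shiftKernel φ φ (x m) (y m)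

/-- Tensor product of the kernels `levelKernel φ j`. -/
noncomputable def levelTensor (φ : ℝ → ℂ) (j : ℤ) (x y : EuclideanSpace ℝ (Fin d)) : ℂ :=
  ∏ m, levelKernel φ j (x m) (y m)

lemma levelTensor_eq (φ : ℝ → ℂ) (j : ℤ) (x y : EuclideanSpace ℝ (Fin d)) :
    levelTensor φ j x y = (((((2 : ℝ) ^ j) ^ d)⁻¹ : ℝ) : ℂ) *
      tensorKernel φ (((2 : ℝ) ^ j)⁻¹ • x) (((2 : ℝ) ^ j)⁻¹ • y) := by
  simp only [levelTensor, levelKernel, tensorKernel, Finset.prod_mul_distrib, PiLp.smul_apply,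
    smul_eq_mul, div_eq_inv_mul]
  simp

lemma norm_tensorKernel_le {φ : ℝ → ℂ} {C : ℝ} {L : ℕ}
    (hφ : ∀ x, ‖φ x‖ ≤ C * decay (L + 2) x) (x y : EuclideanSpace ℝ (Fin d)) :
    ‖tensorKernel φ x y‖ ≤ (C * C * decaySum) ^ d * decay L (x - y) := by
  unfold tensorKernel
  rw [norm_prod]
  have h0 : 0 ≤ C * C * decaySum := mul_nonneg (mul_self_nonneg C) decaySum_nonneg
  refine (Finset.prod_le_prod (fun _ _ => norm_nonneg _)
    fun m _ => norm_shiftKernel_le hφ hφ _ _).trans ?_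
  rw [Finset.prod_mul_distrib, Finset.prod_const, Finset.card_univ, Fintype.card_fin]
  exact mul_le_mul_of_nonneg_left (prod_decay_le L (x - y)) (pow_nonneg h0 _)

lemma continuous_tensorKernel {φ : ℝ → ℂ} {C : ℝ} (hφ : ∀ x, ‖φ x‖ ≤ C * decay 2 x)
    (hc : Continuous φ) :
    Continuous fun p : EuclideanSpace ℝ (Fin d) × EuclideanSpace ℝ (Fin d) =>
      tensorKernel φ p.1 p.2 :=
  continuous_finsetProd _ fun m _ =>
    (continuous_shiftKernel (L := 0) hφ hφ hc hc).comp
      (g := fun p : ℝ × ℝ => shiftKernel φ φ p.1 p.2)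
      (f := fun p : EuclideanSpace ℝ (Fin d) × EuclideanSpace ℝ (Fin d) => (p.1 m, p.2 m))
      (by fun_prop)

lemma continuous_levelTensor {φ : ℝ → ℂ} {C : ℝ} (hφ : ∀ x, ‖φ x‖ ≤ C * decay 2 x)
    (hc : Continuous φ) (j : ℤ) :
    Continuous fun p : EuclideanSpace ℝ (Fin d) × EuclideanSpace ℝ (Fin d) =>
      levelTensor φ j p.1 p.2 := by
  simp only [levelTensor_eq]
  exact continuous_const.mul ((continuous_tensorKernel hφ hc).comp
    (g := fun p : EuclideanSpace ℝ (Fin d) × EuclideanSpace ℝ (Fin d) => tensorKernel φ p.1 p.2)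
    (f := fun p : EuclideanSpace ℝ (Fin d) × EuclideanSpace ℝ (Fin d) =>
      (((2 : ℝ) ^ j)⁻¹ • p.1, ((2 : ℝ) ^ j)⁻¹ • p.2)) (by fun_prop))

lemma norm_levelTensor_le {φ : ℝ → ℂ} {C : ℝ} {L : ℕ}
    (hφ : ∀ x, ‖φ x‖ ≤ C * decay (L + 2) x) (j : ℤ) (x y : EuclideanSpace ℝ (Fin d)) :
    ‖levelTensor φ j x y‖ ≤ (((2 : ℝ) ^ j) ^ d)⁻¹ *
      ((C * C * decaySum) ^ d * decay L (((2 : ℝ) ^ j)⁻¹ • (x - y))) := by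
  rw [levelTensor_eq, norm_mul, Complex.norm_real, Real.norm_of_nonneg (by positivity), smul_sub]
  exact mul_le_mul_of_nonneg_left (norm_tensorKernel_le hφ _ _) (by positivity)

/-- In every coordinate the finer kernel is the sum of a scaling and a wavelet kernel. Expanding the
product gives one term per `e ∈ {0,1}^d`; `e = 0` is the coarser tensor kernel, and the others are
the genders. -/
lemma hasSum_levelTensor_sub {η : Fin 2 → 𝓢(ℝ, ℂ)} (hη : IsWaveletSystem η) (j : ℤ)
    (x y : EuclideanSpace ℝ (Fin d)) :
    HasSum (fun κ : LevelIndex d => (((((2 : ℝ) ^ j) ^ d)⁻¹ : ℝ) : ℂ) *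
        (waveletFun η (j, κ) x * conj (waveletFun η (j, κ) y)))
      (levelTensor (η 0) (j - 1) x y - levelTensor (η 0) j x y) := by
  obtain ⟨C, hC, h⟩ := exists_le_decay_of_fin_two η 2
  have h1 : levelTensor (η 0) (j - 1) x y =
      ∑ e : Fin d → Fin 2, ∏ m, levelKernel (η (e m)) j (x m) (y m) := by
    have := Finset.prod_univ_sum (fun _ : Fin d => (Finset.univ : Finset (Fin 2)))
      (fun m i => levelKernel (η i) j (x m) (y m))
    rw [Fintype.piFinset_univ] at this
    rw [← this]
    simp only [levelTensor, hη.levelKernel_pred, Fin.sum_univ_two]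
  have h2 : levelTensor (η 0) (j - 1) x y - levelTensor (η 0) j x y =
      ∑ e : {e : Fin d → Fin 2 // e ≠ 0}, ∏ m, levelKernel (η (e.1 m)) j (x m) (y m) := by
    set F : (Fin d → Fin 2) → ℂ := fun e => ∏ m, levelKernel (η (e m)) j (x m) (y m) with hF
    have h3 : levelTensor (η 0) j x y = F 0 := rfl
    have h4 : ∑ e ∈ Finset.univ.erase 0, F e = ∑ e : {e : Fin d → Fin 2 // e ≠ 0}, F e :=
      Finset.sum_subtype _ (by simp) F
    rw [h1, h3, ← h4, ← Finset.sum_erase_add _ _ (Finset.mem_univ 0), add_sub_cancel_right]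
  rw [h2]
  refine hasSum_prod_fintype fun e => ?_
  have h3 := summable_and_tsum_prod_pi (𝕜 := ℂ) (f := fun (m : Fin d) (k : ℤ) =>
    (((2 : ℝ) ^ j : ℝ) : ℂ)⁻¹ * (atom (η (e.1 m)) j k (x m) * conj (atom (η (e.1 m)) j k (y m))))
    fun m => summable_levelKernel (h _) j _ _
  have h4 := h3.1.of_norm.hasSum
  rw [h3.2, Finset.prod_congr rfl fun m _ => (hasSum_levelKernel (h _) j _ _).tsum_eq] at h4
  refine h4.congr_fun fun k => ?_
  rw [Finset.prod_mul_distrib, Finset.prod_mul_distrib]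
  simp only [waveletFun, atom, map_prod]
  simp

/-! ### Projections of tempered functions -/

/-- The projection of `f` onto the span of the scaling functions at level `j`. -/
noncomputable def levelProj (φ : ℝ → ℂ) (j : ℤ) (f : EuclideanSpace ℝ (Fin d) → ℂ)
    (x : EuclideanSpace ℝ (Fin d)) : ℂ :=
  ∫ y, levelTensor φ j x y * f y

lemma integrable_levelTensor_mul {φ : ℝ → ℂ} {C : ℝ} {M : ℕ}
    (hφ : ∀ x, ‖φ x‖ ≤ C * decay (M + 2) x) (hc : Continuous φ) (j : ℤ)
    {f : EuclideanSpace ℝ (Fin d) → ℂ} (hf : Integrable fun y => decay M y • f y)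
    (hfm : AEStronglyMeasurable f) (x : EuclideanSpace ℝ (Fin d)) :
    Integrable fun y => levelTensor φ j x y * f y := by
  have hC : 0 ≤ C := nonneg_of_mul_nonneg_left ((norm_nonneg _).trans (hφ 0)) (decay_pos _ _)
  have hφ2 : ∀ x, ‖φ x‖ ≤ C * decay 2 x := fun x =>
    (hφ x).trans (mul_le_mul_of_nonneg_left (decay_anti (by omega) _) hC)
  have h0 : 0 ≤ C * C * decaySum := mul_nonneg (mul_self_nonneg C) decaySum_nonneg
  refine (hf.norm.const_mul ((((2 : ℝ) ^ j) ^ d)⁻¹ * ((C * C * decaySum) ^ d *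
    ((1 + 2 ^ j) * (1 + ‖x‖)) ^ M))).mono' ?_ (Filter.Eventually.of_forall fun y => ?_)
  · exact ((continuous_levelTensor hφ2 hc j).comp
      (by fun_prop : Continuous fun y : EuclideanSpace ℝ (Fin d) => (x, y))
      ).aestronglyMeasurable.mul hfm
  · rw [norm_mul, norm_smul, Real.norm_of_nonneg (decay_nonneg _ _), ← mul_assoc]
    refine mul_le_mul_of_nonneg_right ((norm_levelTensor_le hφ j x y).trans ?_) (norm_nonneg _)
    have h1 := decay_smul_sub_le M (show (0 : ℝ) < 2 ^ j by positivity) x y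
    calc _ ≤ (((2 : ℝ) ^ j) ^ d)⁻¹ * ((C * C * decaySum) ^ d *
          (((1 + 2 ^ j) * (1 + ‖x‖)) ^ M * decay M y)) :=
          mul_le_mul_of_nonneg_left (mul_le_mul_of_nonneg_left h1 (pow_nonneg h0 _))
            (by positivity)
      _ = _ := by ring

/-- The kernel identity is integrated against `f`. For the interchange of sum and integral, `M`
orders of decay are used against the growth of `f`, and `2` for the sum over positions. -/
lemma hasSum_levelProj_sub {η : Fin 2 → 𝓢(ℝ, ℂ)} (hη : IsWaveletSystem η) (j : ℤ) {M : ℕ}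
    {f : EuclideanSpace ℝ (Fin d) → ℂ} (hf : Integrable fun y => decay M y • f y)
    (hfm : AEStronglyMeasurable f) (x : EuclideanSpace ℝ (Fin d)) :
    HasSum (fun κ : LevelIndex d => waveletCoeff η f (j, κ) * waveletFun η (j, κ) x)
      (levelProj (η 0) (j - 1) f x - levelProj (η 0) j f x) := by
  obtain ⟨C, hC, h⟩ := exists_le_decay_of_fin_two η (M + 2)
  have ha : (0 : ℝ) < 2 ^ j := by positivity
  set D : ℝ := ((1 + 2 ^ j) * (1 + ‖x‖)) ^ M with hD
  have hb : ∀ (κ : LevelIndex d) y, ‖waveletFun η (j, κ) x‖ * ‖waveletFun η (j, κ) y‖ ≤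
      C ^ d * C ^ d * D * (∏ m, decay 2 (x m / 2 ^ j - κ.1 m)) * decay M y := by
    intro κ y
    have h1 := norm_waveletFun_le h (j, κ) x
    have h2 := norm_waveletFun_le h (j, κ) y
    have h3 : ∏ m, decay (M + 2) (y m / 2 ^ j - κ.1 m) ≤ ∏ m, decay M (y m / 2 ^ j - κ.1 m) :=
      Finset.prod_le_prod (fun _ _ => decay_nonneg _ _) fun _ _ => decay_anti (by omega) _
    have h4 : (∏ m, decay M (x m / 2 ^ j - κ.1 m)) * ∏ m, decay M (y m / 2 ^ j - κ.1 m) ≤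
        D * decay M y := by
      rw [← Finset.prod_mul_distrib]
      refine le_trans (Finset.prod_le_prod
        (fun _ _ => mul_nonneg (decay_nonneg _ _) (decay_nonneg _ _))
        fun m _ => decay_mul_le M _ _) ?_
      refine le_trans (le_of_eq ?_) ((prod_decay_le M (((2 : ℝ) ^ j)⁻¹ • (x - y))).trans
        (decay_smul_sub_le M ha x y))
      refine Finset.prod_congr rfl fun m _ => ?_
      congr 1
      simp only [PiLp.smul_apply, PiLp.sub_apply, smul_eq_mul]
      field_simp
      ring
    have p0 : ∀ (L : ℕ) (g : Fin d → ℝ), 0 ≤ ∏ m, decay L (g m) := fun L g =>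
      Finset.prod_nonneg fun _ _ => decay_nonneg _ _
    calc _ ≤ (C ^ d * ∏ m, decay (M + 2) (x m / 2 ^ j - κ.1 m)) *
          (C ^ d * ∏ m, decay (M + 2) (y m / 2 ^ j - κ.1 m)) :=
          mul_le_mul h1 h2 (norm_nonneg _) (mul_nonneg (by positivity) (p0 _ _))
      _ ≤ (C ^ d * ∏ m, decay (M + 2) (x m / 2 ^ j - κ.1 m)) *
          (C ^ d * ∏ m, decay M (y m / 2 ^ j - κ.1 m)) :=
          mul_le_mul_of_nonneg_left (mul_le_mul_of_nonneg_left h3 (by positivity))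
            (mul_nonneg (by positivity) (p0 _ _))
      _ = C ^ d * C ^ d * (∏ m, decay 2 (x m / 2 ^ j - κ.1 m)) *
          ((∏ m, decay M (x m / 2 ^ j - κ.1 m)) * ∏ m, decay M (y m / 2 ^ j - κ.1 m)) := by
          simp only [decay_add, Finset.prod_mul_distrib]; ring
      _ ≤ C ^ d * C ^ d * (∏ m, decay 2 (x m / 2 ^ j - κ.1 m)) * (D * decay M y) :=
          mul_le_mul_of_nonneg_left h4 (mul_nonneg (by positivity) (p0 _ _))
      _ = _ := by ring
  have hbF : ∀ (κ : LevelIndex d) y, ‖(((((2 : ℝ) ^ j) ^ d)⁻¹ : ℝ) : ℂ) *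
      (waveletFun η (j, κ) x * conj (waveletFun η (j, κ) y)) * f y‖ ≤
      (((2 : ℝ) ^ j) ^ d)⁻¹ * (C ^ d * C ^ d * D) * (∏ m, decay 2 (x m / 2 ^ j - κ.1 m)) *
        ‖decay M y • f y‖ := by
    intro κ y
    rw [norm_mul, norm_mul, norm_mul, RCLike.norm_conj, Complex.norm_real,
      Real.norm_of_nonneg (by positivity), norm_smul, Real.norm_of_nonneg (decay_nonneg _ _)]
    calc _ ≤ (((2 : ℝ) ^ j) ^ d)⁻¹ * (C ^ d * C ^ d * D *
          (∏ m, decay 2 (x m / 2 ^ j - κ.1 m)) * decay M y) * ‖f y‖ :=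
          mul_le_mul_of_nonneg_right (mul_le_mul_of_nonneg_left (hb κ y) (by positivity))
            (norm_nonneg _)
      _ = _ := by ring
  have hi : ∀ κ : LevelIndex d, Integrable fun y => (((((2 : ℝ) ^ j) ^ d)⁻¹ : ℝ) : ℂ) *
      (waveletFun η (j, κ) x * conj (waveletFun η (j, κ) y)) * f y := fun κ =>
    (hf.norm.const_mul _).mono' ((continuous_const.mul (continuous_const.mul
      (Complex.continuous_conj.comp (continuous_waveletFun η (j, κ))))).aestronglyMeasurable.mul
      hfm) (Filter.Eventually.of_forall (hbF κ))
  have hS := hasSum_integral_of_summable_integral_norm hi ?_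
  · have hφ := h 0
    have e1 : levelProj (η 0) (j - 1) f x - levelProj (η 0) j f x =
        ∫ y, ∑' κ : LevelIndex d, (((((2 : ℝ) ^ j) ^ d)⁻¹ : ℝ) : ℂ) *
          (waveletFun η (j, κ) x * conj (waveletFun η (j, κ) y)) * f y := by
      unfold levelProj
      rw [← integral_sub (integrable_levelTensor_mul hφ (η 0).continuous _ hf hfm x)
        (integrable_levelTensor_mul hφ (η 0).continuous _ hf hfm x)]
      refine integral_congr_ae (Filter.Eventually.of_forall fun y => ?_)
      simp only
      rw [← sub_mul, ((hasSum_levelTensor_sub hη j x y).mul_right (f y)).tsum_eq]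
    rw [e1]
    refine hS.congr_fun fun κ => ?_
    rw [waveletCoeff, ← integral_const_mul, ← integral_mul_const]
    refine integral_congr_ae (Filter.Eventually.of_forall fun y => ?_)
    simp only [Complex.ofReal_inv]
    ring
  · refine Summable.of_nonneg_of_le (fun κ => integral_nonneg fun y => norm_nonneg _)
      (fun κ => integral_mono (hi κ).norm (hf.norm.const_mul _) (hbF κ)) ?_
    simp only [integral_const_mul]
    exact ((summable_levelIndex_decay (fun m => x m / 2 ^ j)).1.mul_left _).mul_right _

end Euclidean

/-! ### Convergence of the projections at fine scales -/

section FineScale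

variable {d : ℕ}

/-- Integration is in the first variable because the projection is going to be moved onto the test
function; Hermitian symmetry of the kernel reduces this to `integral_shiftKernel`. -/
lemma IsWaveletSystem.integral_tensorKernel {η : Fin 2 → 𝓢(ℝ, ℂ)} (hη : IsWaveletSystem η)
    (y : EuclideanSpace ℝ (Fin d)) : ∫ x, tensorKernel (η 0) x y = 1 := by
  have h1 : ∀ y : ℝ, ∫ x, shiftKernel (η 0) (η 0) x y = 1 := fun y => by
    have h := congrArg conj (hη.integral_shiftKernel y)
    rw [← integral_conj, map_one] at h
    simpa only [conj_shiftKernel] using h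
  rw [← (PiLp.volume_preserving_toLp (Fin d)).integral_comp
    (MeasurableEquiv.toLp 2 (Fin d → ℝ)).measurableEmbedding]
  simp only [tensorKernel]
  rw [integral_fintype_prod_volume_eq_prod
    (f := fun (m : Fin d) (x : ℝ) => shiftKernel (η 0) (η 0) x (y m))]
  simp [h1]

variable {φ : ℝ → ℂ} {C : ℝ} {M : ℕ}

lemma integral_levelTensor_mul (φ : ℝ → ℂ) (j : ℤ) (θ : EuclideanSpace ℝ (Fin d) → ℝ)
    (y : EuclideanSpace ℝ (Fin d)) :
    ∫ x, levelTensor φ j x y * θ x = ∫ s, tensorKernel φ (((2 : ℝ) ^ j)⁻¹ • y + s)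
      (((2 : ℝ) ^ j)⁻¹ • y) * θ (y + (2 : ℝ) ^ j • s) := by
  have ha : (0 : ℝ) < 2 ^ j := by positivity
  have h := integral_add_smul volume (fun x => levelTensor φ j x y * θ x) y ha
  rw [finrank_euclideanSpace_fin] at h
  have h' : ∫ x, levelTensor φ j x y * θ x = ((2 : ℝ) ^ j) ^ d •
      ∫ s, levelTensor φ j (y + (2 : ℝ) ^ j • s) y * θ (y + (2 : ℝ) ^ j • s) := by
    rw [h, smul_smul, mul_inv_cancel₀ (by positivity), one_smul]
  rw [h', ← integral_smul]
  refine integral_congr_ae (Filter.Eventually.of_forall fun s => ?_)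
  simp only [levelTensor_eq, Complex.real_smul]
  rw [smul_add, smul_smul, inv_mul_cancel₀ ha.ne', one_smul, ← mul_assoc, ← mul_assoc,
    ← Complex.ofReal_mul, mul_inv_cancel₀ (by positivity), Complex.ofReal_one, one_mul]

lemma norm_tensorKernel_add_le {L : ℕ} (hφ : ∀ x, ‖φ x‖ ≤ C * decay (L + 2) x)
    (y s : EuclideanSpace ℝ (Fin d)) :
    ‖tensorKernel φ (y + s) y‖ ≤ (C * C * decaySum) ^ d * decay L s := by
  have := norm_tensorKernel_le hφ (y + s) y
  rwa [add_sub_cancel_left] at this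

/-- A majorant uniform in `n` for dominated convergence against a tempered `f`. In the rescaled
variable `s`, `M` orders of decay absorb the shift of the weight (by at most `‖s‖`, the scale being
at most `1`), and `d + 1` orders give integrability. -/
lemma norm_integral_levelTensor_mul_le (hφ : ∀ x, ‖φ x‖ ≤ C * decay (M + (d + 1) + 2) x)
    {θ : EuclideanSpace ℝ (Fin d) → ℝ} {B : ℝ} (hB : ∀ x, ‖θ x‖ ≤ B * decay M x) (n : ℕ)
    (y : EuclideanSpace ℝ (Fin d)) :
    ‖∫ x, levelTensor φ (-(n : ℤ)) x y * θ x‖ ≤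
      (C * C * decaySum) ^ d * B * (∫ s : EuclideanSpace ℝ (Fin d), decay (d + 1) s) *
        decay M y := by
  have h0 : 0 ≤ C * C * decaySum := mul_nonneg (mul_self_nonneg C) decaySum_nonneg
  have hB0 : 0 ≤ B := nonneg_of_mul_nonneg_left ((norm_nonneg _).trans (hB 0)) (decay_pos _ _)
  have ha0 : (0 : ℝ) < 2 ^ (-(n : ℤ)) := by positivity
  have ha1 : (2 : ℝ) ^ (-(n : ℤ)) ≤ 1 := zpow_le_one_of_nonpos₀ (by norm_num) (by simp)
  rw [integral_levelTensor_mul, ← integral_const_mul, ← integral_mul_const]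
  refine norm_integral_le_of_norm_le (((integrable_decay volume (by simp)).const_mul _).mul_const _)
    (Filter.Eventually.of_forall fun s => ?_)
  rw [norm_mul, Complex.norm_real]
  have h1 := norm_tensorKernel_add_le (L := M + (d + 1)) hφ (((2 : ℝ) ^ (-(n : ℤ)))⁻¹ • y) s
  have h2 : ‖θ (y + (2 : ℝ) ^ (-(n : ℤ)) • s)‖ ≤ B * ((1 + ‖s‖) ^ M * decay M y) := by
    refine (hB _).trans (mul_le_mul_of_nonneg_left ((decay_add_le M _ _).trans ?_) hB0)
    refine mul_le_mul_of_nonneg_right ?_ (decay_nonneg _ _)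
    gcongr
    rw [norm_smul, Real.norm_of_nonneg ha0.le]
    exact mul_le_of_le_one_left (norm_nonneg _) ha1
  refine (mul_le_mul h1 h2 (norm_nonneg _)
    (mul_nonneg (pow_nonneg h0 _) (decay_nonneg _ _))).trans_eq ?_
  have h3 : decay M s * (1 + ‖s‖) ^ M = 1 := by
    have := norm_nonneg s
    exact inv_mul_cancel₀ (by positivity)
  rw [decay_add]
  linear_combination (C * C * decaySum) ^ d * decay (d + 1) s * B * decay M y * h3

set_option maxHeartbeats 1000000 in
-- The kernels form an approximate identity: total mass one, and concentration at distance `2^(-n)`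
-- with a fixed integrable profile.
lemma tendsto_integral_levelTensor_mul (hφ : ∀ x, ‖φ x‖ ≤ C * decay (d + 1 + 2) x)
    (hc : Continuous φ) (h1 : ∀ y : EuclideanSpace ℝ (Fin d), ∫ x, tensorKernel φ x y = 1)
    {θ : EuclideanSpace ℝ (Fin d) → ℝ} (hθ : Continuous θ) {B : ℝ} (hB : ∀ x, ‖θ x‖ ≤ B)
    (y : EuclideanSpace ℝ (Fin d)) :
    Filter.Tendsto (fun n : ℕ => ∫ x, levelTensor φ (-(n : ℤ)) x y * θ x) Filter.atTop
      (nhds (θ y)) := by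
  have h0 : 0 ≤ C * C * decaySum := mul_nonneg (mul_self_nonneg C) decaySum_nonneg
  have hC : 0 ≤ C := nonneg_of_mul_nonneg_left ((norm_nonneg _).trans (hφ 0)) (decay_pos _ _)
  have hφ2 : ∀ x, ‖φ x‖ ≤ C * decay 2 x := fun x =>
    (hφ x).trans (mul_le_mul_of_nonneg_left (decay_anti (by omega) _) hC)
  have hdi : Integrable (decay (d + 1) : EuclideanSpace ℝ (Fin d) → ℝ) :=
    integrable_decay volume (by simp)
  have hTc : ∀ Y : EuclideanSpace ℝ (Fin d), Continuous fun s => tensorKernel φ (Y + s) Y :=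
    fun Y => (continuous_tensorKernel hφ2 hc).comp
      (by fun_prop : Continuous fun s : EuclideanSpace ℝ (Fin d) => (Y + s, Y))
  have hTi : ∀ Y : EuclideanSpace ℝ (Fin d), Integrable fun s => tensorKernel φ (Y + s) Y :=
    fun Y => (hdi.const_mul _).mono' (hTc Y).aestronglyMeasurable
      (Filter.Eventually.of_forall (norm_tensorKernel_add_le hφ Y))
  set a : ℕ → ℝ := fun n => (2 : ℝ) ^ (-(n : ℤ)) with ha
  have hat : Filter.Tendsto a Filter.atTop (nhds 0) := by
    have : a = fun n : ℕ => (1 / 2 : ℝ) ^ n := by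
      funext n; simp only [ha]; rw [zpow_neg, zpow_natCast, one_div, inv_pow]
    rw [this]
    exact tendsto_pow_atTop_nhds_zero_of_lt_one (by norm_num) (by norm_num)
  have hlim : Filter.Tendsto (fun n : ℕ => ∫ s, (C * C * decaySum) ^ d * decay (d + 1) s *
      ‖θ (y + a n • s) - θ y‖) Filter.atTop (nhds 0) := by
    rw [show (0 : ℝ) = ∫ s : EuclideanSpace ℝ (Fin d), (0 : ℝ) by simp]
    refine tendsto_integral_of_dominated_convergence
      (fun s => (C * C * decaySum) ^ d * decay (d + 1) s * (B + B)) (fun n => ?_)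
      ((hdi.const_mul _).mul_const _) (fun n => Filter.Eventually.of_forall fun s => ?_)
      (Filter.Eventually.of_forall fun s => ?_)
    · have := decay_continuous (E := EuclideanSpace ℝ (Fin d)) (d + 1)
      exact (by fun_prop : Continuous fun s => (C * C * decaySum) ^ d * decay (d + 1) s *
        ‖θ (y + a n • s) - θ y‖).aestronglyMeasurable
    · rw [norm_mul, norm_norm,
        Real.norm_of_nonneg (mul_nonneg (pow_nonneg h0 _) (decay_nonneg _ _))]
      exact mul_le_mul_of_nonneg_left ((norm_sub_le _ _).trans (add_le_add (hB _) (hB _)))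
        (mul_nonneg (pow_nonneg h0 _) (decay_nonneg _ _))
    · have h2 : Filter.Tendsto (fun n => ‖θ (y + a n • s) - θ y‖) Filter.atTop
          (nhds ‖θ (y + (0 : ℝ) • s) - θ y‖) :=
        ((by fun_prop : Continuous fun r : ℝ => ‖θ (y + r • s) - θ y‖).tendsto 0).comp hat
      simp only [zero_smul, add_zero, sub_self, norm_zero] at h2
      simpa using h2.const_mul ((C * C * decaySum) ^ d * decay (d + 1) s)
  rw [tendsto_iff_norm_sub_tendsto_zero]
  refine squeeze_zero (fun _ => norm_nonneg _) (fun n => ?_) hlim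
  set Y : EuclideanSpace ℝ (Fin d) := ((2 : ℝ) ^ (-(n : ℤ)))⁻¹ • y with hY
  have hI : ∫ s, tensorKernel φ (Y + s) Y = 1 := by
    rw [← h1 Y]
    exact integral_add_left_eq_self (fun x => tensorKernel φ x Y) Y
  have hθn : Continuous fun s => ((θ (y + a n • s) : ℝ) : ℂ) := by fun_prop
  have hi2 : Integrable fun s => tensorKernel φ (Y + s) Y * θ (y + a n • s) :=
    (hTi Y).mul_bdd (c := B) hθn.aestronglyMeasurable
      (Filter.Eventually.of_forall fun s => by rw [Complex.norm_real]; exact hB _)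
  rw [integral_levelTensor_mul]
  have hsub : (∫ s, tensorKernel φ (Y + s) Y * θ (y + a n • s)) - θ y =
      ∫ s, tensorKernel φ (Y + s) Y * ((θ (y + a n • s) : ℂ) - θ y) := by
    simp only [mul_sub]
    rw [integral_sub hi2 ((hTi Y).mul_const _), integral_mul_const, hI, one_mul]
  rw [hsub]
  refine norm_integral_le_of_norm_le ?_ (Filter.Eventually.of_forall fun s => ?_)
  · refine (hdi.const_mul _).mul_bdd (c := B + B) ?_ (Filter.Eventually.of_forall fun s => ?_)
    · exact (by fun_prop : Continuous fun s => ‖θ (y + a n • s) - θ y‖).aestronglyMeasurable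
    · rw [norm_norm]
      exact (norm_sub_le _ _).trans (add_le_add (hB _) (hB _))
  · rw [norm_mul, ← Complex.ofReal_sub, Complex.norm_real]
    exact mul_le_mul_of_nonneg_right (norm_tensorKernel_add_le hφ Y s) (norm_nonneg _)

lemma integral_mul_levelProj (hφ : ∀ x, ‖φ x‖ ≤ C * decay (M + 2) x) (hc : Continuous φ) (j : ℤ)
    {f : EuclideanSpace ℝ (Fin d) → ℂ} (hf : Integrable fun y => decay M y • f y)
    (hfm : AEStronglyMeasurable f) {θ : EuclideanSpace ℝ (Fin d) → ℝ} (hθ : Continuous θ)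
    (hθc : HasCompactSupport θ) :
    ∫ x, (θ x : ℂ) * levelProj φ j f x = ∫ y, (∫ x, levelTensor φ j x y * θ x) * f y := by
  have hC : 0 ≤ C := nonneg_of_mul_nonneg_left ((norm_nonneg _).trans (hφ 0)) (decay_pos _ _)
  have hφ2 : ∀ x, ‖φ x‖ ≤ C * decay 2 x := fun x =>
    (hφ x).trans (mul_le_mul_of_nonneg_left (decay_anti (by omega) _) hC)
  have h0 : 0 ≤ C * C * decaySum := mul_nonneg (mul_self_nonneg C) decaySum_nonneg
  have hint : Integrable (Function.uncurry fun x y => (θ x : ℂ) * (levelTensor φ j x y * f y))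
      (volume.prod volume) := by
    have h1 : Integrable fun x : EuclideanSpace ℝ (Fin d) => θ x * ((((2 : ℝ) ^ j) ^ d)⁻¹ *
        ((C * C * decaySum) ^ d * ((1 + 2 ^ j) * (1 + ‖x‖)) ^ M)) :=
      (by fun_prop : Continuous _).integrable_of_hasCompactSupport hθc.mul_right
    refine (h1.norm.mul_prod hf.norm).mono' ?_ (Filter.Eventually.of_forall fun p => ?_)
    · exact (by fun_prop : Continuous fun p : EuclideanSpace ℝ (Fin d) × EuclideanSpace ℝ (Fin d)
        => ((θ p.1 : ℝ) : ℂ)).aestronglyMeasurable.mul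
        ((continuous_levelTensor hφ2 hc j).aestronglyMeasurable.mul hfm.comp_snd)
    · simp only [Function.uncurry]
      rw [norm_mul, norm_mul, norm_mul, norm_smul, Complex.norm_real,
        Real.norm_of_nonneg (decay_nonneg _ _),
        Real.norm_of_nonneg (r := (((2 : ℝ) ^ j) ^ d)⁻¹ * _)
          (mul_nonneg (by positivity) (mul_nonneg (pow_nonneg h0 _) (by positivity))), mul_assoc]
      refine mul_le_mul_of_nonneg_left ?_ (norm_nonneg _)
      rw [← mul_assoc]
      refine mul_le_mul_of_nonneg_right ((norm_levelTensor_le hφ j _ _).trans ?_) (norm_nonneg _)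
      have h2 := decay_smul_sub_le M (show (0 : ℝ) < 2 ^ j by positivity) p.1 p.2
      calc _ ≤ (((2 : ℝ) ^ j) ^ d)⁻¹ * ((C * C * decaySum) ^ d *
            (((1 + 2 ^ j) * (1 + ‖p.1‖)) ^ M * decay M p.2)) :=
            mul_le_mul_of_nonneg_left (mul_le_mul_of_nonneg_left h2 (pow_nonneg h0 _))
              (by positivity)
        _ = _ := by ring
  unfold levelProj
  simp only [← integral_const_mul]
  rw [integral_integral_swap hint]
  refine integral_congr_ae (Filter.Eventually.of_forall fun y => ?_)
  simp only
  rw [← integral_mul_const]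
  refine integral_congr_ae (Filter.Eventually.of_forall fun x => ?_)
  simp only
  ring

lemma continuous_levelProj (hφ : ∀ x, ‖φ x‖ ≤ C * decay (M + 2) x) (hc : Continuous φ) (j : ℤ)
    {f : EuclideanSpace ℝ (Fin d) → ℂ} (hf : Integrable fun y => decay M y • f y)
    (hfm : AEStronglyMeasurable f) : Continuous (levelProj φ j f) := by
  have hC : 0 ≤ C := nonneg_of_mul_nonneg_left ((norm_nonneg _).trans (hφ 0)) (decay_pos _ _)
  have hφ2 : ∀ x, ‖φ x‖ ≤ C * decay 2 x := fun x =>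
    (hφ x).trans (mul_le_mul_of_nonneg_left (decay_anti (by omega) _) hC)
  have h0 : 0 ≤ C * C * decaySum := mul_nonneg (mul_self_nonneg C) decaySum_nonneg
  rw [continuous_iff_continuousAt]
  intro x₀
  have hnear : ∀ᶠ x in nhds x₀, ‖x‖ < ‖x₀‖ + 1 :=
    (continuous_norm.tendsto x₀).eventually_lt_const (by linarith)
  refine continuousAt_of_dominated (bound := fun y => (((2 : ℝ) ^ j) ^ d)⁻¹ *
    ((C * C * decaySum) ^ d * ((1 + 2 ^ j) * (1 + (‖x₀‖ + 1))) ^ M) * ‖decay M y • f y‖)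
    (Filter.Eventually.of_forall fun x =>
      (integrable_levelTensor_mul hφ hc j hf hfm x).1) ?_ (hf.norm.const_mul _)
    (Filter.Eventually.of_forall fun y => ?_)
  · filter_upwards [hnear] with x hx
    refine Filter.Eventually.of_forall fun y => ?_
    rw [norm_mul, norm_smul, Real.norm_of_nonneg (decay_nonneg _ _), ← mul_assoc]
    refine mul_le_mul_of_nonneg_right ((norm_levelTensor_le hφ j _ _).trans ?_) (norm_nonneg _)
    have h2 := decay_smul_sub_le M (show (0 : ℝ) < 2 ^ j by positivity) x y
    have h3 : ((1 + (2 : ℝ) ^ j) * (1 + ‖x‖)) ^ M ≤ ((1 + 2 ^ j) * (1 + (‖x₀‖ + 1))) ^ M := by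
      gcongr
    have h4 := h2.trans (mul_le_mul_of_nonneg_right h3 (decay_nonneg M y))
    calc _ ≤ (((2 : ℝ) ^ j) ^ d)⁻¹ * ((C * C * decaySum) ^ d *
          (((1 + 2 ^ j) * (1 + (‖x₀‖ + 1))) ^ M * decay M y)) :=
          mul_le_mul_of_nonneg_left (mul_le_mul_of_nonneg_left h4 (pow_nonneg h0 _))
            (by positivity)
      _ = _ := by ring
  · exact (((continuous_levelTensor hφ2 hc j).comp
      (by fun_prop : Continuous fun x : EuclideanSpace ℝ (Fin d) => (x, y))).mul_const
        _).continuousAt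

/-- Against a test function `θ`, Fubini moves the projection from `f` to `θ`, where it converges
with a weighted majorant; so the projections of `f` converge to `f` weakly. Uniform convergence
gives `h` as a second weak limit. -/
lemma IsWaveletSystem.ae_eq_of_tendstoUniformly {η : Fin 2 → 𝓢(ℝ, ℂ)} (hη : IsWaveletSystem η)
    {M : ℕ} {f h : EuclideanSpace ℝ (Fin d) → ℂ} (hf : Integrable fun y => decay M y • f y)
    (hfm : AEStronglyMeasurable f)
    (hh : TendstoUniformly (fun n : ℕ => levelProj (η 0) (-(n : ℤ)) f) h Filter.atTop) :
    f =ᵐ[volume] h := by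
  obtain ⟨C, hC, hφ⟩ := exists_schwartz_le_decay (η 0) (M + (d + 1) + 2)
  have hφM : ∀ x, ‖η 0 x‖ ≤ C * decay (M + 2) x := fun x =>
    (hφ x).trans (mul_le_mul_of_nonneg_left (decay_anti (by omega) _) hC.le)
  have hφd : ∀ x, ‖η 0 x‖ ≤ C * decay (d + 1 + 2) x := fun x =>
    (hφ x).trans (mul_le_mul_of_nonneg_left (decay_anti (by omega) _) hC.le)
  have hPc := fun n : ℕ => continuous_levelProj hφM (η 0).continuous (-(n : ℤ)) hf hfm
  have hhc : Continuous h := hh.continuous (Filter.Frequently.of_forall hPc)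
  have hfl : LocallyIntegrable f := by
    have h1 := hf.locallyIntegrable.locallyIntegrableOn Set.univ
    have h2 := h1.continuousOn_smul (g := fun y : EuclideanSpace ℝ (Fin d) => (1 + ‖y‖) ^ M)
      isOpen_univ.isLocallyClosed (by fun_prop : Continuous _).continuousOn
    rw [locallyIntegrableOn_univ] at h2
    refine h2.congr (Filter.Eventually.of_forall fun y => ?_)
    have := norm_nonneg y
    simp only [smul_smul, decay]
    rw [mul_inv_cancel₀ (by positivity), one_smul]
  refine ae_eq_of_integral_contDiff_smul_eq hfl hhc.locallyIntegrable fun θ hθ hθc => ?_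
  have hθ' := hθ.continuous
  simp only [Complex.real_smul]
  obtain ⟨B, hB⟩ : ∃ B, ∀ x, ‖θ x‖ ≤ B * decay M x := by
    obtain ⟨B, hB⟩ := (by fun_prop : Continuous fun x : EuclideanSpace ℝ (Fin d) =>
      θ x * (1 + ‖x‖) ^ M).bounded_above_of_compact_support hθc.mul_right
    refine ⟨B, fun x => ?_⟩
    have := norm_nonneg x
    have h1 := hB x
    rw [norm_mul, Real.norm_of_nonneg (by positivity : 0 ≤ (1 + ‖x‖) ^ M)] at h1
    rwa [decay, ← div_eq_mul_inv, le_div_iff₀ (by positivity)]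
  have hB0 : 0 ≤ B := nonneg_of_mul_nonneg_left ((norm_nonneg _).trans (hB 0)) (decay_pos _ _)
  have hB1 : ∀ x, ‖θ x‖ ≤ B := fun x =>
    (hB x).trans (mul_le_of_le_one_right hB0 (decay_le_one _ _))
  have lim1 : Filter.Tendsto (fun n : ℕ => ∫ x, (θ x : ℂ) * levelProj (η 0) (-(n : ℤ)) f x)
      Filter.atTop (nhds (∫ x, (θ x : ℂ) * f x)) := by
    simp only [integral_mul_levelProj hφM (η 0).continuous _ hf hfm hθ' hθc]
    refine tendsto_integral_of_dominated_convergence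
      (fun y => (C * C * decaySum) ^ d * B *
        (∫ s : EuclideanSpace ℝ (Fin d), decay (d + 1) s) * ‖decay M y • f y‖) (fun n => ?_)
      (hf.norm.const_mul _) (fun n => Filter.Eventually.of_forall fun y => ?_)
      (Filter.Eventually.of_forall fun y => ?_)
    · refine AEStronglyMeasurable.mul ?_ hfm
      have hc2 := continuous_levelTensor (d := d) (φ := η 0) (C := C)
        (fun x => (hφ x).trans (mul_le_mul_of_nonneg_left (decay_anti (by omega) _) hC.le))
        (η 0).continuous (-(n : ℤ))
      refine (StronglyMeasurable.integral_prod_left (f := fun x y =>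
        levelTensor (η 0) (-(n : ℤ)) x y * θ x) (μ := volume) ?_).aestronglyMeasurable
      exact (hc2.mul (by fun_prop : Continuous fun p :
        EuclideanSpace ℝ (Fin d) × EuclideanSpace ℝ (Fin d) => ((θ p.1 : ℝ) : ℂ))
        ).stronglyMeasurable
    · rw [norm_mul, norm_smul, Real.norm_of_nonneg (decay_nonneg _ _), ← mul_assoc]
      exact mul_le_mul_of_nonneg_right (norm_integral_levelTensor_mul_le hφ hB n y)
        (norm_nonneg _)
    · exact (tendsto_integral_levelTensor_mul hφd (η 0).continuous hη.integral_tensorKernel hθ'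
        hB1 y).mul_const _
  have hθi : Integrable fun x => (θ x : ℂ) :=
    (by fun_prop : Continuous fun x => (θ x : ℂ)).integrable_of_hasCompactSupport
      (hθc.comp_left (g := fun t : ℝ => (t : ℂ)) rfl)
  have lim2 : Filter.Tendsto (fun n : ℕ => ∫ x, (θ x : ℂ) * levelProj (η 0) (-(n : ℤ)) f x)
      Filter.atTop (nhds (∫ x, (θ x : ℂ) * h x)) := by
    have hθm : ∀ {F : EuclideanSpace ℝ (Fin d) → ℂ}, Continuous F →
        Integrable fun x => (θ x : ℂ) * F x := fun {F} hF =>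
      (by fun_prop : Continuous fun x => (θ x : ℂ) * F x).integrable_of_hasCompactSupport
        (hθc.comp_left (g := fun t : ℝ => (t : ℂ)) rfl).mul_right
    rw [Metric.tendsto_atTop]
    intro ε hε
    set I := ∫ x, ‖(θ x : ℂ)‖ with hI
    have hI0 : 0 ≤ I := integral_nonneg fun _ => norm_nonneg _
    have hu := Metric.tendstoUniformly_iff.1 hh (ε / (I + 1)) (by positivity)
    obtain ⟨n₀, hn₀⟩ := Filter.eventually_atTop.1 hu
    refine ⟨n₀, fun n hn => ?_⟩
    rw [dist_eq_norm, ← integral_sub (hθm (hPc n)) (hθm hhc)]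
    have hle : ‖∫ x, ((θ x : ℂ) * levelProj (η 0) (-(n : ℤ)) f x - (θ x : ℂ) * h x)‖ ≤
        ∫ x, ‖(θ x : ℂ)‖ * (ε / (I + 1)) := by
      refine norm_integral_le_of_norm_le (hθi.norm.mul_const _)
        (Filter.Eventually.of_forall fun x => ?_)
      rw [← mul_sub, norm_mul, ← dist_eq_norm, dist_comm]
      exact mul_le_mul_of_nonneg_left (hn₀ n hn x).le (norm_nonneg _)
    refine hle.trans_lt ?_
    rw [integral_mul_const, ← mul_div_assoc, div_lt_iff₀ (by positivity)]
    nlinarith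
  exact tendsto_nhds_unique lim1 lim2

end FineScale

/-! ### Finite differences of the projections at coarse scales -/

lemma hasDerivAt_fwdDiff_iter (h : ℝ) (N : ℕ) {f f' : ℝ → ℂ} (hf : ∀ x, HasDerivAt f (f' x) x)
    (x : ℝ) : HasDerivAt ((fwdDiff h)^[N] f) ((fwdDiff h)^[N] f' x) x := by
  induction N generalizing f f' with
  | zero => exact hf x
  | succ N ih =>
    simp only [Function.iterate_succ_apply]
    exact ih fun y => ((hf (y + h)).comp_add_const y h).sub (hf y)

/-- By induction with the mean value theorem: each difference is replaced by a derivative, gaining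
`h`, and the intermediate point lies within `1` of `x`, costing `2^L`. -/
lemma exists_norm_fwdDiff_iter_le (N L : ℕ) (φ : 𝓢(ℝ, ℂ)) :
    ∃ C : ℝ, 0 < C ∧ ∀ h : ℝ, 0 ≤ h → h ≤ 1 → ∀ x,
      ‖(fwdDiff h)^[N] φ x‖ ≤ C * h ^ N * decay L x := by
  induction N generalizing φ with
  | zero =>
    obtain ⟨C, hC, h⟩ := exists_schwartz_le_decay φ L
    exact ⟨C, hC, fun t _ _ x => by simpa using h x⟩
  | succ N ih =>
    obtain ⟨C, hC, hb⟩ := ih (SchwartzMap.derivCLM ℂ ℂ φ)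
    refine ⟨C * 2 ^ L, by positivity, fun h h0 h1 x => ?_⟩
    rw [Function.iterate_succ_apply', fwdDiff]
    have hd := hasDerivAt_fwdDiff_iter h N (f := φ) (f' := SchwartzMap.derivCLM ℂ ℂ φ)
      fun y => φ.hasDerivAt y
    have hmv := (convex_Icc x (x + h)).norm_image_sub_le_of_norm_hasDerivWithin_le
      (fun y _ => (hd y).hasDerivWithinAt) (C := C * h ^ N * (2 ^ L * decay L x))
      (fun y hy => (hb h h0 h1 y).trans ?_) (Set.left_mem_Icc.2 (by linarith))
      (Set.right_mem_Icc.2 (by linarith))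
    · refine hmv.trans_eq ?_
      rw [add_sub_cancel_left, Real.norm_of_nonneg h0]
      ring
    · refine mul_le_mul_of_nonneg_left ?_ (by positivity)
      have h2 := decay_add_le L x (y - x)
      rw [add_sub_cancel] at h2
      refine h2.trans (mul_le_mul_of_nonneg_right ?_ (decay_nonneg _ _))
      have h3 : ‖y - x‖ ≤ 1 := abs_le.2 ⟨by linarith [hy.1], by linarith [hy.2]⟩
      gcongr
      linarith

lemma fwdDiff_iter_shiftKernel {α β : ℝ → ℂ} {A B : ℝ} (hα : ∀ x, ‖α x‖ ≤ A * decay 2 x)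
    (hβ : ∀ x, ‖β x‖ ≤ B * decay 2 x) (h : ℝ) (N : ℕ) (x y : ℝ) :
    (fwdDiff h)^[N] (fun x => shiftKernel α β x y) x =
      shiftKernel ((fwdDiff h)^[N] α) β x y := by
  rw [fwdDiff_iter_eq_sum_shift]
  simp only [shiftKernel, fwdDiff_iter_eq_sum_shift, Finset.sum_mul]
  rw [Summable.tsum_finsetSum]
  · refine Finset.sum_congr rfl fun i _ => ?_
    rw [zsmul_eq_mul, ← tsum_mul_left]
    refine tsum_congr fun k => ?_
    rw [zsmul_eq_mul, mul_assoc, sub_add_eq_add_sub]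
  · intro i _
    refine (((summable_shiftKernel (L := 0) hα hβ (x + i • h) y).of_norm.mul_left
      ((((-1) ^ (N - i) * N.choose i : ℤ) : ℤ) : ℂ))).congr fun k => ?_
    rw [zsmul_eq_mul, mul_assoc, sub_add_eq_add_sub]

lemma fwdDiff_iter_integral_mul {E α : Type*} [AddCommMonoid E] [MeasurableSpace α]
    {μ : Measure α} (v : E) (N : ℕ) {K : E → α → ℂ} {g : α → ℂ}
    (hK : ∀ x, Integrable (fun y => K x y * g y) μ) (x : E) :
    (fwdDiff v)^[N] (fun x => ∫ y, K x y * g y ∂μ) x =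
      ∫ y, (fwdDiff v)^[N] (fun x => K x y) x * g y ∂μ := by
  simp only [fwdDiff_iter_eq_sum_shift, Finset.sum_mul, zsmul_eq_mul, mul_assoc]
  rw [integral_finsetSum _ fun k _ => (hK _).const_mul _]
  exact Finset.sum_congr rfl fun k _ => (integral_const_mul _ _).symm

/-- Along the ray, `p` is a polynomial in `m`, and a polynomial with limit zero vanishes. In the
induction, `fwdDiff v p` also tends to zero, so it vanishes on the ray and `p` is constant there. -/
lemma eq_zero_of_fwdDiff_iter_eq_zero {E F : Type*} [AddCommGroup E] [NormedAddCommGroup F]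
    {v : E} {N : ℕ} {p : E → F} (hp : ∀ x, (fwdDiff v)^[N] p x = 0) (y : E)
    (hlim : Filter.Tendsto (fun m : ℕ => p (y + m • v)) Filter.atTop (nhds 0)) : p y = 0 := by
  induction N generalizing p y with
  | zero => exact hp y
  | succ N ih =>
    have hshift : ∀ k : ℕ, Filter.Tendsto (fun m : ℕ => p (y + k • v + m • v)) Filter.atTop
        (nhds 0) := fun k => by
      refine ((Filter.tendsto_add_atTop_iff_nat k).2 hlim).congr fun m => ?_
      rw [add_assoc, ← add_smul, add_comm m k]
    have hstep : ∀ k : ℕ, p (y + (k + 1) • v) = p (y + k • v) := by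
      intro k
      have h0 := ih (p := fwdDiff v p) (fun x => by
        rw [← Function.iterate_succ_apply]; exact hp x) (y + k • v) (by
        have h1 := (hshift (k + 1)).sub (hshift k)
        rw [sub_zero] at h1
        refine h1.congr fun m => ?_
        rw [fwdDiff]
        congr 2
        rw [add_smul, one_smul]
        abel)
      rw [fwdDiff, sub_eq_zero] at h0
      rw [← h0, add_smul, one_smul, add_assoc]
    have hconst : ∀ k : ℕ, p (y + k • v) = p y := by
      intro k
      induction k with
      | zero => simp
      | succ k ihk => rw [hstep, ihk]
    simp only [hconst] at hlim
    exact tendsto_nhds_unique tendsto_const_nhds hlim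

section CoarseScale

variable {d : ℕ}

/-- A unit step in one coordinate is a step `2^(-n)` in the rescaled variable and affects only one
tensor factor, so each difference gains `2^(-n)`. The normalisation `2^(-nd)` is not needed and is
bounded by `1`. -/
lemma norm_fwdDiff_iter_levelTensor_le {φ : ℝ → ℂ} {C : ℝ} {M N : ℕ} (m₀ : Fin d)
    (hφ : ∀ x, ‖φ x‖ ≤ C * decay (M + 2) x) (n : ℕ)
    (hd : ∀ x, ‖(fwdDiff (((2 : ℝ) ^ n)⁻¹))^[N] φ x‖ ≤
      C * (((2 : ℝ) ^ n)⁻¹) ^ N * decay (M + 2) x) (x y : EuclideanSpace ℝ (Fin d)) :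
    ‖(fwdDiff (EuclideanSpace.single m₀ (1 : ℝ)))^[N] (fun x => levelTensor φ n x y) x‖ ≤
      (((2 : ℝ) ^ n)⁻¹) ^ N * ((C * C * decaySum) ^ d *
        decay M (((2 : ℝ) ^ n)⁻¹ • (x - y))) := by
  have hC : 0 ≤ C := nonneg_of_mul_nonneg_left ((norm_nonneg _).trans (hφ 0)) (decay_pos _ _)
  have hφ2 : ∀ x, ‖φ x‖ ≤ C * decay 2 x := fun x =>
    (hφ x).trans (mul_le_mul_of_nonneg_left (decay_anti (by omega) _) hC)
  have h0 : 0 ≤ C * C * decaySum := mul_nonneg (mul_nonneg hC hC) decaySum_nonneg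
  set h : ℝ := ((2 : ℝ) ^ n)⁻¹ with hh
  have hh0 : 0 < h := by positivity
  have hh1 : h ≤ 1 := inv_le_one_of_one_le₀ (one_le_pow₀ (by norm_num))
  set R : ℂ := ∏ m ∈ Finset.univ.erase m₀, shiftKernel φ φ (h * x m) (h * y m) with hR
  have key : (fwdDiff (EuclideanSpace.single m₀ (1 : ℝ)))^[N] (fun x => levelTensor φ n x y) x =
      ((h ^ d : ℝ) : ℂ) * (shiftKernel ((fwdDiff h)^[N] φ) φ (h * x m₀) (h * y m₀) * R) := by
    rw [← fwdDiff_iter_shiftKernel hφ2 hφ2, fwdDiff_iter_eq_sum_shift, fwdDiff_iter_eq_sum_shift,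
      Finset.sum_mul, Finset.mul_sum]
    refine Finset.sum_congr rfl fun k _ => ?_
    rw [levelTensor_eq, zpow_natCast, ← hh, tensorKernel, ← inv_pow, ← hh,
      ← Finset.mul_prod_erase _ _ (Finset.mem_univ m₀)]
    have e1 : (h • (x + k • EuclideanSpace.single m₀ (1 : ℝ))) m₀ = h * x m₀ + k • h := by
      simp [mul_comm]
    have e2 : ∏ m ∈ Finset.univ.erase m₀,
        shiftKernel φ φ ((h • (x + k • EuclideanSpace.single m₀ (1 : ℝ))) m) ((h • y) m) = R := by
      refine Finset.prod_congr rfl fun m hm => ?_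
      have hm' : m ≠ m₀ := Finset.ne_of_mem_erase hm
      simp [hm']
    rw [e1, e2]
    simp only [zsmul_eq_mul, PiLp.smul_apply, smul_eq_mul]
    ring
  rw [key, norm_mul, norm_mul, Complex.norm_real, Real.norm_of_nonneg (by positivity), hR,
    norm_prod]
  have b1 : ‖shiftKernel ((fwdDiff h)^[N] φ) φ (h * x m₀) (h * y m₀)‖ ≤
      h ^ N * (C * C * decaySum * decay M (h * (x m₀ - y m₀))) := by
    refine (norm_shiftKernel_le hd hφ _ _).trans_eq ?_
    rw [mul_sub]; ring
  have b2 : ∏ m ∈ Finset.univ.erase m₀, ‖shiftKernel φ φ (h * x m) (h * y m)‖ ≤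
      ∏ m ∈ Finset.univ.erase m₀, (C * C * decaySum * decay M (h * (x m - y m))) :=
    Finset.prod_le_prod (fun _ _ => norm_nonneg _) fun m _ => by
      rw [mul_sub]; exact norm_shiftKernel_le hφ hφ _ _
  have b3 : ∏ m, (C * C * decaySum * decay M (h * (x m - y m))) ≤
      (C * C * decaySum) ^ d * decay M (h • (x - y)) := by
    rw [Finset.prod_mul_distrib, Finset.prod_const, Finset.card_univ, Fintype.card_fin]
    exact mul_le_mul_of_nonneg_left (prod_decay_le M (h • (x - y))) (pow_nonneg h0 _)
  have hb0 : ∀ m, 0 ≤ C * C * decaySum * decay M (h * (x m - y m)) := fun m =>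
    mul_nonneg h0 (decay_nonneg _ _)
  calc h ^ d * (‖shiftKernel ((fwdDiff h)^[N] φ) φ (h * x m₀) (h * y m₀)‖ *
        ∏ m ∈ Finset.univ.erase m₀, ‖shiftKernel φ φ (h * x m) (h * y m)‖)
      ≤ 1 * (h ^ N * (C * C * decaySum * decay M (h * (x m₀ - y m₀))) *
        ∏ m ∈ Finset.univ.erase m₀, (C * C * decaySum * decay M (h * (x m - y m)))) := by
        refine mul_le_mul (pow_le_one₀ hh0.le hh1) (mul_le_mul b1 b2
          (Finset.prod_nonneg fun _ _ => norm_nonneg _)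
          (mul_nonneg (by positivity) (hb0 _))) ?_ zero_le_one
        exact mul_nonneg (norm_nonneg _) (Finset.prod_nonneg fun _ _ => norm_nonneg _)
    _ = h ^ N * ∏ m, (C * C * decaySum * decay M (h * (x m - y m))) := by
        rw [← Finset.mul_prod_erase _ _ (Finset.mem_univ m₀)]; ring
    _ ≤ _ := mul_le_mul_of_nonneg_left b3 (by positivity)

/-- The `M + 1` differences gain `2^(-n(M+1))`, while the weight needed to integrate `f` loses only
`2^(nM)`; a factor `2^(-n)` survives. -/
lemma tendsto_fwdDiff_iter_levelProj (φ : 𝓢(ℝ, ℂ)) (m₀ : Fin d) {M : ℕ}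
    {f : EuclideanSpace ℝ (Fin d) → ℂ} (hf : Integrable fun y => decay M y • f y)
    (hfm : AEStronglyMeasurable f) (x : EuclideanSpace ℝ (Fin d)) :
    Filter.Tendsto (fun n : ℕ => (fwdDiff (EuclideanSpace.single m₀ (1 : ℝ)))^[M + 1]
      (levelProj φ n f) x) Filter.atTop (nhds 0) := by
  obtain ⟨C₀, hC₀, hφ₀⟩ := exists_schwartz_le_decay φ (M + 2)
  obtain ⟨C₁, hC₁, hφ₁⟩ := exists_norm_fwdDiff_iter_le (M + 1) (M + 2) φ
  set C := C₀ + C₁ with hC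
  have hC0 : 0 < C := by positivity
  have hφ : ∀ x, ‖φ x‖ ≤ C * decay (M + 2) x := fun x =>
    (hφ₀ x).trans (mul_le_mul_of_nonneg_right (by linarith) (decay_nonneg _ _))
  have h0 : 0 ≤ C * C * decaySum := mul_nonneg (mul_self_nonneg C) decaySum_nonneg
  set v : EuclideanSpace ℝ (Fin d) := EuclideanSpace.single m₀ (1 : ℝ) with hv
  set D : ℝ := (C * C * decaySum) ^ d * (2 * (1 + ‖x‖)) ^ M with hD
  have hD0 : 0 ≤ D := mul_nonneg (pow_nonneg h0 _) (by positivity)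
  have hb : ∀ n : ℕ, ‖(fwdDiff v)^[M + 1] (levelProj φ n f) x‖ ≤
      (1 / 2 : ℝ) ^ n * (D * ∫ y, ‖decay M y • f y‖) := by
    intro n
    set h : ℝ := ((2 : ℝ) ^ n)⁻¹ with hh
    have hh0 : 0 < h := by positivity
    have hh1 : h ≤ 1 := inv_le_one_of_one_le₀ (one_le_pow₀ (by norm_num))
    have hd : ∀ x, ‖(fwdDiff h)^[M + 1] φ x‖ ≤ C * h ^ (M + 1) * decay (M + 2) x := fun x =>
      (hφ₁ h hh0.le hh1 x).trans (mul_le_mul_of_nonneg_right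
        (mul_le_mul_of_nonneg_right (by linarith) (by positivity)) (decay_nonneg _ _))
    have e : (fwdDiff v)^[M + 1] (levelProj φ n f) x =
        ∫ y, (fwdDiff v)^[M + 1] (fun x => levelTensor φ n x y) x * f y := by
      exact fwdDiff_iter_integral_mul v (M + 1)
        (fun x => integrable_levelTensor_mul hφ φ.continuous n hf hfm x) x
    rw [e, ← integral_const_mul, ← integral_const_mul]
    refine norm_integral_le_of_norm_le ((hf.norm.const_mul _).const_mul _)
      (Filter.Eventually.of_forall fun y => ?_)
    rw [norm_mul, norm_smul, Real.norm_of_nonneg (decay_nonneg _ _), ← mul_assoc D, ← mul_assoc]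
    refine mul_le_mul_of_nonneg_right
      ((norm_fwdDiff_iter_levelTensor_le m₀ hφ n hd x y).trans ?_) (norm_nonneg _)
    have h2 := decay_smul_sub_le M (show (0 : ℝ) < 2 ^ n by positivity) x y
    have h3 : h ^ M * ((1 + 2 ^ n) * (1 + ‖x‖)) ^ M ≤ (2 * (1 + ‖x‖)) ^ M := by
      rw [← mul_pow, ← mul_assoc]
      have : h * (1 + 2 ^ n) ≤ 2 := by
        rw [mul_add, hh, inv_mul_cancel₀ (by positivity), mul_one]
        linarith
      gcongr
    have h4 : h = (1 / 2 : ℝ) ^ n := by rw [hh, one_div, inv_pow]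
    have hdM := decay_nonneg M y
    calc h ^ (M + 1) * ((C * C * decaySum) ^ d * decay M (((2 : ℝ) ^ n)⁻¹ • (x - y)))
        ≤ h ^ (M + 1) * ((C * C * decaySum) ^ d *
          (((1 + 2 ^ n) * (1 + ‖x‖)) ^ M * decay M y)) :=
          mul_le_mul_of_nonneg_left (mul_le_mul_of_nonneg_left h2 (pow_nonneg h0 _))
            (by positivity)
      _ = h * ((C * C * decaySum) ^ d *
          ((h ^ M * ((1 + 2 ^ n) * (1 + ‖x‖)) ^ M) * decay M y)) := by ring
      _ ≤ h * ((C * C * decaySum) ^ d * ((2 * (1 + ‖x‖)) ^ M * decay M y)) :=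
          mul_le_mul_of_nonneg_left (mul_le_mul_of_nonneg_left
            (mul_le_mul_of_nonneg_right h3 hdM) (pow_nonneg h0 _)) hh0.le
      _ = _ := by rw [hD, ← h4]; ring
  rw [tendsto_zero_iff_norm_tendsto_zero]
  refine squeeze_zero (fun _ => norm_nonneg _) hb ?_
  have h2 : Filter.Tendsto (fun n : ℕ => (1 / 2 : ℝ) ^ n) Filter.atTop (nhds 0) :=
    tendsto_pow_atTop_nhds_zero_of_lt_one (by norm_num) (by norm_num)
  simpa only [zero_mul] using h2.mul_const (D * ∫ y, ‖decay M y • f y‖)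

/-- A function in `L_τ` tends to zero along almost every discrete ray in a coordinate direction. -/
lemma ae_tendsto_add_nsmul_single {τ : ℝ} (hτ : 0 < τ) (m₀ : Fin d)
    {f : EuclideanSpace ℝ (Fin d) → ℂ} (hf : MemLp f (ENNReal.ofReal τ)) :
    ∀ᵐ y, Filter.Tendsto (fun m : ℕ => f (y + m • EuclideanSpace.single m₀ (1 : ℝ)))
      Filter.atTop (nhds 0) := by
  set v : EuclideanSpace ℝ (Fin d) := EuclideanSpace.single m₀ (1 : ℝ) with hv
  set F : EuclideanSpace ℝ (Fin d) → ℝ≥0∞ := fun y => ‖f y‖ₑ ^ τ with hF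
  have hFi : ∫⁻ y, F y < ∞ := by
    have := (eLpNorm_lt_top_iff_lintegral_rpow_enorm_lt_top (by simpa using hτ)
      ENNReal.ofReal_ne_top).1 hf.2
    rwa [ENNReal.toReal_ofReal hτ.le] at this
  have hFm : AEMeasurable F := hf.1.enorm.pow_const τ
  -- Summing `F` over the integer translates is not globally integrable, so it is first weighted in
  -- the direction of the ray. Shifting the translations onto `ρ` bounds the integral by `decaySum *
  -- ∫ F`, and positivity of `ρ` returns the unweighted sum almost everywhere.
  set ρ : EuclideanSpace ℝ (Fin d) → ℝ≥0∞ := fun y => ENNReal.ofReal (decay 2 (y m₀)) with hρ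
  have hρm : Measurable ρ := by
    have := (decay_continuous (E := ℝ) 2)
    exact (by fun_prop : Continuous fun y : EuclideanSpace ℝ (Fin d) =>
      decay 2 (y m₀)).measurable.ennreal_ofReal
  have hsh : ∀ m : ℤ, ∫⁻ y, ρ y * F (y + m • v) = ∫⁻ z, ρ (z - m • v) * F z := by
    intro m
    rw [← lintegral_add_right_eq_self (fun z => ρ (z - m • v) * F z) (m • v)]
    simp
  have hFs : ∀ m : ℤ, AEMeasurable fun y => F (y + m • v) := fun m =>
    hFm.comp_quasiMeasurePreserving
      (measurePreserving_add_right volume (m • v)).quasiMeasurePreserving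
  have hρF : ∀ m : ℤ, AEMeasurable fun y => ρ y * F (y + m • v) := fun m =>
    hρm.aemeasurable.mul (hFs m)
  have hρF' : ∀ m : ℤ, AEMeasurable fun z => ρ (z - m • v) * F z := fun m =>
    (hρm.comp (measurable_sub_const (m • v))).aemeasurable.mul hFm
  have hsum : ∫⁻ y, ∑' m : ℤ, ρ y * F (y + m • v) < ∞ := by
    rw [lintegral_tsum hρF]
    simp only [hsh]
    rw [← lintegral_tsum hρF']
    refine lt_of_le_of_lt (lintegral_mono (g := fun z => ENNReal.ofReal decaySum * F z)
      fun z => ?_) ?_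
    · simp only
      rw [ENNReal.tsum_mul_right]
      refine mul_le_mul_left ?_ _
      have e : ∀ m : ℤ, ρ (z - m • v) = ENNReal.ofReal (decay 2 (z m₀ - m)) := fun m => by
        simp [hρ, hv]
      simp only [e]
      rw [← ENNReal.ofReal_tsum_of_nonneg (fun m => decay_nonneg _ _)
        (summable_decay_int le_rfl _)]
      exact ENNReal.ofReal_le_ofReal (tsum_decay_int_le le_rfl _)
    · rw [lintegral_const_mul' _ _ ENNReal.ofReal_ne_top]
      exact ENNReal.mul_lt_top ENNReal.ofReal_lt_top hFi
  have hae := ae_lt_top' (AEMeasurable.tsum hρF) hsum.ne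
  filter_upwards [hae] with y hy
  have hρ0 : ρ y ≠ 0 := by
    simp only [hρ, ne_eq, ENNReal.ofReal_eq_zero, not_le]
    exact decay_pos _ _
  rw [ENNReal.tsum_mul_left] at hy
  have hy' : ∑' m : ℤ, F (y + m • v) ≠ ∞ := fun h => by
    rw [h, ENNReal.mul_top hρ0] at hy
    exact lt_irrefl _ hy
  have h1 := (ENNReal.tendsto_cofinite_zero_of_tsum_ne_top hy').comp
    (Nat.cast_injective (R := ℤ)).tendsto_cofinite
  rw [Nat.cofinite_eq_atTop] at h1
  rw [tendsto_zero_iff_enorm_tendsto_zero]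
  have h2 := (ENNReal.continuous_rpow_const (y := 1 / τ)).tendsto 0 |>.comp h1
  rw [ENNReal.zero_rpow_of_pos (by positivity)] at h2
  refine h2.congr fun m => ?_
  simp only [Function.comp_apply, hF, natCast_zsmul]
  rw [← ENNReal.rpow_mul, mul_one_div_cancel hτ.ne', ENNReal.rpow_one]

end CoarseScale

/-! ### Pointwise reconstruction from the wavelet coefficients -/

section Reconstruction

variable {d : ℕ}

lemma summable_norm_mul_waveletFun {η : Fin 2 → 𝓢(ℝ, ℂ)} {C : ℝ} (hC : 0 ≤ C)
    (h : ∀ i x, ‖η i x‖ ≤ C * decay 2 x) {c : LevelIndex d → ℂ} {A : ℝ} (hA : 0 ≤ A)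
    (hcA : ∀ κ, ‖c κ‖ ≤ A) (j : ℤ) (x : EuclideanSpace ℝ (Fin d)) :
    (Summable fun κ => ‖c κ * waveletFun η (j, κ) x‖) ∧
      ∑' κ, ‖c κ * waveletFun η (j, κ) x‖ ≤ A * (C ^ d * levelSum d) := by
  obtain ⟨hs, hle⟩ := summable_levelIndex_decay (fun m => x m / 2 ^ j)
  have hb : ∀ κ : LevelIndex d, ‖c κ * waveletFun η (j, κ) x‖ ≤
      A * (C ^ d * ∏ m, decay 2 (x m / 2 ^ j - κ.1 m)) := fun κ => by
    rw [norm_mul]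
    exact mul_le_mul (hcA κ) (norm_waveletFun_le h (j, κ) x) (norm_nonneg _) hA
  have hs' := (hs.mul_left (C ^ d)).mul_left A
  have h1 : Summable fun κ => ‖c κ * waveletFun η (j, κ) x‖ :=
    hs'.of_nonneg_of_le (fun _ => norm_nonneg _) hb
  refine ⟨h1, (h1.tsum_le_tsum hb hs').trans ?_⟩
  rw [tsum_mul_left, tsum_mul_left]
  exact mul_le_mul_of_nonneg_left (mul_le_mul_of_nonneg_left hle (pow_nonneg hC _)) hA

lemma tendsto_waveletFun_add_nsmul_single (η : Fin 2 → 𝓢(ℝ, ℂ)) (m₀ : Fin d) (i : WaveletIndex d)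
    (y : EuclideanSpace ℝ (Fin d)) :
    Filter.Tendsto (fun m : ℕ => waveletFun η i (y + m • EuclideanSpace.single m₀ (1 : ℝ)))
      Filter.atTop (nhds 0) := by
  obtain ⟨C, hC, h⟩ := exists_le_decay_of_fin_two η 1
  have ha : (0 : ℝ) < 2 ^ i.1 := by positivity
  rw [tendsto_zero_iff_norm_tendsto_zero]
  have hlim : Filter.Tendsto (fun m : ℕ => (y m₀ + (m : ℝ)) / 2 ^ i.1 - i.2.1 m₀)
      Filter.atTop Filter.atTop :=
    Filter.tendsto_atTop_add_const_right _ _ ((Filter.tendsto_atTop_add_const_left _ _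
      tendsto_natCast_atTop_atTop).atTop_div_const ha)
  have hlim2 : Filter.Tendsto (fun m : ℕ =>
      C ^ d * decay 1 ((y m₀ + (m : ℝ)) / 2 ^ i.1 - i.2.1 m₀)) Filter.atTop (nhds 0) := by
    rw [← mul_zero (C ^ d)]
    refine Filter.Tendsto.const_mul _ ?_
    simp only [decay, pow_one]
    exact (Filter.tendsto_atTop_add_const_left _ _
      (tendsto_norm_atTop_atTop.comp hlim)).inv_tendsto_atTop
  refine squeeze_zero (fun _ => norm_nonneg _) (fun m => ?_) hlim2
  refine (norm_waveletFun_le h i _).trans (mul_le_mul_of_nonneg_left ?_ (by positivity))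
  have e : (y + m • EuclideanSpace.single m₀ (1 : ℝ)) m₀ = y m₀ + m := by simp
  rw [← Finset.mul_prod_erase _ _ (Finset.mem_univ m₀), e]
  exact mul_le_of_le_one_right (decay_nonneg _ _)
    (Finset.prod_le_one (fun _ _ => decay_nonneg _ _) fun _ _ => decay_le_one _ _)

/-- Only finitely many coefficients exceed `δ`, and their wavelets decay along the ray; the rest
contribute at most `δ` times the level bound, uniformly in the point. -/
lemma tendsto_tsum_mul_waveletFun {η : Fin 2 → 𝓢(ℝ, ℂ)} {c : LevelIndex d → ℂ}
    (hc : Filter.Tendsto c Filter.cofinite (nhds 0)) (m₀ : Fin d) (j : ℤ)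
    (y : EuclideanSpace ℝ (Fin d)) :
    Filter.Tendsto (fun m : ℕ => ∑' κ, c κ *
      waveletFun η (j, κ) (y + m • EuclideanSpace.single m₀ (1 : ℝ))) Filter.atTop (nhds 0) := by
  classical
  obtain ⟨C, hC, h⟩ := exists_le_decay_of_fin_two η 2
  rw [Metric.tendsto_atTop]
  intro ε hε
  set D : ℝ := C ^ d * levelSum d with hD
  have hD0 : 0 ≤ D := mul_nonneg (by positivity) (levelSum_nonneg d)
  set δ : ℝ := ε / (2 * (D + 1)) with hδ
  have hδ0 : 0 < δ := by positivity
  have hfin : {κ | ¬ ‖c κ‖ < δ}.Finite := by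
    have := (tendsto_zero_iff_norm_tendsto_zero.1 hc).eventually_lt_const hδ0
    exact Filter.eventually_cofinite.1 this
  set S := hfin.toFinset with hS
  have hfs : Filter.Tendsto (fun m : ℕ => ∑ κ ∈ S, c κ *
      waveletFun η (j, κ) (y + m • EuclideanSpace.single m₀ (1 : ℝ))) Filter.atTop (nhds 0) := by
    rw [show (0 : ℂ) = ∑ κ ∈ S, c κ * 0 by simp]
    exact tendsto_finsetSum _ fun κ _ =>
      (tendsto_waveletFun_add_nsmul_single η m₀ (j, κ) y).const_mul _
  obtain ⟨n₀, hn₀⟩ := Metric.tendsto_atTop.1 hfs (ε / 2) (half_pos hε)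
  refine ⟨n₀, fun m hm => ?_⟩
  have h1 := hn₀ m hm
  rw [dist_zero_right] at h1 ⊢
  set x := y + m • EuclideanSpace.single m₀ (1 : ℝ)
  have h2 := summable_norm_mul_waveletFun hC.le h (c := fun κ => if κ ∈ S then 0 else c κ) hδ0.le
    (fun κ => by
      by_cases hκ : κ ∈ S
      · simp [hκ, hδ0.le]
      · simp only [hκ, if_false]
        simp only [hS, Set.Finite.mem_toFinset, Set.mem_ofPred_eq, not_not] at hκ
        exact hκ.le) j x
  have h3 : HasSum (fun κ => (if κ ∈ S then c κ else 0) * waveletFun η (j, κ) x)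
      (∑ κ ∈ S, c κ * waveletFun η (j, κ) x) := by
    have : HasSum (fun κ => (if κ ∈ S then c κ else 0) * waveletFun η (j, κ) x) _ :=
      hasSum_sum_of_ne_finset_zero (s := S) fun κ hκ => by simp [hκ]
    rwa [Finset.sum_congr rfl (g := fun κ => c κ * waveletFun η (j, κ) x)
      (fun κ hκ => by simp [hκ])] at this
  have h4 := h3.add h2.1.of_norm.hasSum
  have h5 : ∑' κ, c κ * waveletFun η (j, κ) x = _ := (h4.congr_fun fun κ => by
    by_cases hκ : κ ∈ S <;> simp [hκ]).tsum_eq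
  rw [h5]
  have h6 := (norm_tsum_le_tsum_norm h2.1).trans h2.2
  have h7 : δ * D < ε / 2 := by
    rw [hδ, div_mul_eq_mul_div, div_lt_div_iff₀ (by positivity) (by norm_num)]
    nlinarith
  calc _ ≤ _ := norm_add_le _ _
    _ < ε / 2 + ε / 2 := add_lt_add h1 (h6.trans_lt h7)
    _ = ε := add_halves ε

set_option maxHeartbeats 1000000 in
-- The series over all levels telescopes to the difference between the fine-scale limit, which is
-- `f`, and the coarse-scale limit `p`. The vanishing of `p` uses both `f ∈ L_τ` and the decay of
-- the coefficients, since temperedness alone leaves polynomials possible.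
theorem IsWaveletSystem.ae_eq_tsum (hd : 0 < d) {η : Fin 2 → 𝓢(ℝ, ℂ)} (hη : IsWaveletSystem η)
    {τ : ℝ} (hτ : 0 < τ) {M : ℕ} {f : EuclideanSpace ℝ (Fin d) → ℂ}
    (hfτ : MemLp f (ENNReal.ofReal τ)) (hf : Integrable fun y => decay M y • f y)
    {A : ℤ → ℝ} (hA : Summable A) (hcA : ∀ j κ, ‖waveletCoeff η f (j, κ)‖ ≤ A j)
    (hA0 : ∀ j, 0 ≤ A j)
    (hc0 : ∀ j, Filter.Tendsto (fun κ => waveletCoeff η f (j, κ)) Filter.cofinite (nhds 0)) :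
    (∀ x, Summable fun i => ‖waveletCoeff η f i * waveletFun η i x‖) ∧
      f =ᵐ[volume] fun x => ∑' i, waveletCoeff η f i * waveletFun η i x := by
  obtain ⟨C, hC, h⟩ := exists_le_decay_of_fin_two η 2
  have hfm := hfτ.1
  set m₀ : Fin d := ⟨0, hd⟩
  set v : EuclideanSpace ℝ (Fin d) := EuclideanSpace.single m₀ (1 : ℝ) with hv
  set P : ℤ → EuclideanSpace ℝ (Fin d) → ℂ := fun j => levelProj (η 0) j f with hP
  set Q : ℤ → EuclideanSpace ℝ (Fin d) → ℂ := fun j x => P (j - 1) x - P j x with hQ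
  set D : ℝ := C ^ d * levelSum d with hD
  have hsum : ∀ j x, HasSum (fun κ : LevelIndex d => waveletCoeff η f (j, κ) *
      waveletFun η (j, κ) x) (Q j x) := fun j x => hasSum_levelProj_sub hη j hf hfm x
  have hlev := fun j x => summable_norm_mul_waveletFun hC.le h (hA0 j) (hcA j) j x
  have hQA : ∀ j x, ‖Q j x‖ ≤ A j * D := fun j x => by
    rw [← (hsum j x).tsum_eq]
    exact (norm_tsum_le_tsum_norm (hlev j x).1).trans (hlev j x).2
  have hAD : Summable fun j => A j * D := hA.mul_right D
  have hsm : ∀ x, Summable fun i => ‖waveletCoeff η f i * waveletFun η i x‖ := fun x =>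
    (summable_prod_of_nonneg fun _ => norm_nonneg _).2
      ⟨fun j => (hlev j x).1, hAD.of_nonneg_of_le (fun j => tsum_nonneg fun _ => norm_nonneg _)
        fun j => (hlev j x).2⟩
  refine ⟨hsm, ?_⟩
  have hfull : ∀ x, ∑' i, waveletCoeff η f i * waveletFun η i x = ∑' j, Q j x := fun x => by
    rw [(hsm x).of_norm.tsum_prod]
    exact tsum_congr fun j => (hsum j x).tsum_eq
  have hQs : ∀ x, Summable fun j => Q j x := fun x =>
    Summable.of_norm_bounded hAD fun j => hQA j x
  have hneg : ∀ (n : ℕ) x, P (-(n : ℤ)) x = P 0 x + ∑ i ∈ Finset.range n, Q (-(i : ℤ)) x := by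
    intro n x
    induction n with
    | zero => simp
    | succ n ih =>
      rw [Finset.sum_range_succ, ← add_assoc, ← ih]
      simp only [hQ]
      rw [show (-((n + 1 : ℕ) : ℤ)) = -(n : ℤ) - 1 by push_cast; ring]
      ring
  have hpos : ∀ (n : ℕ) x, P n x = P 0 x - ∑ i ∈ Finset.range n, Q ((i : ℤ) + 1) x := by
    intro n x
    induction n with
    | zero => simp
    | succ n ih =>
      rw [Finset.sum_range_succ, ← sub_sub, ← ih]
      simp only [hQ]
      rw [add_sub_cancel_right, show ((n + 1 : ℕ) : ℤ) = (n : ℤ) + 1 by push_cast; ring]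
      ring
  have inj1 : Function.Injective fun n : ℕ => -(n : ℤ) := fun a b hab => by simpa using hab
  have inj2 : Function.Injective fun n : ℕ => (n : ℤ) + 1 := fun a b hab => by simpa using hab
  -- `H` is the limit of the projections at fine scales and `p` the limit at coarse scales, both
  -- written as series starting from `P 0`.
  set H : EuclideanSpace ℝ (Fin d) → ℂ := fun x => P 0 x + ∑' i : ℕ, Q (-(i : ℤ)) x with hH
  set p : EuclideanSpace ℝ (Fin d) → ℂ := fun x => P 0 x - ∑' i : ℕ, Q ((i : ℤ) + 1) x with hp
  have hunif : TendstoUniformly (fun n : ℕ => levelProj (η 0) (-(n : ℤ)) f) H Filter.atTop := by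
    have h1 := tendstoUniformly_tsum_nat (hAD.comp_injective inj1)
      (f := fun (i : ℕ) x => Q (-(i : ℤ)) x) fun i x => hQA _ x
    rw [Metric.tendstoUniformly_iff] at h1 ⊢
    refine fun ε hε => (h1 ε hε).mono fun n hn x => ?_
    have h2 := hn x
    have h3 : levelProj (η 0) (-(n : ℤ)) f x = _ := hneg n x
    rw [h3]
    simpa only [hH, dist_add_left] using h2
  have hfH := hη.ae_eq_of_tendstoUniformly hf hfm hunif
  have hHp : ∀ x, H x = p x + ∑' j, Q j x := by
    intro x
    have e : ∑' j, Q j x = ∑' j, Q (-j) x := ((Equiv.neg ℤ).tsum_eq fun j => Q j x).symm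
    have h1 : Summable fun i : ℕ => Q (-(i : ℤ)) x := (hQs x).comp_injective inj1
    have h2 : Summable fun i : ℕ => Q (-(-((i : ℤ) + 1))) x := by
      simp only [neg_neg]
      exact (hQs x).comp_injective inj2
    rw [e, tsum_of_nat_of_neg_add_one (f := fun j => Q (-j) x) h1 h2]
    simp only [neg_neg, hH, hp]
    ring
  have hplim : ∀ x, Filter.Tendsto (fun n : ℕ => levelProj (η 0) n f x) Filter.atTop
      (nhds (p x)) := by
    intro x
    have h1 := ((hQs x).comp_injective inj2).hasSum.tendsto_sum_nat
    exact (h1.const_sub (P 0 x)).congr fun n => (hpos n x).symm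
  -- A finite difference is a finite combination of values, so it passes to the pointwise limit `p`.
  have hp0 : ∀ x, (fwdDiff v)^[M + 1] p x = 0 := by
    intro x
    refine tendsto_nhds_unique ?_ (tendsto_fwdDiff_iter_levelProj (η 0) m₀ hf hfm x)
    simp only [fwdDiff_iter_eq_sum_shift]
    exact tendsto_finsetSum _ fun k _ => (hplim _).const_smul _
  have hglim : ∀ y, Filter.Tendsto (fun m : ℕ => ∑' j, Q j (y + m • v)) Filter.atTop (nhds 0) := by
    intro y
    rw [show (0 : ℂ) = ∑' _ : ℤ, (0 : ℂ) by simp]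
    refine tendsto_tsum_of_dominated_convergence hAD (fun j => ?_)
      (Filter.Eventually.of_forall fun m j => hQA j _)
    have := tendsto_tsum_mul_waveletFun (η := η) (hc0 j) m₀ j y
    simpa only [(hsum j _).tsum_eq] using this
  -- The exceptional null set must be avoided by the whole ray; countably many translates of it are
  -- still null.
  have hall : ∀ᵐ y, ∀ m : ℕ, f (y + m • v) = H (y + m • v) :=
    ae_all_iff.2 fun m =>
      (measurePreserving_add_right volume (m • v)).quasiMeasurePreserving.ae hfH
  filter_upwards [hall, ae_tendsto_add_nsmul_single hτ m₀ hfτ] with y h1 h2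
  have h3 : Filter.Tendsto (fun m : ℕ => p (y + m • v)) Filter.atTop (nhds 0) := by
    have := h2.sub (hglim y)
    rw [sub_zero] at this
    refine this.congr fun m => ?_
    rw [h1 m, hHp, add_sub_cancel_right]
  have h4 := eq_zero_of_fwdDiff_iter_eq_zero hp0 y h3
  have h5 := h1 0
  rw [zero_smul, add_zero] at h5
  rw [h5, hHp, h4, zero_add, hfull]

end Reconstruction

/-! ### Gaussian approximation of bandlimited functions in one variable -/

section Univariate

/-- For a monomial, `|x|^m ≤ m! exp |x|` and `|x| - x²/2 ≤ 1`. Applied to Hermite polynomials, this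
provides the Schwartz bounds of the Gaussian. -/
lemma exists_abs_aeval_mul_exp_le (p : Polynomial ℤ) (k : ℕ) :
    ∃ C : ℝ, ∀ x : ℝ, |x| ^ k * |Polynomial.aeval x p * Real.exp (-(x ^ 2 / 2))| ≤ C := by
  have hmon : ∀ m : ℕ, ∀ x : ℝ, |x| ^ m * Real.exp (-(x ^ 2 / 2)) ≤
      m.factorial * Real.exp 1 := by
    intro m x
    have h1 := Real.pow_div_factorial_le_exp |x| (abs_nonneg x) m
    rw [div_le_iff₀ (by positivity)] at h1
    have h2 : Real.exp |x| * Real.exp (-(x ^ 2 / 2)) ≤ Real.exp 1 := by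
      rw [← Real.exp_add]
      refine Real.exp_le_exp.2 ?_
      nlinarith [sq_abs x, sq_nonneg (|x| - 1)]
    calc _ ≤ Real.exp |x| * m.factorial * Real.exp (-(x ^ 2 / 2)) := by gcongr
      _ = m.factorial * (Real.exp |x| * Real.exp (-(x ^ 2 / 2))) := by ring
      _ ≤ _ := by gcongr
  refine ⟨∑ i ∈ Finset.range (p.natDegree + 1), |(p.coeff i : ℝ)| *
    ((k + i).factorial * Real.exp 1), fun x => ?_⟩
  rw [Polynomial.aeval_eq_sum_range, abs_mul, abs_of_pos (Real.exp_pos _)]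
  calc _ ≤ |x| ^ k * ((∑ i ∈ Finset.range (p.natDegree + 1), |(p.coeff i : ℝ)| * |x| ^ i) *
        Real.exp (-(x ^ 2 / 2))) := by
        gcongr
        refine (Finset.abs_sum_le_sum_abs _ _).trans_eq (Finset.sum_congr rfl fun i _ => ?_)
        rw [zsmul_eq_mul, abs_mul, abs_pow]
    _ = ∑ i ∈ Finset.range (p.natDegree + 1), |(p.coeff i : ℝ)| *
        (|x| ^ (k + i) * Real.exp (-(x ^ 2 / 2))) := by
        rw [Finset.sum_mul, Finset.mul_sum]
        exact Finset.sum_congr rfl fun i _ => by rw [pow_add]; ring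
    _ ≤ _ := Finset.sum_le_sum fun i _ =>
        mul_le_mul_of_nonneg_left (hmon (k + i) x) (abs_nonneg _)

/-- The Gaussian `exp (-x² / 2)` as a Schwartz function. -/
noncomputable def gaussianSchwartz : 𝓢(ℝ, ℂ) where
  toFun x := (Real.exp (-(x ^ 2 / 2)) : ℂ)
  smooth' := Complex.ofRealCLM.contDiff.comp (by fun_prop : ContDiff ℝ _ fun x : ℝ =>
    Real.exp (-(x ^ 2 / 2)))
  decay' k n := by
    obtain ⟨C, hC⟩ := exists_abs_aeval_mul_exp_le (Polynomial.hermite n) k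
    refine ⟨C, fun x => ?_⟩
    have h1 := Complex.ofRealLI.norm_iteratedFDeriv_comp_left (𝕜 := ℝ) (n := n) (i := n) (x := x)
      (f := fun x : ℝ => Real.exp (-(x ^ 2 / 2)))
      (by fun_prop : ContDiff ℝ n fun x : ℝ => Real.exp (-(x ^ 2 / 2))).contDiffAt le_rfl
    have h2 : ‖iteratedFDeriv ℝ n (fun x : ℝ => (Real.exp (-(x ^ 2 / 2)) : ℂ)) x‖ =
        |Polynomial.aeval x (Polynomial.hermite n) * Real.exp (-(x ^ 2 / 2))| := by
      refine h1.trans ?_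
      rw [norm_iteratedFDeriv_eq_norm_iteratedDeriv, iteratedDeriv_eq_iterate,
        Polynomial.deriv_gaussian_eq_hermite_mul_gaussian, mul_assoc, norm_mul, norm_pow, norm_neg,
        norm_one, one_pow, one_mul, Real.norm_eq_abs]
    rw [h2, Real.norm_eq_abs]
    exact hC x

lemma gaussianSchwartz_apply (x : ℝ) :
    gaussianSchwartz x = (Real.exp (-(x ^ 2 / 2)) : ℂ) := rfl

lemma fourier_gaussianSchwartz_ne_zero (ξ : ℝ) : 𝓕 gaussianSchwartz ξ ≠ 0 := by
  have hb : 0 < ((1 / (2 * Real.pi) : ℝ) : ℂ).re := by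
    rw [Complex.ofReal_re]; positivity
  have h := congrFun (fourier_gaussian_pi hb) ξ
  have e : (gaussianSchwartz : ℝ → ℂ) = fun x : ℝ =>
      Complex.exp (-Real.pi * ((1 / (2 * Real.pi) : ℝ) : ℂ) * x ^ 2) := by
    funext x
    rw [gaussianSchwartz_apply, Complex.ofReal_exp]
    congr 1
    push_cast
    have := Complex.ofReal_ne_zero.2 Real.pi_ne_zero
    field_simp
  rw [SchwartzMap.fourier_coe, e, h]
  have h0 : ((1 / (2 * Real.pi) : ℝ) : ℂ) ≠ 0 := fun h0 => by
    rw [h0] at hb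
    simp at hb
  refine mul_ne_zero (one_div_ne_zero ?_) (Complex.exp_ne_zero _)
  rw [Complex.cpow_ne_zero_iff]
  exact Or.inl h0

/-- The Schwartz function `t ↦ γ (x - t)`. -/
noncomputable def reflect (γ : 𝓢(ℝ, ℂ)) (x : ℝ) : 𝓢(ℝ, ℂ) :=
  SchwartzMap.compCLMOfAntilipschitz ℂ (K := 1) (g := fun t : ℝ => x - t)
    (by fun_prop) (AntilipschitzWith.of_le_mul_dist fun a b => by
      rw [dist_sub_left, NNReal.coe_one, one_mul]) γ

lemma reflect_apply (γ : 𝓢(ℝ, ℂ)) (x t : ℝ) : reflect γ x t = γ (x - t) := rfl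

/-- The Schwartz function `t ↦ κ t * γ (x - t)`. -/
noncomputable def convIntegrand (κ γ : 𝓢(ℝ, ℂ)) (x : ℝ) : 𝓢(ℝ, ℂ) :=
  SchwartzMap.smulLeftCLM ℂ (κ : ℝ → ℂ) (reflect γ x)

lemma convIntegrand_apply (κ γ : 𝓢(ℝ, ℂ)) (x t : ℝ) :
    convIntegrand κ γ x t = κ t * γ (x - t) := by
  rw [convIntegrand, SchwartzMap.smulLeftCLM_apply_apply κ.hasTemperateGrowth, reflect_apply,
    smul_eq_mul]

/-- Deconvolution: the quotient of the Fourier transforms of `φ` and `γ` is smooth because the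
denominator has no zeros, and compactly supported because `φ` is bandlimited. Its inverse transform
is `κ`; the multiplication formula with the reflected `γ` verifies the convolution identity. -/
lemma exists_eq_integral_convIntegrand {φ : 𝓢(ℝ, ℂ)} (hφ : HasCompactSupport (𝓕 (φ : ℝ → ℂ)))
    {γ : 𝓢(ℝ, ℂ)} (hγ : ∀ ξ, 𝓕 γ ξ ≠ 0) :
    ∃ κ : 𝓢(ℝ, ℂ), ∀ x, φ x = ∫ t, convIntegrand κ γ x t := by
  have hc : HasCompactSupport fun ξ => 𝓕 φ ξ * (𝓕 γ ξ)⁻¹ := HasCompactSupport.mul_right hφ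
  have hs : ContDiff ℝ (⊤ : ℕ∞) fun ξ => 𝓕 φ ξ * (𝓕 γ ξ)⁻¹ :=
    ((𝓕 φ).smooth ⊤).mul (((𝓕 γ).smooth ⊤).inv hγ)
  set K : 𝓢(ℝ, ℂ) := hc.toSchwartzMap hs with hK
  have hKa : ∀ ξ, K ξ = 𝓕 φ ξ * (𝓕 γ ξ)⁻¹ := fun ξ => rfl
  refine ⟨𝓕⁻ K, fun x => ?_⟩
  have h1 := SchwartzMap.integral_fourier_mul_eq (𝓕⁻ K) (𝓕⁻ (reflect γ x))
  rw [FourierTransform.fourier_fourierInv_eq, FourierTransform.fourier_fourierInv_eq] at h1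
  simp only [convIntegrand_apply]
  simp only [reflect_apply] at h1
  rw [← h1]
  have h2 : ∀ ξ : ℝ, 𝓕⁻ (reflect γ x) ξ =
      Complex.exp (2 * Real.pi * (x * ξ) * Complex.I) * 𝓕 γ ξ := by
    intro ξ
    rw [SchwartzMap.fourierInv_coe, SchwartzMap.fourier_coe, Real.fourierInv_eq', Real.fourier_eq',
      ← integral_const_mul, ← integral_sub_left_eq_self _ volume x]
    refine integral_congr_ae (Filter.Eventually.of_forall fun t => ?_)
    simp only [reflect_apply, sub_sub_cancel, smul_eq_mul]
    rw [← mul_assoc, ← Complex.exp_add]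
    congr 2
    simp only [RCLike.inner_apply, conj_trivial]
    push_cast
    ring
  have h3 : φ x = 𝓕⁻ (𝓕 φ) x := by rw [FourierTransform.fourierInv_fourier_eq]
  rw [h3, SchwartzMap.fourierInv_coe, Real.fourierInv_eq']
  refine integral_congr_ae (Filter.Eventually.of_forall fun ξ => ?_)
  simp only [h2, hKa, smul_eq_mul]
  have e : Complex.exp (((2 * Real.pi * inner ℝ ξ x : ℝ) : ℂ) * Complex.I) =
      Complex.exp (2 * Real.pi * (x * ξ) * Complex.I) := by
    simp only [RCLike.inner_apply, conj_trivial]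
    push_cast
    rfl
  rw [e]
  field_simp [hγ ξ]

lemma deriv_convIntegrand (κ γ : 𝓢(ℝ, ℂ)) (x : ℝ) :
    SchwartzMap.derivCLM ℂ ℂ (convIntegrand κ γ x) =
      convIntegrand (SchwartzMap.derivCLM ℂ ℂ κ) γ x -
        convIntegrand κ (SchwartzMap.derivCLM ℂ ℂ γ) x := by
  ext t
  rw [sub_apply]
  simp only [SchwartzMap.derivCLM_apply, convIntegrand_apply]
  have e : (convIntegrand κ γ x : ℝ → ℂ) = fun t => κ t * γ (x - t) :=
    funext fun t => convIntegrand_apply κ γ x t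
  have h1 : HasDerivAt κ (deriv κ t) t := (κ.differentiable t).hasDerivAt
  have h2 : HasDerivAt (fun t => γ (x - t)) (-deriv γ (x - t)) t :=
    ((γ.differentiable (x - t)).hasDerivAt).comp_const_sub x t
  rw [e, (h1.fun_mul h2).deriv]
  ring

lemma norm_convIntegrand_le {κ γ : 𝓢(ℝ, ℂ)} {A B : ℝ} {L M : ℕ}
    (hκ : ∀ t, ‖κ t‖ ≤ A * decay (L + M) t) (hγ : ∀ t, ‖γ t‖ ≤ B * decay M t) (x t : ℝ) :
    ‖convIntegrand κ γ x t‖ ≤ A * B * decay L t * decay M x := by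
  have hA : 0 ≤ A := nonneg_of_mul_nonneg_left ((norm_nonneg _).trans (hκ 0)) (decay_pos _ _)
  have hB : 0 ≤ B := nonneg_of_mul_nonneg_left ((norm_nonneg _).trans (hγ 0)) (decay_pos _ _)
  have h1 : decay M t * decay M (x - t) ≤ decay M x := by
    have := decay_mul_le M t (t - x)
    rwa [sub_sub_cancel, decay_sub_comm M t x] at this
  rw [convIntegrand_apply, norm_mul]
  calc _ ≤ (A * decay (L + M) t) * (B * decay M (x - t)) :=
        mul_le_mul (hκ t) (hγ _) (norm_nonneg _) (mul_nonneg hA (decay_nonneg _ _))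
    _ = A * B * decay L t * (decay M t * decay M (x - t)) := by rw [decay_add]; ring
    _ ≤ _ := mul_le_mul_of_nonneg_left h1
        (mul_nonneg (mul_nonneg hA hB) (decay_nonneg _ _))

/-- Each power of `ξ` is paid for by a derivative in `t`, which by the product rule yields two
integrands of the same kind. The decay in `x` comes from the product bound on the integrand and
survives the induction. -/
lemma exists_pow_mul_norm_fourier_convIntegrand_le (M R : ℕ) (κ γ : 𝓢(ℝ, ℂ)) :
    ∃ C : ℝ, ∀ x ξ : ℝ, |ξ| ^ R * ‖𝓕 (convIntegrand κ γ x) ξ‖ ≤ C * decay M x := by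
  induction R generalizing κ γ with
  | zero =>
    obtain ⟨A, hA, hκ⟩ := exists_schwartz_le_decay κ (2 + M)
    obtain ⟨B, hB, hγ⟩ := exists_schwartz_le_decay γ M
    refine ⟨A * B * ∫ t : ℝ, decay 2 t, fun x ξ => ?_⟩
    rw [pow_zero, one_mul, SchwartzMap.fourier_coe, Real.fourier_eq, ← integral_const_mul,
      ← integral_mul_const]
    refine norm_integral_le_of_norm_le (((integrable_decay_real le_rfl).const_mul _).mul_const _)
      (Filter.Eventually.of_forall fun t => ?_)
    rw [Circle.norm_smul]
    exact norm_convIntegrand_le hκ hγ x t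
  | succ R ih =>
    obtain ⟨C₁, h1⟩ := ih (SchwartzMap.derivCLM ℂ ℂ κ) γ
    obtain ⟨C₂, h2⟩ := ih κ (SchwartzMap.derivCLM ℂ ℂ γ)
    refine ⟨C₁ + C₂, fun x ξ => ?_⟩
    set F := convIntegrand κ γ x
    have h3 : 𝓕 (SchwartzMap.derivCLM ℂ ℂ F) ξ = (2 * Real.pi * Complex.I * ξ) • 𝓕 F ξ :=
      congrFun (Real.fourier_deriv F.integrable F.differentiable
        (SchwartzMap.derivCLM ℂ ℂ F).integrable) ξ
    have h4 : 𝓕 (SchwartzMap.derivCLM ℂ ℂ F) ξ =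
        𝓕 (convIntegrand (SchwartzMap.derivCLM ℂ ℂ κ) γ x) ξ -
          𝓕 (convIntegrand κ (SchwartzMap.derivCLM ℂ ℂ γ) x) ξ := by
      rw [deriv_convIntegrand, ← SchwartzMap.fourierTransformCLM_apply (𝕜 := ℂ), map_sub,
        sub_apply]
      rfl
    have h5 : |ξ| * ‖𝓕 F ξ‖ ≤ ‖𝓕 (SchwartzMap.derivCLM ℂ ℂ F) ξ‖ := by
      rw [h3, norm_smul]
      refine mul_le_mul_of_nonneg_right ?_ (norm_nonneg _)
      have : ‖(2 * Real.pi * Complex.I * ξ : ℂ)‖ = 2 * Real.pi * |ξ| := by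
        simp [abs_of_pos Real.pi_pos]
      rw [this]
      nlinarith [Real.pi_gt_three, abs_nonneg ξ]
    calc _ = |ξ| ^ R * (|ξ| * ‖𝓕 F ξ‖) := by ring
      _ ≤ |ξ| ^ R * (‖𝓕 (convIntegrand (SchwartzMap.derivCLM ℂ ℂ κ) γ x) ξ‖ +
          ‖𝓕 (convIntegrand κ (SchwartzMap.derivCLM ℂ ℂ γ) x) ξ‖) := by
          refine mul_le_mul_of_nonneg_left (h5.trans ?_) (by positivity)
          rw [h4]
          exact norm_sub_le _ _
      _ ≤ _ := by rw [mul_add, add_mul]; exact add_le_add (h1 x ξ) (h2 x ξ)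

/-- By Poisson summation the trapezoidal sum is the sum of the values of the Fourier transform at `n
/ h`. The term `n = 0` is the integral, and the others are at most `B (h / |n|)^R`. -/
lemma norm_trapezoid_sub_integral_le (f : 𝓢(ℝ, ℂ)) {R : ℕ} (hR : 2 ≤ R) {B : ℝ}
    (hB : ∀ ξ : ℝ, |ξ| ^ R * ‖𝓕 f ξ‖ ≤ B) {h : ℝ} (hh : 0 < h) :
    ‖h * ∑' k : ℤ, f (h * k) - ∫ t, f t‖ ≤ B * h ^ R * ∑' n : ℤ, 1 / (n : ℝ) ^ 2 := by
  have hB0 : 0 ≤ B := (mul_nonneg (by positivity) (norm_nonneg _)).trans (hB 0)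
  set F : 𝓢(ℝ, ℂ) := SchwartzMap.compCLMOfContinuousLinearEquiv ℂ
    (ContinuousLinearEquiv.unitsEquivAut ℝ (Units.mk0 h hh.ne')) f with hF
  have hFa : ∀ t, F t = f (h * t) := fun t => by
    simp [hF, mul_comm]
  have hFF : ∀ ξ : ℝ, 𝓕 F ξ = (h : ℂ)⁻¹ * 𝓕 f (ξ / h) := by
    intro ξ
    rw [SchwartzMap.fourier_coe, SchwartzMap.fourier_coe, Real.fourier_eq', Real.fourier_eq']
    have e := MeasureTheory.Measure.integral_comp_mul_left (fun t : ℝ =>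
      Complex.exp (((-2 * Real.pi * inner ℝ t (ξ / h) : ℝ) : ℂ) * Complex.I) • f t) h
    rw [abs_of_pos (inv_pos.2 hh), Complex.real_smul, Complex.ofReal_inv] at e
    rw [← e]
    refine integral_congr_ae (Filter.Eventually.of_forall fun t => ?_)
    simp only [hFa, RCLike.inner_apply, conj_trivial]
    congr 5
    field_simp
  have hP := SchwartzMap.tsum_eq_tsum_fourier F 0
  simp only [zero_add, hFa, hFF, QuotientAddGroup.mk_zero, fourier_eval_zero, mul_one] at hP
  rw [hP, tsum_mul_left, ← mul_assoc, mul_inv_cancel₀ (Complex.ofReal_ne_zero.2 hh.ne'), one_mul]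
  have hb : ∀ n : ℤ, n ≠ 0 → ‖𝓕 f (n / h)‖ ≤ B * h ^ R * (1 / (n : ℝ) ^ 2) := by
    intro n hn
    have hn1 : (1 : ℝ) ≤ |(n : ℝ)| := by
      have := Int.one_le_abs hn
      exact_mod_cast this
    have h1 := hB (n / h)
    rw [abs_div, abs_of_pos hh, div_pow, div_mul_eq_mul_div, div_le_iff₀ (by positivity)] at h1
    rw [mul_one_div, le_div_iff₀ (by positivity)]
    refine le_trans ?_ h1
    rw [mul_comm, ← sq_abs]
    exact mul_le_mul_of_nonneg_right (pow_le_pow_right₀ hn1 hR) (norm_nonneg _)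
  have hZ : Summable fun n : ℤ => 1 / (n : ℝ) ^ 2 := Real.summable_one_div_int_pow.2 one_lt_two
  have hs : Summable fun n : ℤ => 𝓕 f (n / h) :=
    Summable.of_norm_bounded_eventually (hZ.mul_left (B * h ^ R)) <|
      Filter.eventually_cofinite.2 ((Set.finite_singleton 0).subset fun n hn => by
        by_contra hn0
        exact hn (hb n hn0))
  rw [hs.tsum_eq_add_tsum_ite 0]
  have h0 : 𝓕 f (((0 : ℤ) : ℝ) / h) = ∫ t, f t := by
    rw [SchwartzMap.fourier_coe, Real.fourier_eq']
    simp
  rw [h0, add_sub_cancel_left]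
  refine tsum_of_norm_bounded (hZ.hasSum.mul_left _) fun n => ?_
  split_ifs with hn
  · rw [norm_zero]; positivity
  · exact hb n hn

/-- The omitted nodes satisfy `|h k| ≥ h (K + 1) ≥ h⁻¹`, so `R` orders of decay of `κ` give `h^R`;
two more make the lattice sum bounded independently of `h`, and `M` go to the decay in `x`. -/
lemma norm_trapezoid_tail_le {κ γ : 𝓢(ℝ, ℂ)} {A B : ℝ} {M R : ℕ}
    (hκ : ∀ t, ‖κ t‖ ≤ A * decay (R + 2 + M) t) (hγ : ∀ t, ‖γ t‖ ≤ B * decay M t) {h : ℝ}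
    (hh : 0 < h) (hh1 : h ≤ 1) {K : ℕ} (hK : h⁻¹ ≤ h * (K + 1)) (x : ℝ) :
    ‖h * ∑' k : ℤ, convIntegrand κ γ x (h * k) -
      ∑ k ∈ Finset.Icc (-(K : ℤ)) K, h * convIntegrand κ γ x (h * k)‖ ≤
        A * B * decay M x * h ^ R * decaySum := by
  have hA : 0 ≤ A := nonneg_of_mul_nonneg_left ((norm_nonneg _).trans (hκ 0)) (decay_pos _ _)
  have hB : 0 ≤ B := nonneg_of_mul_nonneg_left ((norm_nonneg _).trans (hγ 0)) (decay_pos _ _)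
  set S := Finset.Icc (-(K : ℤ)) K with hS
  set g : ℤ → ℂ := fun k => h * convIntegrand κ γ x (h * k) with hg
  obtain ⟨hl, hle⟩ := summable_decay_lattice hh hh1 0
  simp only [add_zero] at hl hle
  have hD : 0 ≤ A * B * decay M x := mul_nonneg (mul_nonneg hA hB) (decay_nonneg _ _)
  have hgb : ∀ k : ℤ, ‖g k‖ ≤ A * B * decay M x * (decay R (h * k) * (h * decay 2 (h * k))) := by
    intro k
    simp only [hg]
    rw [norm_mul, Complex.norm_real, Real.norm_of_nonneg hh.le]
    refine (mul_le_mul_of_nonneg_left (norm_convIntegrand_le hκ hγ x _) hh.le).trans_eq ?_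
    rw [decay_add]
    ring
  have hgs : Summable g := Summable.of_norm_bounded (hl.mul_left (A * B * decay M x)) fun k =>
    (hgb k).trans (mul_le_mul_of_nonneg_left (mul_le_of_le_one_left
      (mul_nonneg hh.le (decay_nonneg _ _)) (decay_le_one _ _)) hD)
  have hfin : HasSum (fun k => if k ∈ S then g k else 0) (∑ k ∈ S, g k) := by
    have : HasSum (fun k => if k ∈ S then g k else 0) _ :=
      hasSum_sum_of_ne_finset_zero (s := S) fun k hk => by simp [hk]
    rwa [Finset.sum_congr rfl (g := g) (fun k hk => by simp [hk])] at this
  rw [← tsum_mul_left]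
  have hsub := hgs.hasSum.sub hfin
  rw [← hsub.tsum_eq]
  refine (tsum_of_norm_bounded (hl.hasSum.mul_left (A * B * decay M x * h ^ R))
    fun k => ?_).trans (mul_le_mul_of_nonneg_left hle (mul_nonneg hD (by positivity)))
  by_cases hk : k ∈ S
  · simp only [hk, if_true, sub_self, norm_zero]
    exact mul_nonneg (mul_nonneg hD (by positivity)) (mul_nonneg hh.le (decay_nonneg _ _))
  · simp only [hk, if_false, sub_zero]
    refine (hgb k).trans ?_
    rw [mul_assoc (A * B * decay M x)]
    refine mul_le_mul_of_nonneg_left (mul_le_mul_of_nonneg_right ?_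
      (mul_nonneg hh.le (decay_nonneg _ _))) hD
    have hk' : (K : ℝ) + 1 ≤ |(k : ℝ)| := by
      have : (K : ℤ) + 1 ≤ |k| := by
        rw [hS, Finset.mem_Icc] at hk
        by_contra hlt
        exact hk (abs_le.1 (by omega))
      exact_mod_cast this
    have h1 : h⁻¹ ≤ 1 + ‖h * k‖ := by
      rw [norm_mul, Real.norm_of_nonneg hh.le, Real.norm_eq_abs]
      nlinarith [mul_le_mul_of_nonneg_left hk' hh.le]
    rw [decay, ← inv_inv (h ^ R), ← inv_pow h]
    exact inv_anti₀ (by positivity) (pow_le_pow_left₀ (by positivity) h1 R)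

/-- A bandlimited Schwartz function is approximated at any algebraic rate, with any polynomial
decay, by combinations of `2 K + 1` Gaussians. -/
lemma exists_gaussian_quadrature {φ : 𝓢(ℝ, ℂ)} (hφ : HasCompactSupport (𝓕 (φ : ℝ → ℂ)))
    {r : ℕ} (hr : 1 ≤ r) (M : ℕ) :
    ∃ (C : ℝ) (a : ℕ → ℤ → ℂ) (p : ℕ → ℤ → ℝ), ∀ (K : ℕ) (x : ℝ),
      ‖φ x - ∑ k ∈ Finset.Icc (-(K : ℤ)) K,
        a K k * (Real.exp (-((x - p K k) ^ 2 / 2)) : ℂ)‖ ≤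
          C * (((K : ℝ) + 1) ^ r)⁻¹ * decay M x := by
  obtain ⟨κ, hκφ⟩ := exists_eq_integral_convIntegrand hφ fourier_gaussianSchwartz_ne_zero
  set γ := gaussianSchwartz with hγdef
  obtain ⟨A, hA, hκ⟩ := exists_schwartz_le_decay κ (2 * r + 2 + M)
  obtain ⟨B, hB, hγ⟩ := exists_schwartz_le_decay γ M
  obtain ⟨D, hD⟩ := exists_pow_mul_norm_fourier_convIntegrand_le M (2 * r) κ γ
  -- With this step the nodes reach out to about `h⁻¹`, so discretisation and truncation are both of
  -- order `h^(2r) = (K + 1)^(-r)`.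
  set h : ℕ → ℝ := fun K => (√((K : ℝ) + 1))⁻¹ with hh
  refine ⟨D * (∑' n : ℤ, 1 / (n : ℝ) ^ 2) + A * B * decaySum, fun K k => h K * κ (h K * k),
    fun K k => h K * k, fun K x => ?_⟩
  have hK0 : (1 : ℝ) ≤ (K : ℝ) + 1 := by linarith [K.cast_nonneg (α := ℝ)]
  have hh0 : 0 < h K := by simp only [hh]; positivity
  have hh1 : h K ≤ 1 := inv_le_one_of_one_le₀ (Real.one_le_sqrt.2 hK0)
  have hpow : h K ^ (2 * r) = (((K : ℝ) + 1) ^ r)⁻¹ := by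
    simp only [hh]
    rw [pow_mul, inv_pow, Real.sq_sqrt (by linarith), inv_pow]
  have hK : (h K)⁻¹ ≤ h K * (K + 1) := by
    simp only [hh, inv_inv]
    rw [inv_mul_eq_div, le_div_iff₀ (by positivity), Real.mul_self_sqrt (by linarith)]
  have h1 := norm_trapezoid_sub_integral_le (convIntegrand κ γ x) (by omega : 2 ≤ 2 * r) (hD x) hh0
  have h2 := norm_trapezoid_tail_le hκ hγ hh0 hh1 hK x
  rw [← hκφ x] at h1
  have e : ∑ k ∈ Finset.Icc (-(K : ℤ)) K, (h K * κ (h K * k)) *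
      (Real.exp (-((x - h K * k) ^ 2 / 2)) : ℂ) =
      ∑ k ∈ Finset.Icc (-(K : ℤ)) K, (h K : ℂ) * convIntegrand κ γ x (h K * k) :=
    Finset.sum_congr rfl fun k _ => by
      rw [convIntegrand_apply, hγdef, gaussianSchwartz_apply, mul_assoc]
  rw [e, ← hpow]
  rw [norm_sub_rev] at h1
  refine (norm_sub_le_norm_sub_add_norm_sub _ _ _).trans ((add_le_add h1 h2).trans_eq ?_)
  ring

end Univariate

/-! ### Gaussian approximation of the wavelets -/

section Multivariate

variable {d : ℕ}

lemma isGaussianSum_finset_sum {ι : Type*} (s : Finset ι) {n : ℕ} (hn : s.card ≤ n) (A : ι → ℂ)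
    (ξ : ι → EuclideanSpace ℝ (Fin d)) {σ : ι → ℝ} (hσ : ∀ i, 0 < σ i) :
    IsGaussianSum n fun x => ∑ i ∈ s, A i * (Real.exp (-(‖x - ξ i‖ / σ i) ^ 2) : ℂ) := by
  obtain ⟨e⟩ : Nonempty (s ↪ Fin n) :=
    Function.Embedding.nonempty_of_card_le (by simpa using hn)
  -- The surplus slots receive the coefficient `0`; the width `1` there only serves positivity.
  refine ⟨Function.extend e (fun i => A i) 0, Function.extend e (fun i => ξ i) 0,
    Function.extend e (fun i => σ i) 1, fun j => ?_, fun x => ?_⟩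
  · by_cases hj : ∃ i, e i = j
    · obtain ⟨i, rfl⟩ := hj
      rw [e.injective.extend_apply]
      exact hσ i
    · rw [Function.extend_apply' _ _ _ hj]
      exact one_pos
  · beta_reduce
    rw [← Finset.sum_coe_sort s
      fun i => A i * (Real.exp (-(‖x - ξ i‖ / σ i) ^ 2) : ℂ)]
    refine Fintype.sum_of_injective e e.injective _ _ (fun j hj => ?_) fun i => ?_
    · rw [Function.extend_apply' _ _ _ (by simpa using hj)]
      simp
    · simp only [e.injective.extend_apply]

lemma isGaussianSum_zero (n : ℕ) : IsGaussianSum (d := d) n fun _ => 0 := by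
  simpa using isGaussianSum_finset_sum (d := d) (∅ : Finset ℕ) (Nat.zero_le n) (fun _ => 0)
    (fun _ => 0) (σ := fun _ => 1) fun _ => one_pos

lemma IsGaussianSum.sum_mul {ι : Type*} {n : ι → ℕ} {S : ι → EuclideanSpace ℝ (Fin d) → ℂ}
    (hS : ∀ i, IsGaussianSum (n i) (S i)) (c : ι → ℂ) (T : Finset ι) {N : ℕ}
    (hN : ∑ i ∈ T, n i ≤ N) : IsGaussianSum N fun x => ∑ i ∈ T, c i * S i x := by
  choose A ξ σ hσ hA using hS
  have h := isGaussianSum_finset_sum (T.sigma fun i => (Finset.univ : Finset (Fin (n i))))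
    (n := N) (by simpa using hN) (fun p => c p.1 * A p.1 p.2) (fun p => ξ p.1 p.2)
    (σ := fun p => σ p.1 p.2) fun p => hσ p.1 p.2
  convert h using 2 with x
  rw [Finset.sum_sigma]
  refine Finset.sum_congr rfl fun i _ => ?_
  rw [hA, Finset.mul_sum]
  exact Finset.sum_congr rfl fun j _ => (mul_assoc _ _ _).symm

/-- Factors are exchanged one at a time; each exchange costs `ε` relative to the common majorant
`D`, which preserves the product envelope. -/
lemma norm_prod_sub_prod_le {ι : Type*} (s : Finset ι) {a b : ι → ℂ} {D : ι → ℝ} {ε : ℝ}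
    (hε : 0 ≤ ε) (ha : ∀ i, ‖a i‖ ≤ D i) (hb : ∀ i, ‖b i‖ ≤ D i)
    (hab : ∀ i, ‖a i - b i‖ ≤ ε * D i) :
    ‖∏ i ∈ s, a i - ∏ i ∈ s, b i‖ ≤ s.card * ε * ∏ i ∈ s, D i := by
  classical
  have hD : ∀ i, 0 ≤ D i := fun i => (norm_nonneg _).trans (ha i)
  induction s using Finset.induction_on with
  | empty => simp
  | insert i s hi ih =>
    rw [Finset.prod_insert hi, Finset.prod_insert hi, Finset.prod_insert hi,
      Finset.card_insert_of_notMem hi]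
    have hpa : ‖∏ i ∈ s, a i‖ ≤ ∏ i ∈ s, D i := by
      rw [norm_prod]
      exact Finset.prod_le_prod (fun _ _ => norm_nonneg _) fun _ _ => ha _
    have e : a i * ∏ i ∈ s, a i - b i * ∏ i ∈ s, b i =
        (a i - b i) * ∏ i ∈ s, a i + b i * (∏ i ∈ s, a i - ∏ i ∈ s, b i) := by ring
    rw [e]
    refine (norm_add_le _ _).trans ?_
    rw [norm_mul, norm_mul]
    have h1 := mul_le_mul (hab i) hpa (norm_nonneg _) (mul_nonneg hε (hD i))
    have h2 := mul_le_mul (hb i) ih (norm_nonneg _) (hD i)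
    refine (add_le_add h1 h2).trans_eq ?_
    push_cast
    ring

/-- A product of one-dimensional Gaussians of equal width is a radial Gaussian, so expanding the
product of sums gives one Gaussian per grid point. The width is `√2 * 2^j` because the univariate
exponent is `-t² / 2`. -/
lemma isGaussianSum_prod {n K : ℕ} (hn : (2 * K + 1) ^ d ≤ n) (i : WaveletIndex d)
    (a : Fin d → ℤ → ℂ) (p : Fin d → ℤ → ℝ) :
    IsGaussianSum n fun x : EuclideanSpace ℝ (Fin d) => ∏ m, ∑ k ∈ Finset.Icc (-(K : ℤ)) K,
      a m k * (Real.exp (-((x m / 2 ^ i.1 - i.2.1 m - p m k) ^ 2 / 2)) : ℂ) := by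
  have ha : (0 : ℝ) < 2 ^ i.1 := by positivity
  have hcard : (Fintype.piFinset fun _ : Fin d => Finset.Icc (-(K : ℤ)) K).card ≤ n := by
    rw [Fintype.card_piFinset_const, Int.card_Icc]
    convert hn using 2
    omega
  convert isGaussianSum_finset_sum (Fintype.piFinset fun _ : Fin d => Finset.Icc (-(K : ℤ)) K)
    hcard (fun l => ∏ m, a m (l m))
    (fun l => WithLp.toLp 2 fun m => (2 : ℝ) ^ i.1 * (i.2.1 m + p m (l m)))
    (σ := fun _ => √2 * 2 ^ i.1) (fun _ => by positivity) using 2 with x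
  rw [Finset.prod_univ_sum]
  refine Finset.sum_congr rfl fun l _ => ?_
  rw [Finset.prod_mul_distrib, ← Complex.ofReal_prod, ← Real.exp_sum]
  congr 3
  rw [div_pow, EuclideanSpace.norm_sq_eq, mul_pow, Real.sq_sqrt (by norm_num),
    Finset.sum_neg_distrib, Finset.sum_div]
  congr 1
  refine Finset.sum_congr rfl fun m _ => ?_
  simp only [PiLp.sub_apply, Real.norm_eq_abs, sq_abs]
  field_simp
  ring

/-- `K` is the largest integer whose tensor grid fits into the budget `n`; maximality gives `n < (2
K + 3)^d`, so little of the budget is wasted. -/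
lemma exists_pow_le_and_le_pow (hd : 0 < d) {n : ℕ} (hn : 1 ≤ n) :
    ∃ K : ℕ, (2 * K + 1) ^ d ≤ n ∧ 1 + n ≤ (3 * (K + 1)) ^ d := by
  set P : ℕ → Prop := fun K => (2 * K + 1) ^ d ≤ n with hP
  have h0 : P 0 := by simpa [hP] using hn
  have h1 : P (Nat.findGreatest P n) := Nat.findGreatest_spec (Nat.zero_le n) h0
  refine ⟨Nat.findGreatest P n, h1, ?_⟩
  set K := Nat.findGreatest P n with hK
  have hKn : K < n ∨ n ≤ K := lt_or_ge _ _
  have hlt : n < (2 * (K + 1) + 1) ^ d := by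
    by_contra hle
    rw [not_lt] at hle
    have h2 : 2 * (K + 1) + 1 ≤ (2 * (K + 1) + 1) ^ d := Nat.le_self_pow hd.ne' _
    exact Nat.findGreatest_is_greatest (Nat.lt_succ_self K) (by omega) hle
  have : (2 * (K + 1) + 1) ^ d ≤ (3 * (K + 1)) ^ d := Nat.pow_le_pow_left (by omega) d
  omega

/-- A wavelet is approximated by `n` Gaussians at any algebraic rate, with the decay of the
wavelet. -/
lemma exists_isGaussianSum_norm_waveletFun_sub_le (hd : 0 < d) {η : Fin 2 → 𝓢(ℝ, ℂ)}
    (hη : ∀ i, HasCompactSupport (𝓕 (η i : ℝ → ℂ))) {ρ : ℝ} (hρ : 0 ≤ ρ) :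
    ∃ C : ℝ, 0 < C ∧ ∀ (i : WaveletIndex d) (n : ℕ), ∃ G, IsGaussianSum n G ∧
      ∀ x, ‖waveletFun η i x - G x‖ ≤
        C * (1 + n : ℝ) ^ (-ρ) * ∏ m, decay 2 (x m / 2 ^ i.1 - i.2.1 m) := by
  -- A budget `n` allows only about `n^(1/d)` nodes per coordinate, so the rate `ρ` in `n` requires
  -- the univariate rate `d * ρ`; the quadrature also asks for `1 ≤ r`.
  set r : ℕ := max 1 ⌈d * ρ⌉₊ with hr
  choose C₁ a p hq using fun i => exists_gaussian_quadrature (hη i) (r := r) (le_max_left _ _) 2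
  obtain ⟨C₂, hC₂, hdec⟩ := exists_le_decay_of_fin_two η 2
  set C₃ : ℝ := C₂ + |C₁ 0| + |C₁ 1| with hC₃
  have hC₃0 : 0 < C₃ := by positivity
  have h2 : C₂ ≤ C₃ := by simp only [hC₃]; linarith [abs_nonneg (C₁ 0), abs_nonneg (C₁ 1)]
  have h1 : ∀ i, C₁ i ≤ C₃ := by
    intro i
    fin_cases i
    · show C₁ 0 ≤ C₃
      simp only [hC₃]; linarith [abs_nonneg (C₁ 1), le_abs_self (C₁ 0)]
    · show C₁ 1 ≤ C₃
      simp only [hC₃]; linarith [abs_nonneg (C₁ 0), le_abs_self (C₁ 1)]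
  set Q : ℝ := (2 * C₃) ^ d with hQ
  have hQ0 : 0 < Q := by positivity
  refine ⟨C₂ ^ d + d * Q * (3 : ℝ) ^ (d * ρ), by positivity, fun i n => ?_⟩
  have hP0 : ∀ x : EuclideanSpace ℝ (Fin d), 0 ≤ ∏ m, decay 2 (x m / 2 ^ i.1 - i.2.1 m) :=
    fun x => Finset.prod_nonneg fun _ _ => decay_nonneg _ _
  -- With no Gaussians the wavelet itself is the error, which its own envelope bounds. Including
  -- this case is what permits the threshold `N₀ = 0`.
  rcases Nat.eq_zero_or_pos n with rfl | hn
  · refine ⟨fun _ => 0, isGaussianSum_zero 0, fun x => ?_⟩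
    rw [sub_zero, Nat.cast_zero, add_zero, Real.one_rpow, mul_one]
    refine (norm_waveletFun_le hdec i x).trans (mul_le_mul_of_nonneg_right ?_ (hP0 x))
    have : 0 ≤ d * Q * (3 : ℝ) ^ (d * ρ) := by positivity
    linarith
  obtain ⟨K, hK1, hK2⟩ := exists_pow_le_and_le_pow hd hn
  refine ⟨_, isGaussianSum_prod hK1 i (fun m => a (i.2.2.1 m) K) fun m => p (i.2.2.1 m) K,
    fun x => ?_⟩
  set u : Fin d → ℝ := fun m => x m / 2 ^ i.1 - i.2.1 m with hu
  set ε : ℝ := (((K : ℝ) + 1) ^ r)⁻¹ with hε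
  have hK0 : (1 : ℝ) ≤ (K : ℝ) + 1 := by linarith [K.cast_nonneg (α := ℝ)]
  have hε0 : 0 ≤ ε := by positivity
  have hε1 : ε ≤ 1 := inv_le_one_of_one_le₀ (one_le_pow₀ hK0)
  have hqu : ∀ m, ‖η (i.2.2.1 m) (u m) - ∑ k ∈ Finset.Icc (-(K : ℤ)) K, a (i.2.2.1 m) K k *
      (Real.exp (-((u m - p (i.2.2.1 m) K k) ^ 2 / 2)) : ℂ)‖ ≤ C₃ * ε * decay 2 (u m) := fun m =>
    (hq _ K _).trans (mul_le_mul_of_nonneg_right (mul_le_mul_of_nonneg_right (h1 _) hε0)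
      (decay_nonneg _ _))
  have hηu : ∀ m, ‖η (i.2.2.1 m) (u m)‖ ≤ C₃ * decay 2 (u m) := fun m =>
    (hdec _ _).trans (mul_le_mul_of_nonneg_right h2 (decay_nonneg _ _))
  have hCd : ∀ m, 0 ≤ C₃ * decay 2 (u m) := fun m => mul_nonneg hC₃0.le (decay_nonneg _ _)
  rw [waveletFun_eq]
  -- The factor `2` leaves room for the approximants, which are bounded by the generator plus an
  -- error with `ε ≤ 1`.
  refine (norm_prod_sub_prod_le Finset.univ (D := fun m => 2 * C₃ * decay 2 (u m)) hε0
    (fun m => (hηu m).trans ?_) (fun m => ?_) (fun m => (hqu m).trans ?_)).trans ?_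
  · linarith [hCd m]
  · refine (norm_le_norm_add_norm_sub (η (i.2.2.1 m) (u m)) _).trans
      ((add_le_add (hηu m) (hqu m)).trans ?_)
    nlinarith [mul_le_of_le_one_right (hCd m) hε1]
  · nlinarith [mul_nonneg (hCd m) hε0]
  · rw [Finset.prod_mul_distrib, Finset.prod_const, Finset.card_univ, Fintype.card_fin]
    have hεn : ε ≤ (3 : ℝ) ^ (d * ρ) * (1 + n : ℝ) ^ (-ρ) := by
      have hdr : (d : ℝ) * ρ ≤ r := (Nat.le_ceil _).trans (by exact_mod_cast le_max_right _ _)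
      have hn1 : (0 : ℝ) < 1 + n := by positivity
      have h3 : (1 + n : ℝ) ^ ρ ≤ (3 : ℝ) ^ (d * ρ) * ((K : ℝ) + 1) ^ r := by
        have h4 : (1 + n : ℝ) ≤ (3 * ((K : ℝ) + 1)) ^ d := by exact_mod_cast hK2
        calc (1 + n : ℝ) ^ ρ ≤ ((3 * ((K : ℝ) + 1)) ^ d) ^ ρ :=
              Real.rpow_le_rpow hn1.le h4 hρ
          _ = (3 : ℝ) ^ (d * ρ) * ((K : ℝ) + 1) ^ (d * ρ) := by
              rw [← Real.rpow_natCast, ← Real.rpow_mul (by positivity),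
                Real.mul_rpow (by norm_num) (by positivity)]
          _ ≤ _ := by
              refine mul_le_mul_of_nonneg_left ?_ (by positivity)
              rw [← Real.rpow_natCast]
              exact Real.rpow_le_rpow_of_exponent_le hK0 hdr
      rw [Real.rpow_neg hn1.le, hε, ← div_eq_mul_inv, le_div_iff₀ (by positivity),
        inv_mul_le_iff₀ (by positivity), mul_comm]
      exact h3
    have hdQ : 0 ≤ (d : ℝ) * Q := by positivity
    have hnρ : 0 ≤ (1 + n : ℝ) ^ (-ρ) := by positivity
    calc (d : ℝ) * ε * (Q * ∏ m, decay 2 (u m)) = d * Q * ε * ∏ m, decay 2 (u m) := by ring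
      _ ≤ d * Q * ((3 : ℝ) ^ (d * ρ) * (1 + n : ℝ) ^ (-ρ)) * ∏ m, decay 2 (u m) :=
          mul_le_mul_of_nonneg_right (mul_le_mul_of_nonneg_left hεn hdQ) (hP0 x)
      _ ≤ _ := by
          refine mul_le_mul_of_nonneg_right ?_ (hP0 x)
          have : 0 ≤ C₂ ^ d * (1 + n : ℝ) ^ (-ρ) := by positivity
          linarith

end Multivariate

/-! ### Energies and costs of Besov functions -/

section Besov

variable {d : ℕ} {η : Fin 2 → 𝓢(ℝ, ℂ)} {τ q : ℝ} {f : EuclideanSpace ℝ (Fin d) → ℂ}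

lemma tsum_levelEnergy_rpow (hq : 0 < q) :
    ∑' j, levelEnergy η τ f j ^ q = besovSeminorm η τ q f ^ q := by
  rw [besovSeminorm, ← ENNReal.rpow_mul, one_div_mul_cancel hq.ne', ENNReal.rpow_one]

lemma levelEnergy_le_besovSeminorm (hq : 0 < q) (j : ℤ) :
    levelEnergy η τ f j ≤ besovSeminorm η τ q f := by
  rw [← ENNReal.rpow_le_rpow_iff hq, ← tsum_levelEnergy_rpow hq]
  exact ENNReal.le_tsum j

lemma tsum_enorm_waveletCoeff_rpow (hτ : 0 < τ) (j : ℤ) :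
    ∑' κ : LevelIndex d, ‖waveletCoeff η f (j, κ)‖ₑ ^ τ = levelEnergy η τ f j ^ τ := by
  rw [levelEnergy, ← ENNReal.rpow_mul, one_div_mul_cancel hτ.ne', ENNReal.rpow_one]

lemma hasSum_of_tsum_ofReal_eq {ι : Type*} {u : ι → ℝ} (hu : ∀ i, 0 ≤ u i) {a : ℝ} (ha : 0 ≤ a)
    (h : ∑' i, ENNReal.ofReal (u i) = ENNReal.ofReal a) : HasSum u a := by
  have hs : Summable u := by
    have h1 := ENNReal.summable_toReal (h ▸ ENNReal.ofReal_ne_top)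
    simpa only [ENNReal.toReal_ofReal (hu _)] using h1
  rw [← ENNReal.ofReal_tsum_of_nonneg hu hs,
    ENNReal.ofReal_eq_ofReal_iff (tsum_nonneg hu) ha] at h
  exact h ▸ hs.hasSum

lemma hasSum_levelEnergy_toReal_rpow (hB : besovSeminorm η τ q f ≠ ∞) (hq : 0 < q) :
    HasSum (fun j => (levelEnergy η τ f j).toReal ^ q) ((besovSeminorm η τ q f).toReal ^ q) := by
  refine hasSum_of_tsum_ofReal_eq (fun j => by positivity) (by positivity) ?_
  rw [ENNReal.toReal_rpow, ENNReal.ofReal_toReal (ENNReal.rpow_ne_top_of_nonneg hq.le hB),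
    ← tsum_levelEnergy_rpow hq]
  refine tsum_congr fun j => ?_
  rw [ENNReal.toReal_rpow, ENNReal.ofReal_toReal (ENNReal.rpow_ne_top_of_nonneg hq.le
    ((levelEnergy_le_besovSeminorm hq j).trans_lt hB.lt_top).ne)]

lemma hasSum_norm_waveletCoeff_rpow (hB : besovSeminorm η τ q f ≠ ∞)
    (hτ : 0 < τ) (hq : 0 < q) (j : ℤ) :
    HasSum (fun κ : LevelIndex d => ‖waveletCoeff η f (j, κ)‖ ^ τ)
      ((levelEnergy η τ f j).toReal ^ τ) := by
  refine hasSum_of_tsum_ofReal_eq (fun κ => by positivity) (by positivity) ?_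
  rw [ENNReal.toReal_rpow, ENNReal.ofReal_toReal (ENNReal.rpow_ne_top_of_nonneg hτ.le
    ((levelEnergy_le_besovSeminorm hq j).trans_lt hB.lt_top).ne), ← tsum_enorm_waveletCoeff_rpow hτ]
  refine tsum_congr fun κ => ?_
  rw [← ENNReal.ofReal_rpow_of_nonneg (norm_nonneg _) hτ.le, ofReal_norm]

lemma norm_waveletCoeff_le (hB : besovSeminorm η τ q f ≠ ∞)
    (hτ : 0 < τ) (hq : 0 < q) (j : ℤ) (κ : LevelIndex d) :
    ‖waveletCoeff η f (j, κ)‖ ≤ (levelEnergy η τ f j).toReal := by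
  rw [← Real.rpow_le_rpow_iff (norm_nonneg _) ENNReal.toReal_nonneg hτ]
  exact le_hasSum (hasSum_norm_waveletCoeff_rpow hB hτ hq j) κ fun _ _ => by positivity

lemma tendsto_waveletCoeff (hB : besovSeminorm η τ q f ≠ ∞)
    (hτ : 0 < τ) (hq : 0 < q) (j : ℤ) :
    Filter.Tendsto (fun κ : LevelIndex d => waveletCoeff η f (j, κ)) Filter.cofinite (nhds 0) := by
  rw [tendsto_zero_iff_norm_tendsto_zero]
  have h := (hasSum_norm_waveletCoeff_rpow hB hτ hq j).summable.tendsto_cofinite_zero.rpow_const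
    (p := 1 / τ) (Or.inr (by positivity))
  rw [Real.zero_rpow (by positivity)] at h
  refine h.congr fun κ => ?_
  rw [← Real.rpow_mul (norm_nonneg _), mul_one_div_cancel hτ.ne', Real.rpow_one]

/-- Since `q ≤ 1`, `A_j = A_j^q A_j^(1-q) ≤ A_j^q |f|^(1-q)`. This summability makes the wavelet
series converge absolutely and uniformly over levels. -/
lemma summable_levelEnergy_toReal (hB : besovSeminorm η τ q f ≠ ∞) (hq : 0 < q) (hq1 : q ≤ 1) :
    Summable fun j => (levelEnergy η τ f j).toReal := by
  refine ((hasSum_levelEnergy_toReal_rpow hB hq).summable.mul_right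
    ((besovSeminorm η τ q f).toReal ^ (1 - q))).of_nonneg_of_le (fun _ => ENNReal.toReal_nonneg)
    fun j => ?_
  have h1 : (levelEnergy η τ f j).toReal ≤ (besovSeminorm η τ q f).toReal :=
    ENNReal.toReal_mono hB (levelEnergy_le_besovSeminorm hq j)
  calc (levelEnergy η τ f j).toReal
      = (levelEnergy η τ f j).toReal ^ q * (levelEnergy η τ f j).toReal ^ (1 - q) := by
        rw [← Real.rpow_add' ENNReal.toReal_nonneg (by norm_num), add_sub_cancel, Real.rpow_one]
    _ ≤ _ := mul_le_mul_of_nonneg_left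
        (Real.rpow_le_rpow ENNReal.toReal_nonneg h1 (by linarith)) (by positivity)

/-- Over one level the costs sum to `N |f|^(-q) A_j^(q-τ) A_j^τ = N |f|^(-q) A_j^q`, and over the
levels to `N`. Only inequality is claimed because everything vanishes when `|f| = 0`. -/
lemma summable_besovCost (hB : besovSeminorm η τ q f ≠ ∞)
    (hτ : 0 < τ) (hq : 0 < q) (N : ℕ) :
    Summable (besovCost η τ q N f) ∧ ∑' i, besovCost η τ q N f i ≤ N := by
  set a : ℤ → ℝ := fun j => (levelEnergy η τ f j).toReal with ha
  set b : ℝ := (besovSeminorm η τ q f).toReal with hb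
  have ha0 : ∀ j, 0 ≤ a j := fun j => ENNReal.toReal_nonneg
  have hb0 : 0 ≤ b := ENNReal.toReal_nonneg
  have hc0 : ∀ i, 0 ≤ besovCost η τ q N f i := fun i => by
    unfold besovCost
    positivity
  have hlev : ∀ j, HasSum (fun κ : LevelIndex d => besovCost η τ q N f (j, κ))
      (N * b ^ (-q) * a j ^ (q - τ) * a j ^ τ) := fun j =>
    (hasSum_norm_waveletCoeff_rpow hB hτ hq j).mul_left (N * b ^ (-q) * a j ^ (q - τ))
  have hle : ∀ j, N * b ^ (-q) * a j ^ (q - τ) * a j ^ τ ≤ N * b ^ (-q) * a j ^ q := by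
    intro j
    rcases (ha0 j).eq_or_lt with h | h
    · rw [← h, Real.zero_rpow hτ.ne', mul_zero]
      positivity
    · rw [mul_assoc, ← Real.rpow_add h, sub_add_cancel]
  have hsum := (hasSum_levelEnergy_toReal_rpow hB hq).mul_left (N * b ^ (-q))
  have hsj : Summable fun j => ∑' κ : LevelIndex d, besovCost η τ q N f (j, κ) := by
    refine hsum.summable.of_nonneg_of_le (fun j => tsum_nonneg fun _ => hc0 _) fun j => ?_
    rw [(hlev j).tsum_eq]
    exact hle j
  have hs : Summable (besovCost η τ q N f) :=
    (summable_prod_of_nonneg hc0).2 ⟨fun j => (hlev j).summable, hsj⟩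
  refine ⟨hs, ?_⟩
  rw [hs.tsum_prod]
  refine (hsj.tsum_le_tsum (fun j => ((hlev j).tsum_eq.trans_le (hle j))) hsum.summable).trans ?_
  rw [hsum.tsum_eq]
  rcases hb0.eq_or_lt with h | h
  · rw [← hb, ← h, Real.zero_rpow hq.ne', mul_zero]
    exact N.cast_nonneg
  · rw [← hb, mul_assoc, ← Real.rpow_add h, neg_add_cancel, Real.rpow_zero, mul_one]

/-- The relation between `q` and `τ` says `q / τ = 1 - q`. Raising the cost to the power `-1/τ`
therefore turns `|f|^(-q)` into `|f|^(1-q)`, `A_j^(q-τ)` into `A_j^q`, and `|f_I|^τ` into `|f_I|⁻¹`,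
which cancels the coefficient. -/
lemma norm_waveletCoeff_mul_rpow_le (hB : besovSeminorm η τ q f ≠ ∞)
    (hτ : 0 < τ) (hq : 0 < q) (hqτ : 1 / q = 1 + 1 / τ) {N : ℕ}
    (hN : 1 ≤ N) (i : WaveletIndex d) {n : ℝ} (hn : besovCost η τ q N f i ≤ n) :
    ‖waveletCoeff η f i‖ * n ^ (-(1 / τ)) ≤ (N : ℝ) ^ (-(1 / τ)) *
      (besovSeminorm η τ q f).toReal ^ (1 - q) * (levelEnergy η τ f i.1).toReal ^ q := by
  have hle : ‖waveletCoeff η f i‖ ≤ (levelEnergy η τ f i.1).toReal :=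
    norm_waveletCoeff_le hB hτ hq i.1 i.2
  have hle2 : (levelEnergy η τ f i.1).toReal ≤ (besovSeminorm η τ q f).toReal :=
    ENNReal.toReal_mono hB (levelEnergy_le_besovSeminorm hq i.1)
  rw [besovCost] at hn
  generalize (levelEnergy η τ f i.1).toReal = a at *
  generalize (besovSeminorm η τ q f).toReal = b at *
  rcases (norm_nonneg (waveletCoeff η f i)).eq_or_lt with hc | hc
  · have ha : 0 ≤ a := hc.trans_le hle
    have hb : 0 ≤ b := ha.trans hle2
    rw [← hc, zero_mul]
    positivity
  generalize ‖waveletCoeff η f i‖ = c at *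
  have ha : 0 < a := hc.trans_le hle
  have hb : 0 < b := ha.trans_le hle2
  have hN0 : (0 : ℝ) < N := by exact_mod_cast hN
  have h1 : q * (1 / τ) = 1 - q := by
    have : q * (1 / q) = q * (1 + 1 / τ) := by rw [hqτ]
    rw [mul_one_div_cancel hq.ne'] at this
    linarith
  have h2 : n ^ (-(1 / τ)) ≤ ((N : ℝ) * b ^ (-q) * a ^ (q - τ) * c ^ τ) ^ (-(1 / τ)) :=
    Real.rpow_le_rpow_of_nonpos (by positivity) hn (by simp [hτ.le])
  have h3 : ((N : ℝ) * b ^ (-q) * a ^ (q - τ) * c ^ τ) ^ (-(1 / τ)) =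
      (N : ℝ) ^ (-(1 / τ)) * b ^ (1 - q) * a ^ q * c⁻¹ := by
    rw [Real.mul_rpow (by positivity) (by positivity), Real.mul_rpow (by positivity) (by positivity),
      Real.mul_rpow (by positivity) (by positivity), ← Real.rpow_mul hb.le, ← Real.rpow_mul ha.le,
      ← Real.rpow_mul hc.le]
    have e1 : -q * -(1 / τ) = 1 - q := by rw [neg_mul_neg, h1]
    have e2 : (q - τ) * -(1 / τ) = q := by
      have : τ * (1 / τ) = 1 := mul_one_div_cancel hτ.ne'
      linarith
    have e3 : τ * -(1 / τ) = -1 := by rw [mul_neg, mul_one_div_cancel hτ.ne']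
    rw [e1, e2, e3, Real.rpow_neg_one]
  calc c * n ^ (-(1 / τ)) ≤ c * ((N : ℝ) ^ (-(1 / τ)) * b ^ (1 - q) * a ^ q * c⁻¹) :=
        mul_le_mul_of_nonneg_left (h2.trans_eq h3) hc.le
    _ = _ := by field_simp

lemma summable_mul_of_tsum_le {α β : Type*} {u : α → ℝ} (hu0 : ∀ j, 0 ≤ u j) (hu : Summable u)
    {p : α × β → ℝ} (hp0 : ∀ i, 0 ≤ p i) {L : ℝ}
    (hp : ∀ j, (Summable fun κ => p (j, κ)) ∧ ∑' κ, p (j, κ) ≤ L) :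
    (Summable fun i => u i.1 * p i) ∧ ∑' i, u i.1 * p i ≤ (∑' j, u j) * L := by
  have hle : ∀ j, ∑' κ, u j * p (j, κ) ≤ u j * L := fun j => by
    rw [tsum_mul_left]
    exact mul_le_mul_of_nonneg_left (hp j).2 (hu0 j)
  have hpos : ∀ i, 0 ≤ u i.1 * p i := fun i => mul_nonneg (hu0 _) (hp0 i)
  have hsj : Summable fun j => ∑' κ, u j * p (j, κ) :=
    Summable.of_nonneg_of_le (fun j => tsum_nonneg fun κ => hpos (j, κ)) hle (hu.mul_right L)
  have hs : Summable fun i => u i.1 * p i :=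
    (summable_prod_of_nonneg (f := fun i => u i.1 * p i) hpos).2
      ⟨fun j => (hp j).1.mul_left (u j), hsj⟩
  refine ⟨hs, ?_⟩
  rw [hs.tsum_prod, ← tsum_mul_right]
  exact hsj.tsum_le_tsum hle (hu.mul_right _)

end Besov

/-! ### Assembly of the Gaussian approximant -/

/-- Nonlinear `L_∞` approximation from Besov spaces by `N` Gaussians, with the budget of Gaussians
allocated to the wavelets by the Besov cost distribution. -/
theorem theorem4p2 {d : ℕ} (hd : 0 < d) (η : Fin 2 → 𝓢(ℝ, ℂ)) (hη : IsWaveletSystem η) :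
    ∃ N₀ : ℕ, ∀ s τ q : ℝ, 0 < s → 1 / τ = s / d → 1 / q = 1 + s / d →
      ∃ C : ℝ, 0 < C ∧ ∀ N : ℕ, 1 ≤ N →
        ∀ f : EuclideanSpace ℝ (Fin d) → ℂ, MemBesov η τ q f →
          ∃ s_f : EuclideanSpace ℝ (Fin d) → ℂ,
            IsGaussianSum N s_f ∧
            eLpNorm (fun x => f x - s_f x) ∞ volume
              ≤ ENNReal.ofReal (C * (N : ℝ) ^ (-(s / d))) * besovSeminorm η τ q f ∧
            {i : WaveletIndex d | besovBudget η τ q N₀ N f i ≠ 0}.Finite ∧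
            ∑ᶠ i : WaveletIndex d, besovBudget η τ q N₀ N f i ≤ N ∧
            ∃ S : WaveletIndex d → EuclideanSpace ℝ (Fin d) → ℂ,
              (∀ i, IsGaussianSum (besovBudget η τ q N₀ N f i) (S i)) ∧
              ∀ x, s_f x = ∑ᶠ i : WaveletIndex d, waveletCoeff η f i * S i x := by
  -- The wavelet approximation holds for every budget, including `0`, so no threshold is needed and
  -- the budget is just the floor of the cost.
  refine ⟨0, fun s τ q hs hτs hqs => ?_⟩
  have hd0 : (0 : ℝ) < d := by exact_mod_cast hd
  have hρ : 0 < 1 / τ := by rw [hτs]; positivity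
  have hτ : 0 < τ := one_div_pos.1 hρ
  have hq : 0 < q := by
    have : 0 < 1 / q := by rw [hqs]; positivity
    exact one_div_pos.1 this
  have hqτ : 1 / q = 1 + 1 / τ := by rw [hqs, hτs]
  have hq1 : q ≤ 1 := by
    have : 1 ≤ 1 / q := by rw [hqτ]; linarith
    rwa [le_div_iff₀ hq, one_mul] at this
  obtain ⟨C, hC, hG⟩ := exists_isGaussianSum_norm_waveletFun_sub_le hd hη.bandlimited hρ.le
  -- The summand `1` only secures positivity of the constant; the estimate itself gives `C *
  -- levelSum d`.
  refine ⟨C * (levelSum d + 1), mul_pos hC (by linarith [levelSum_nonneg d]),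
    fun N hN f hf => ?_⟩
  obtain ⟨M, hM⟩ := hf.tempered
  have hB := hf.finite.ne
  set b : ℝ := (besovSeminorm η τ q f).toReal with hb
  set a : ℤ → ℝ := fun j => (levelEnergy η τ f j).toReal with ha
  set B : WaveletIndex d → ℕ := besovBudget η τ q 0 N f with hBud
  have ha0 : ∀ j, 0 ≤ a j := fun j => ENNReal.toReal_nonneg
  have hb0 : 0 ≤ b := ENNReal.toReal_nonneg
  have hB_eq : ∀ i, B i = ⌊besovCost η τ q N f i⌋₊ := fun i => by simp [hBud, besovBudget]
  have hcost0 : ∀ i, 0 ≤ besovCost η τ q N f i := fun i => by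
    unfold besovCost
    positivity
  obtain ⟨hcs, hcN⟩ := summable_besovCost hB hτ hq N
  -- A nonzero budget means a cost of at least `1`, which happens finitely often because the costs
  -- are summable.
  have hfin : {i | B i ≠ 0}.Finite := by
    refine (Filter.eventually_cofinite.1
      (hcs.tendsto_cofinite_zero.eventually_lt_const one_pos)).subset fun i hi => ?_
    intro hlt
    exact hi (by rw [hB_eq, Nat.floor_eq_zero]; exact hlt)
  have hsupp : ∀ i, i ∉ hfin.toFinset → B i = 0 := fun i hi => by simpa using hi
  have hbudget : ∑ i ∈ hfin.toFinset, B i ≤ N := by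
    have h1 : ((∑ i ∈ hfin.toFinset, B i : ℕ) : ℝ) ≤ N := by
      rw [Nat.cast_sum]
      refine le_trans (Finset.sum_le_sum fun i _ => ?_)
        ((hcs.sum_le_tsum _ fun i _ => hcost0 i).trans hcN)
      rw [hB_eq]
      exact Nat.floor_le (hcost0 i)
    exact_mod_cast h1
  choose S hS hSle using fun i => hG i (B i)
  -- A combination of zero Gaussians is the zero function, so the formal sum over all wavelets is a
  -- finite one.
  have hS0 : ∀ i, i ∉ hfin.toFinset → ∀ x, S i x = 0 := by
    intro i hi x
    have h1 := hS i
    rw [hsupp i hi] at h1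
    obtain ⟨A, ξ, σ, -, h2⟩ := h1
    rw [h2 x, Fin.sum_univ_zero]
  have hfinsum : ∀ x, ∑ i ∈ hfin.toFinset, waveletCoeff η f i * S i x =
      ∑ᶠ i, waveletCoeff η f i * S i x := fun x =>
    (finsum_eq_sum_of_support_subset _ fun i hi => by
      by_contra hi'
      exact hi (by simp only [hS0 i hi' x, mul_zero])).symm
  refine ⟨fun x => ∑ i ∈ hfin.toFinset, waveletCoeff η f i * S i x,
    IsGaussianSum.sum_mul hS _ _ hbudget, ?_, hfin, ?_, S, hS, hfinsum⟩
  · obtain ⟨hsm, hrec⟩ := hη.ae_eq_tsum hd hτ hf.memLp hM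
      (summable_levelEnergy_toReal hB hq hq1) (norm_waveletCoeff_le hB hτ hq)
      ha0 (tendsto_waveletCoeff hB hτ hq)
    set D : ℝ := C * ((N : ℝ) ^ (-(1 / τ)) * b ^ (1 - q)) with hD
    have hD0 : 0 ≤ D := by positivity
    have hpb : b ^ q * b ^ (1 - q) = b := by
      rw [← Real.rpow_add' hb0 (by norm_num), add_sub_cancel, Real.rpow_one]
    have hterm : ∀ i x, ‖waveletCoeff η f i * waveletFun η i x - waveletCoeff η f i * S i x‖ ≤
        D * a i.1 ^ q * ∏ m, decay 2 (x m / 2 ^ i.1 - i.2.1 m) := by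
      intro i x
      have hp0 : 0 ≤ ∏ m, decay 2 (x m / 2 ^ i.1 - i.2.1 m) :=
        Finset.prod_nonneg fun _ _ => decay_nonneg _ _
      -- This bound covers wavelets with and without Gaussians alike, so the discarded wavelets need
      -- no separate estimate.
      have h1 : besovCost η τ q N f i ≤ 1 + B i := by
        rw [hB_eq, add_comm]
        exact (Nat.lt_floor_add_one _).le
      have h2 := norm_waveletCoeff_mul_rpow_le hB hτ hq hqτ hN i h1
      rw [← mul_sub, norm_mul]
      calc _ ≤ ‖waveletCoeff η f i‖ * (C * (1 + B i : ℝ) ^ (-(1 / τ)) *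
            ∏ m, decay 2 (x m / 2 ^ i.1 - i.2.1 m)) :=
            mul_le_mul_of_nonneg_left (hSle i x) (norm_nonneg _)
        _ = C * (‖waveletCoeff η f i‖ * (1 + B i : ℝ) ^ (-(1 / τ))) *
            ∏ m, decay 2 (x m / 2 ^ i.1 - i.2.1 m) := by ring
        _ ≤ C * ((N : ℝ) ^ (-(1 / τ)) * b ^ (1 - q) * a i.1 ^ q) *
            ∏ m, decay 2 (x m / 2 ^ i.1 - i.2.1 m) :=
            mul_le_mul_of_nonneg_right (mul_le_mul_of_nonneg_left h2 hC.le) hp0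
        _ = _ := by rw [hD]; ring
    have hbound : ∀ x : EuclideanSpace ℝ (Fin d),
        (Summable fun i : WaveletIndex d =>
          D * a i.1 ^ q * ∏ m, decay 2 (x m / 2 ^ i.1 - i.2.1 m)) ∧
        ∑' i : WaveletIndex d, D * a i.1 ^ q * ∏ m, decay 2 (x m / 2 ^ i.1 - i.2.1 m) ≤
          C * levelSum d * (N : ℝ) ^ (-(1 / τ)) * b := by
      intro x
      have hsum := (hasSum_levelEnergy_toReal_rpow hB hq).mul_left D
      obtain ⟨h1, h2⟩ := summable_mul_of_tsum_le (u := fun j => D * a j ^ q)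
        (p := fun i : WaveletIndex d => ∏ m, decay 2 (x m / 2 ^ i.1 - i.2.1 m))
        (fun j => by positivity) hsum.summable
        (fun i => Finset.prod_nonneg fun _ _ => decay_nonneg _ _)
        fun j => summable_levelIndex_decay fun m => x m / 2 ^ j
      refine ⟨h1, h2.trans_eq ?_⟩
      rw [hsum.tsum_eq, ← hb, hD]
      linear_combination C * (N : ℝ) ^ (-(1 / τ)) * levelSum d * hpb
    have hae : ∀ᵐ x, ‖f x - ∑ i ∈ hfin.toFinset, waveletCoeff η f i * S i x‖ ≤
        C * (levelSum d + 1) * (N : ℝ) ^ (-(s / d)) * b := by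
      filter_upwards [hrec] with x hx
      have h1 : HasSum (fun i => waveletCoeff η f i * S i x)
          (∑ i ∈ hfin.toFinset, waveletCoeff η f i * S i x) :=
        hasSum_sum_of_ne_finset_zero fun i hi => by rw [hS0 i hi, mul_zero]
      have h2 := (hsm x).of_norm.hasSum.sub h1
      rw [hx, ← h2.tsum_eq]
      refine (tsum_of_norm_bounded (hbound x).1.hasSum fun i => hterm i x).trans
        ((hbound x).2.trans ?_)
      rw [hτs]
      have : 0 ≤ C * (N : ℝ) ^ (-(s / d)) * b := by positivity
      linarith
    rw [eLpNorm_exponent_top]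
    refine (eLpNormEssSup_le_of_ae_bound hae).trans_eq ?_
    rw [ENNReal.ofReal_mul (mul_nonneg (mul_nonneg hC.le
      (by linarith [levelSum_nonneg d])) (by positivity)), hb, ENNReal.ofReal_toReal hB]
  · rw [finsum_eq_sum_of_support_subset (s := hfin.toFinset) _ fun i hi => by simpa using hi]
    exact hbudget
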